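/- An \emph{Arveson system} is a measurable family $\mathcal E=(\mathcal E_t)_{t\ge 0}$ of separable complex Hilbert spaces together with a measurable family of unitaries $\mathcal E_s\otimes\mathcal E_t\to\mathcal E_{s+t}$ ($s,t\ge 0$) that is associative; one writes $\mathcal E_s\otimes\mathcal E_t=\mathcal E_{s+t}$. A \emph{product subsystem} of $\mathcal E$ is a family of closed subspaces $\mathcal S_t\subset\mathcal E_t$ with $\mathcal S_s\otimes\mathcal S_t=\mathcal S_{s+t}$ for all $s,t\ge0$; it is itself an Arveson system. A \emph{unital unit} of $\mathcal E$ is a measurable section $u=(u_t)_{t\ge0}$ of unit vectors $u_t\in\mathcal E_t$ with $u_s\otimes u_t=u_{s+t}$, and $(\mathcal E,u)$ is then called a \emph{spatial Arveson system}. The \emph{spatial product} $\mathcal E\,{}_u\!\otimes_v\mathcal F$ of two spatial Arveson systems $(\mathcal E,u)$, $(\mathcal F,v)$ is the smallest product subsystem of $\mathcal E\otimes\mathcal F=(\mathcal E_t\otimes\mathcal F_t)_{t\ge0}$ that contains $u_t\otimes\mathcal F_t$ and $\mathcal E_t\otimes v_t$ for all $t\ge 0$. \textbf{Theorem.} (1)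 Let $(\mathcal E,u)$, $(\mathcal E,u')$, $(\mathcal F,v)$, $(\mathcal F,v')$ be spatial Arveson systems. Then $\mathcal E\,{}_u\!\otimes_v\mathcal F=\mathcal E\,{}_{u'}\!\otimes_{v'}\mathcal F$ as product subsystems of $\mathcal E\otimes\mathcal F$. In particular, the two spatial products are isomorphic Arveson systems (there is a measurable family of unitaries between the fibres that respects the products). (2) Let $\vartheta^1,\vartheta^2$ be $E_0$-semigroups (pointwise strongly continuous semigroups $(\vartheta^i_t)_{t\ge0}$ of normal unital $*$-endomorphisms) on $B(H_1)$, $B(H_2)$, where $H_1,H_2$ are nonzero separable complex Hilbert spaces. For strongly continuous semigroups $U^i=(U^i_t)_{t\ge0}$ of isometries in $B(H_i)$ that intertwine $\vartheta^i$, that is, $\vartheta^i_t(a)U^i_t=U^i_t a$ for all $a\in B(H_i)$ and $t\ge 0$, the \emph{Powers sum} is the Markov semigroup on $B(H_1\oplus H_2)$ given by $$T_t\begin{pmatrix}a_{11}&a_{12}\\a_{21}&a_{22}\end{pmatrix}=\begin{pmatrix}\vartheta^1_t(a_{11})&U^1_t\,a_{12}\,(U^2_t)^*\\U^2_t\,a_{21}\,(U^1_t)^*&\vartheta^2_t(a_{22})\end{pmatrix}.$$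 A \emph{minimal dilation} of $T$ is an $E_0$-semigroup $\theta$ on $B(K)$, with $K$ a separable Hilbert space containing $H_1\oplus H_2$ and $p$ the projection of $K$ onto $H_1\oplus H_2$, such that $T_t(a)=p\,\theta_t(a)\,p$ for all $a\in B(H_1\oplus H_2)=pB(K)p$ and $t\ge 0$, and such that the vectors $\theta_{t_1}(a_1)\cdots\theta_{t_n}(a_n)h$ with $n\ge0$, $t_1\ge\dots\ge t_n\ge0$, $a_i\in B(H_1\oplus H_2)$, $h\in H_1\oplus H_2$ span a dense subspace of $K$. If $U^i$ and $U'^i$ are two such intertwining semigroups for $\vartheta^i$ ($i=1,2$), if $\theta$ is a minimal dilation of the Powers sum formed with $U^1,U^2$ and $\theta'$ one of the Powers sum formed with $U'^1,U'^2$, then $\theta$ and $\theta'$ are cocycle conjugate: there are a unitary $W:K\to K'$ and a strongly continuous family of unitaries $C_t\in B(K')$, $t\ge 0$, with $C_{s+t}=C_s\,\theta'_s(C_t)$ and $W\theta_t(a)W^*=C_t\,\theta'_t(WaW^*)\,C_t^*$ for all $a\in B(K)$ and $s,t\ge 0$. -/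

import Mathlib

open scoped NNReal TensorProduct

universe u v w w'

/-- An Arveson system: a measurable family of separable Hilbert spaces `E_t`, `t ≥ 0`, with a
measurable associative family of unitaries `E_s ⊗ E_t → E_{s+t}`.

* The measurable structure of the family is given by a fundamental sequence of sections: their inner
  products are measurable and they are total in every `E_t`, so every `E_t` is separable. A section
  `x` is measurable if all the functions `t ↦ ⟪fund n t, x t⟫` are.
* The unitaries are given by the products `x y` which are the images of the elementary tensors
  `x ⊗ y`: a bilinear map extends to a unitary of the Hilbert space tensor product if and only if it
  multiplies inner products and the products are total. For convenience the product takes values in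
  `E_r` for every `r` that is equal to `s + t`. -/
structure ArvesonSystem where
  space : ℝ≥0 → Type u
  [normedAddCommGroup : ∀ t, NormedAddCommGroup (space t)]
  [innerProductSpace : ∀ t, InnerProductSpace ℂ (space t)]
  [completeSpace : ∀ t, CompleteSpace (space t)]
  fund : ℕ → ∀ t, space t
  measurable_inner_fund : ∀ m n, Measurable fun t => inner ℂ (fund m t) (fund n t)
  total_fund : ∀ t, (Submodule.span ℂ (Set.range fun n => fund n t)).topologicalClosure = ⊤
  mul : ∀ {s t r : ℝ≥0}, s + t = r → space s →ₗ[ℂ] space t →ₗ[ℂ] space r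
  inner_mul_mul : ∀ {s t r : ℝ≥0} (h : s + t = r) (x x' : space s) (y y' : space t),
    inner ℂ (mul h x y) (mul h x' y') = inner ℂ x x' * inner ℂ y y'
  total_mul : ∀ {s t r : ℝ≥0} (h : s + t = r),
    (Submodule.span ℂ {z | ∃ x y, mul h x y = z}).topologicalClosure = ⊤
  measurable_mul : ∀ k m n,
    Measurable fun p : ℝ≥0 × ℝ≥0 =>
      inner ℂ (fund k (p.1 + p.2)) (mul rfl (fund m p.1) (fund n p.2))
  mul_assoc : ∀ {r s t rs st rst : ℝ≥0} (hrs : r + s = rs) (hst : s + t = st)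
    (h₁ : rs + t = rst) (h₂ : r + st = rst) (x : space r) (y : space s) (z : space t),
    mul h₁ (mul hrs x y) z = mul h₂ x (mul hst y z)

namespace ArvesonSystem

attribute [instance] normedAddCommGroup innerProductSpace completeSpace

section Bilinear

variable {X Y Z : Type*} [NormedAddCommGroup X] [InnerProductSpace ℂ X]
  [NormedAddCommGroup Y] [InnerProductSpace ℂ Y] [NormedAddCommGroup Z] [InnerProductSpace ℂ Z]

theorem norm_bilin (B : X →ₗ[ℂ] Y →ₗ[ℂ] Z)
    (hB : ∀ x x' y y', inner ℂ (B x y) (B x' y') = inner ℂ x x' * inner ℂ y y') (x : X) (y : Y) :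
    ‖B x y‖ = ‖x‖ * ‖y‖ := by
  have h := hB x x y y
  simp only [inner_self_eq_norm_sq_to_K] at h
  have h2 : ‖B x y‖ ^ 2 = (‖x‖ * ‖y‖) ^ 2 := by
    rw [mul_pow]; exact_mod_cast h
  exact (pow_left_inj₀ (norm_nonneg _) (by positivity) two_ne_zero).1 h2

/-- A bilinear map with multiplicative inner products, as a continuous bilinear map. -/
noncomputable def bilinL (B : X →ₗ[ℂ] Y →ₗ[ℂ] Z)
    (hB : ∀ x x' y y', inner ℂ (B x y) (B x' y') = inner ℂ x x' * inner ℂ y y') :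
    X →L[ℂ] Y →L[ℂ] Z :=
  B.mkContinuous₂ 1 fun x y => by rw [norm_bilin B hB, one_mul]

open UniformSpace (Completion)

/-- The extension by continuity of such a bilinear map to the completions. -/
noncomputable def complBilin (B : X →ₗ[ℂ] Y →ₗ[ℂ] Z)
    (hB : ∀ x x' y y', inner ℂ (B x y) (B x' y') = inner ℂ x x' * inner ℂ y y') :
    Completion X →L[ℂ] Completion Y →L[ℂ] Completion Z :=
  ((((ContinuousLinearMap.compL ℂ Y Z (Completion Z) Completion.toComplL).comp
    (bilinL B hB)).extend (Completion.toComplL (𝕜 := ℂ))).flip.extend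
      (Completion.toComplL (𝕜 := ℂ))).flip

theorem complBilin_coe (B : X →ₗ[ℂ] Y →ₗ[ℂ] Z)
    (hB : ∀ x x' y y', inner ℂ (B x y) (B x' y') = inner ℂ x x' * inner ℂ y y') (x : X) (y : Y) :
    complBilin B hB (x : Completion X) (y : Completion Y) = ((B x y : Z) : Completion Z) := by
  have hd : ∀ W : Type _, ∀ [NormedAddCommGroup W] [InnerProductSpace ℂ W],
      DenseRange (Completion.toComplL (𝕜 := ℂ) (E := W)) :=
    fun W _ _ => Completion.denseRange_coe
  have hd' : DenseRange (Completion.toComplL (𝕜 := ℂ) (E := Y)) := Completion.denseRange_coe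
  have hi : IsUniformInducing (Completion.toComplL (𝕜 := ℂ) (E := X)) :=
    Completion.isUniformInducing_coe X
  have hi' : IsUniformInducing (Completion.toComplL (𝕜 := ℂ) (E := Y)) :=
    Completion.isUniformInducing_coe Y
  unfold complBilin
  rw [ContinuousLinearMap.flip_apply]
  have e1 := ContinuousLinearMap.extend_eq
    ((((ContinuousLinearMap.compL ℂ Y Z (Completion Z) Completion.toComplL).comp
    (bilinL B hB)).extend (Completion.toComplL (𝕜 := ℂ))).flip) hd' hi' y
  have e2 := ContinuousLinearMap.extend_eq
    ((ContinuousLinearMap.compL ℂ Y Z (Completion Z) Completion.toComplL).comp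
    (bilinL B hB)) (hd X) hi x
  erw [e1]
  rw [ContinuousLinearMap.flip_apply]
  erw [e2]
  rfl

theorem inner_complBilin (B : X →ₗ[ℂ] Y →ₗ[ℂ] Z)
    (hB : ∀ x x' y y', inner ℂ (B x y) (B x' y') = inner ℂ x x' * inner ℂ y y')
    (x x' : Completion X) (y y' : Completion Y) :
    inner ℂ (complBilin B hB x y) (complBilin B hB x' y') = inner ℂ x x' * inner ℂ y y' := by
  have hc : Continuous fun p : Completion X × Completion Y => complBilin B hB p.1 p.2 :=
    (complBilin B hB).continuous₂
  induction x, x' using Completion.induction_on₂ with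
  | hp =>
    refine isClosed_eq ?_ ?_
    · exact (hc.comp (by fun_prop : Continuous fun p : Completion X × Completion X => (p.1, y))).inner
        (hc.comp (by fun_prop : Continuous fun p : Completion X × Completion X => (p.2, y')))
    · fun_prop
  | ih x x' =>
    induction y, y' using Completion.induction_on₂ with
    | hp =>
      refine isClosed_eq ?_ ?_
      · fun_prop
      · fun_prop
    | ih y y' => simp only [complBilin_coe, Completion.inner_coe, hB]

end Bilinear

theorem inner_map₂ {X Y Z X' Y' Z' : Type*} [NormedAddCommGroup X] [InnerProductSpace ℂ X]
    [NormedAddCommGroup Y] [InnerProductSpace ℂ Y] [NormedAddCommGroup Z] [InnerProductSpace ℂ Z]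
    [NormedAddCommGroup X'] [InnerProductSpace ℂ X'] [NormedAddCommGroup Y']
    [InnerProductSpace ℂ Y'] [NormedAddCommGroup Z'] [InnerProductSpace ℂ Z']
    (B : X →ₗ[ℂ] Y →ₗ[ℂ] Z) (B' : X' →ₗ[ℂ] Y' →ₗ[ℂ] Z')
    (hB : ∀ x x' y y', inner ℂ (B x y) (B x' y') = inner ℂ x x' * inner ℂ y y')
    (hB' : ∀ x x' y y', inner ℂ (B' x y) (B' x' y') = inner ℂ x x' * inner ℂ y y')
    (a a' : X ⊗[ℂ] X') (b b' : Y ⊗[ℂ] Y') :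
    inner ℂ (TensorProduct.map₂ B B' a b) (TensorProduct.map₂ B B' a' b') =
      inner ℂ a a' * inner ℂ b b' := by
  induction a with
  | zero => simp
  | add a₁ a₂ h₁ h₂ => simp only [map_add, LinearMap.add_apply, inner_add_left, h₁, h₂, add_mul]
  | tmul x₁ x₁' =>
    induction a' with
    | zero => simp
    | add a₁ a₂ h₁ h₂ => simp only [map_add, LinearMap.add_apply, inner_add_right, h₁, h₂, add_mul]
    | tmul x₂ x₂' =>
      induction b with
      | zero => simp
      | add a₁ a₂ h₁ h₂ => simp only [map_add, inner_add_left, h₁, h₂, mul_add]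
      | tmul y₁ y₁' =>
        induction b' with
        | zero => simp
        | add a₁ a₂ h₁ h₂ => simp only [map_add, inner_add_right, h₁, h₂, mul_add]
        | tmul y₂ y₂' =>
          simp only [TensorProduct.map₂_apply_tmul, TensorProduct.map_tmul, TensorProduct.inner_tmul,
            hB, hB']
          ring

/-- A closed subspace that contains the products of two total sets contains all products. -/
theorem bilin_mem {X Y Z : Type*} [NormedAddCommGroup X] [InnerProductSpace ℂ X]
    [NormedAddCommGroup Y] [InnerProductSpace ℂ Y] [NormedAddCommGroup Z] [InnerProductSpace ℂ Z]
    (B : X →L[ℂ] Y →L[ℂ] Z) (S : Set X) (T : Set Y) (M : Submodule ℂ Z)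
    (hM : IsClosed (M : Set Z)) (h : ∀ s ∈ S, ∀ t ∈ T, B s t ∈ M)
    {x : X} (hx : x ∈ (Submodule.span ℂ S).topologicalClosure)
    {y : Y} (hy : y ∈ (Submodule.span ℂ T).topologicalClosure) : B x y ∈ M := by
  have h1 : ∀ s ∈ S, B s y ∈ M := by
    intro s hs
    have : (Submodule.span ℂ T).topologicalClosure ≤ M.comap (B s).toLinearMap := by
      refine Submodule.topologicalClosure_minimal _ ?_ (hM.preimage (B s).continuous)
      rw [Submodule.span_le]
      intro t ht
      exact h s hs t ht
    exact this hy
  have : (Submodule.span ℂ S).topologicalClosure ≤ M.comap (B.flip y).toLinearMap := by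
    refine Submodule.topologicalClosure_minimal _ ?_ (hM.preimage (B.flip y).continuous)
    rw [Submodule.span_le]
    intro s hs
    exact h1 s hs
  exact this hx

open UniformSpace (Completion)

theorem tensor_total {X Y : Type*} [NormedAddCommGroup X] [InnerProductSpace ℂ X]
    [NormedAddCommGroup Y] [InnerProductSpace ℂ Y] (S : Set X) (T : Set Y)
    (hS : (Submodule.span ℂ S).topologicalClosure = ⊤)
    (hT : (Submodule.span ℂ T).topologicalClosure = ⊤)
    (M : Submodule ℂ (Completion (X ⊗[ℂ] Y))) (hM : IsClosed (M : Set (Completion (X ⊗[ℂ] Y))))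
    (h : ∀ s ∈ S, ∀ t ∈ T, ((s ⊗ₜ[ℂ] t : X ⊗[ℂ] Y) : Completion (X ⊗[ℂ] Y)) ∈ M) : M = ⊤ := by
  have h1 : ∀ (x : X) (y : Y), ((x ⊗ₜ[ℂ] y : X ⊗[ℂ] Y) : Completion (X ⊗[ℂ] Y)) ∈ M := by
    intro x y
    exact bilin_mem ((ContinuousLinearMap.compL ℂ Y (X ⊗[ℂ] Y) (Completion (X ⊗[ℂ] Y))
      Completion.toComplL).comp (TensorProduct.mkL ℂ X Y)) S T M hM h
      (hS ▸ Submodule.mem_top) (hT ▸ Submodule.mem_top)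
  rw [eq_top_iff]
  rintro z -
  induction z using Completion.induction_on with
  | hp => exact hM
  | ih a =>
    induction a with
    | zero => exact M.zero_mem
    | tmul x y => exact h1 x y
    | add a b ha hb => rw [Completion.coe_add]; exact M.add_mem ha hb

/-- The product `(x ⊗ y) (x' ⊗ y') = x x' ⊗ y y'` on Hilbert space tensor products. -/
noncomputable def tensorMul (E : ArvesonSystem.{u}) (F : ArvesonSystem.{v}) {s t r : ℝ≥0}
    (h : s + t = r) :
    Completion (E.space s ⊗[ℂ] F.space s) →L[ℂ] Completion (E.space t ⊗[ℂ] F.space t) →L[ℂ]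
      Completion (E.space r ⊗[ℂ] F.space r) :=
  complBilin (TensorProduct.map₂ (E.mul h) (F.mul h))
    (inner_map₂ _ _ (E.inner_mul_mul h) (F.inner_mul_mul h))

theorem tensorMul_coe (E : ArvesonSystem.{u}) (F : ArvesonSystem.{v}) {s t r : ℝ≥0}
    (h : s + t = r) (a : E.space s ⊗[ℂ] F.space s) (b : E.space t ⊗[ℂ] F.space t) :
    tensorMul E F h (a : Completion _) (b : Completion _) =
      ((TensorProduct.map₂ (E.mul h) (F.mul h) a b : E.space r ⊗[ℂ] F.space r) : Completion _) :=
  complBilin_coe _ _ _ _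

/-- The tensor product of two Arveson systems: the family of Hilbert space tensor products
`E_t ⊗ F_t`, with the product determined by `(x ⊗ y) (x' ⊗ y') = x x' ⊗ y y'`. -/
noncomputable def tensor (E : ArvesonSystem.{u}) (F : ArvesonSystem.{v}) :
    ArvesonSystem.{max u v} where
  space t := Completion (E.space t ⊗[ℂ] F.space t)
  fund n t := ((E.fund n.unpair.1 t ⊗ₜ[ℂ] F.fund n.unpair.2 t : E.space t ⊗[ℂ] F.space t) :
    Completion (E.space t ⊗[ℂ] F.space t))
  measurable_inner_fund m n := by
    simp only [Completion.inner_coe, TensorProduct.inner_tmul]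
    exact (E.measurable_inner_fund _ _).mul (F.measurable_inner_fund _ _)
  total_fund t := by
    refine tensor_total _ _ (E.total_fund t) (F.total_fund t) _
      (Submodule.isClosed_topologicalClosure _) ?_
    rintro _ ⟨m, rfl⟩ _ ⟨n, rfl⟩
    refine Submodule.le_topologicalClosure _ (Submodule.subset_span ⟨Nat.pair m n, ?_⟩)
    simp
  mul h := LinearMap.mk₂ ℂ (fun x y => tensorMul E F h x y) (by simp) (by simp) (by simp) (by simp)
  inner_mul_mul h x x' y y' := inner_complBilin _ _ x x' y y'
  total_mul h := by
    refine tensor_total _ _ (E.total_mul h) (F.total_mul h) _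
      (Submodule.isClosed_topologicalClosure _) ?_
    rintro _ ⟨x, y, rfl⟩ _ ⟨x', y', rfl⟩
    refine Submodule.le_topologicalClosure _ (Submodule.subset_span
      ⟨((x ⊗ₜ[ℂ] x' : E.space _ ⊗[ℂ] F.space _) : Completion _),
        ((y ⊗ₜ[ℂ] y' : E.space _ ⊗[ℂ] F.space _) : Completion _), ?_⟩)
    rw [LinearMap.mk₂_apply, tensorMul_coe, TensorProduct.map₂_apply_tmul, TensorProduct.map_tmul]
  measurable_mul k m n := by
    simp only [LinearMap.mk₂_apply, tensorMul_coe, Completion.inner_coe,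
      TensorProduct.map₂_apply_tmul, TensorProduct.map_tmul, TensorProduct.inner_tmul]
    exact (E.measurable_mul _ _ _).mul (F.measurable_mul _ _ _)
  mul_assoc hrs hst h₁ h₂ x y z := by
    simp only [LinearMap.mk₂_apply]
    induction x, y, z using Completion.induction_on₃ with
    | hp => refine isClosed_eq ?_ ?_ <;> fun_prop
    | ih a b c =>
      simp only [tensorMul_coe]
      congr 1
      induction a with
      | zero => simp
      | add a₁ a₂ h₁ h₂ => simp only [map_add, LinearMap.add_apply, h₁, h₂]
      | tmul x x' =>
        induction b with
        | zero => simp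
        | add a₁ a₂ h₁ h₂ => simp only [map_add, LinearMap.add_apply, h₁, h₂]
        | tmul y y' =>
          induction c with
          | zero => simp
          | add a₁ a₂ h₁ h₂ => simp only [map_add, h₁, h₂]
          | tmul z z' =>
            simp only [TensorProduct.map₂_apply_tmul, TensorProduct.map_tmul]
            rw [E.mul_assoc hrs hst h₁ h₂, F.mul_assoc hrs hst h₁ h₂]

variable (A : ArvesonSystem.{u})

/-- The product of an Arveson system as a continuous bilinear map. -/
noncomputable def mulL {s t r : ℝ≥0} (h : s + t = r) : A.space s →L[ℂ] A.space t →L[ℂ] A.space r :=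
  bilinL (A.mul h) (A.inner_mul_mul h)

/-- A product subsystem: closed subspaces `S_t` of `A_t` with `S_{s+t} = S_s ⊗ S_t`, the closed
linear span of the products. -/
@[ext]
structure Subsystem where
  carrier : ∀ t, Submodule ℂ (A.space t)
  isClosed : ∀ t, IsClosed (carrier t : Set (A.space t))
  mul_eq : ∀ {s t r : ℝ≥0} (h : s + t = r),
    (Submodule.span ℂ {z | ∃ x ∈ carrier s, ∃ y ∈ carrier t, A.mul h x y = z}).topologicalClosure =
      carrier r

variable {A}

namespace Subsystem

theorem mul_mem (S : Subsystem A) {s t r : ℝ≥0} (h : s + t = r) {x : A.space s} {y : A.space t}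
    (hx : x ∈ S.carrier s) (hy : y ∈ S.carrier t) : A.mul h x y ∈ S.carrier r := by
  rw [← S.mul_eq h]
  exact Submodule.le_topologicalClosure _ (Submodule.subset_span ⟨x, hx, y, hy, rfl⟩)

/-- Slices of elements of `S_{s+t}` lie in `S_s`. -/
theorem slice_left_mem (S : Subsystem A) {s t r : ℝ≥0} (h : s + t = r) {z : A.space r}
    (hz : z ∈ S.carrier r) (y : A.space t) :
    ContinuousLinearMap.adjoint ((A.mulL h).flip y) z ∈ S.carrier s := by
  have : S.carrier r ≤ (S.carrier s).comap
      (ContinuousLinearMap.adjoint ((A.mulL h).flip y)).toLinearMap := by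
    rw [← S.mul_eq h]
    refine Submodule.topologicalClosure_minimal _ ?_
      ((S.isClosed s).preimage (ContinuousLinearMap.continuous _))
    rw [Submodule.span_le]
    rintro _ ⟨x', hx', y', hy', rfl⟩
    have e : ContinuousLinearMap.adjoint ((A.mulL h).flip y) (A.mul h x' y') =
        inner ℂ y y' • x' := by
      refine ext_inner_left ℂ fun w => ?_
      rw [ContinuousLinearMap.adjoint_inner_right, inner_smul_right]
      exact (A.inner_mul_mul h w x' y y').trans (mul_comm _ _)
    change ContinuousLinearMap.adjoint ((A.mulL h).flip y) (A.mul h x' y') ∈ S.carrier s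
    rw [e]
    exact (S.carrier s).smul_mem _ hx'
  exact this hz

/-- Slices of elements of `S_{s+t}` lie in `S_t`. -/
theorem slice_right_mem (S : Subsystem A) {s t r : ℝ≥0} (h : s + t = r) {z : A.space r}
    (hz : z ∈ S.carrier r) (x : A.space s) :
    ContinuousLinearMap.adjoint (A.mulL h x) z ∈ S.carrier t := by
  have : S.carrier r ≤ (S.carrier t).comap
      (ContinuousLinearMap.adjoint (A.mulL h x)).toLinearMap := by
    rw [← S.mul_eq h]
    refine Submodule.topologicalClosure_minimal _ ?_
      ((S.isClosed t).preimage (ContinuousLinearMap.continuous _))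
    rw [Submodule.span_le]
    rintro _ ⟨x', hx', y', hy', rfl⟩
    have e : ContinuousLinearMap.adjoint (A.mulL h x) (A.mul h x' y') = inner ℂ x x' • y' := by
      refine ext_inner_left ℂ fun w => ?_
      rw [ContinuousLinearMap.adjoint_inner_right, inner_smul_right]
      exact A.inner_mul_mul h x x' w y'
    change ContinuousLinearMap.adjoint (A.mulL h x) (A.mul h x' y') ∈ S.carrier t
    rw [e]
    exact (S.carrier t).smul_mem _ hy'
  exact this hz

/-- The tensor product of two closed subspaces contains every element with all slices in them. -/
theorem mem_of_slices {s t r : ℝ≥0} (h : s + t = r) (P : Submodule ℂ (A.space s))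
    (Q : Submodule ℂ (A.space t)) (hP : IsClosed (P : Set (A.space s)))
    (hQ : IsClosed (Q : Set (A.space t))) (z : A.space r)
    (hl : ∀ y, ContinuousLinearMap.adjoint ((A.mulL h).flip y) z ∈ P)
    (hr : ∀ x, ContinuousLinearMap.adjoint (A.mulL h x) z ∈ Q) :
    z ∈ (Submodule.span ℂ {w | ∃ x ∈ P, ∃ y ∈ Q, A.mul h x y = w}).topologicalClosure := by
  set M := (Submodule.span ℂ {w | ∃ x ∈ P, ∃ y ∈ Q, A.mul h x y = w}).topologicalClosure with hM
  have : CompleteSpace M := (Submodule.isClosed_topologicalClosure _).completeSpace_coe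
  have : CompleteSpace P := hP.completeSpace_coe
  have : CompleteSpace Q := hQ.completeSpace_coe
  have hMo : ∀ w, (∀ x ∈ P, ∀ y ∈ Q, inner ℂ (A.mul h x y) w = 0) → ∀ m ∈ M, inner ℂ m w = 0 := by
    intro w hw m hm
    have : M ≤ (ℂ ∙ w)ᗮ := by
      refine Submodule.topologicalClosure_minimal _ ?_ (Submodule.isClosed_orthogonal _)
      rw [Submodule.span_le]
      rintro _ ⟨x, hx, y, hy, rfl⟩
      exact Submodule.mem_orthogonal_singleton_iff_inner_left.2 (hw x hx y hy)
    exact Submodule.mem_orthogonal_singleton_iff_inner_left.1 (this hm)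
  set n := z - M.starProjection z with hn
  have hnM : n ∈ Mᗮ := M.sub_starProjection_mem_orthogonal z
  have hm : M.starProjection z ∈ M := M.starProjection_apply_mem z
  -- `n` is orthogonal to all products
  have key : ∀ x y, inner ℂ n (A.mul h x y) = 0 := by
    have h1 : ∀ x ∈ Pᗮ, ∀ y, inner ℂ n (A.mul h x y) = 0 := by
      intro x hx y
      rw [hn, inner_sub_left, hMo (A.mul h x y) ?_ _ hm, sub_zero]
      · have e := ContinuousLinearMap.adjoint_inner_left ((A.mulL h).flip y) x z
        exact e.symm.trans (hx _ (hl y))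
      · intro x' hx' y' hy'
        rw [A.inner_mul_mul, hx x' hx', zero_mul]
    have h2 : ∀ x, ∀ y ∈ Qᗮ, inner ℂ n (A.mul h x y) = 0 := by
      intro x y hy
      rw [hn, inner_sub_left, hMo (A.mul h x y) ?_ _ hm, sub_zero]
      · have e := ContinuousLinearMap.adjoint_inner_left (A.mulL h x) y z
        exact e.symm.trans (hy _ (hr x))
      · intro x' hx' y' hy'
        rw [A.inner_mul_mul, hy y' hy', mul_zero]
    intro x y
    have ex : x = P.starProjection x + (x - P.starProjection x) := by abel
    have ey : y = Q.starProjection y + (y - Q.starProjection y) := by abel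
    rw [ex, map_add, LinearMap.add_apply, inner_add_right,
      h1 _ (P.sub_starProjection_mem_orthogonal x), add_zero, ey, map_add, inner_add_right,
      h2 _ _ (Q.sub_starProjection_mem_orthogonal y), add_zero]
    refine (Submodule.mem_orthogonal' _ _).1 hnM _ ?_
    exact Submodule.le_topologicalClosure _ (Submodule.subset_span
      ⟨_, P.starProjection_apply_mem x, _, Q.starProjection_apply_mem y, rfl⟩)
  have hn0 : n = 0 := by
    have : (⊤ : Submodule ℂ (A.space r)) ≤ (ℂ ∙ n)ᗮ := by
      rw [← A.total_mul h]
      refine Submodule.topologicalClosure_minimal _ ?_ (Submodule.isClosed_orthogonal _)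
      rw [Submodule.span_le]
      rintro _ ⟨x, y, rfl⟩
      exact Submodule.mem_orthogonal_singleton_iff_inner_right.2 (key x y)
    exact inner_self_eq_zero.1
      (Submodule.mem_orthogonal_singleton_iff_inner_right.1 (this Submodule.mem_top : n ∈ _))
  exact Submodule.starProjection_eq_self_iff.1 (sub_eq_zero.1 hn0).symm

/-- The pointwise intersection of a set of subsystems, which is again a subsystem. -/
noncomputable def sInf (C : Set (Subsystem A)) : Subsystem A where
  carrier t := ⨅ S ∈ C, S.carrier t
  isClosed t := by
    simp only [Submodule.coe_iInf]
    exact isClosed_iInter fun S => isClosed_iInter fun _ => S.isClosed t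
  mul_eq {s t r} h := by
    have hcl : ∀ t, IsClosed ((⨅ S ∈ C, S.carrier t : Submodule ℂ (A.space t)) :
        Set (A.space t)) := fun t => by
      simp only [Submodule.coe_iInf]
      exact isClosed_iInter fun S => isClosed_iInter fun _ => S.isClosed t
    apply le_antisymm
    · refine Submodule.topologicalClosure_minimal _ ?_ (hcl r)
      rw [Submodule.span_le]
      rintro _ ⟨x, hx, y, hy, rfl⟩
      simp only [SetLike.mem_coe, Submodule.mem_iInf] at hx hy ⊢
      exact fun S hS => S.mul_mem h (hx S hS) (hy S hS)
    · intro z hz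
      simp only [Submodule.mem_iInf] at hz
      refine mem_of_slices h _ _ (hcl s) (hcl t) z (fun y => ?_) fun x => ?_
      · simp only [Submodule.mem_iInf]
        exact fun S hS => S.slice_left_mem h (hz S hS) y
      · simp only [Submodule.mem_iInf]
        exact fun S hS => S.slice_right_mem h (hz S hS) x

instance (S : Subsystem A) (t : ℝ≥0) : CompleteSpace (S.carrier t) :=
  (S.isClosed t).completeSpace_coe

end Subsystem

/-- In a family of Hilbert spaces with a fundamental sequence, measurable sections have measurable
inner products. -/
theorem measurable_inner_sections {Ω : Type*} [MeasurableSpace Ω] {H : Ω → Type*}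
    [∀ t, NormedAddCommGroup (H t)] [∀ t, InnerProductSpace ℂ (H t)] (ξ : ℕ → ∀ t, H t)
    (hξ : ∀ m n, Measurable fun t => inner ℂ (ξ m t) (ξ n t))
    (htot : ∀ t, (Submodule.span ℂ (Set.range fun n => ξ n t)).topologicalClosure = ⊤)
    {f g : ∀ t, H t} (hf : ∀ n, Measurable fun t => inner ℂ (ξ n t) (f t))
    (hg : ∀ n, Measurable fun t => inner ℂ (ξ n t) (g t)) :
    Measurable fun t => inner ℂ (f t) (g t) := by
  let q : (Σ n : ℕ, ℕ) → ∀ t, H t := fun i t =>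
    ∑ k : Fin i.1, TopologicalSpace.denseSeq (Fin i.1 → ℂ) i.2 k • ξ k t
  have hqm : ∀ (i) (x : ∀ t, H t), (∀ n, Measurable fun t => inner ℂ (ξ n t) (x t)) →
      Measurable fun t => inner ℂ (q i t) (x t) := by
    intro i x hx
    simp only [q, sum_inner, inner_smul_left]
    exact Finset.measurable_sum _ fun k _ => (hx k).const_mul _
  have hqq : ∀ i, Measurable fun t => inner ℂ (q i t) (q i t) := by
    intro i
    refine hqm i _ fun n => ?_
    simp only [q, inner_sum, inner_smul_right]
    exact Finset.measurable_sum _ fun k _ => (hξ n k).const_mul _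
  have hdense : ∀ t, Dense (Set.range fun i => q i t) := by
    intro t
    have h1 : ((Submodule.span ℂ (Set.range fun n => ξ n t) : Submodule ℂ (H t)) : Set (H t)) ⊆
        closure (Set.range fun i => q i t) := by
      intro y hy
      obtain ⟨c, hc⟩ := (Finsupp.mem_span_range_iff_exists_finsupp).1 hy
      obtain ⟨n, hn⟩ := c.support.exists_nat_subset_range
      have e : y = ∑ k : Fin n, c k • ξ k t := by
        rw [← hc, Finsupp.sum_of_support_subset _ hn _ (by simp), ← Fin.sum_univ_eq_sum_range
          (fun k => c k • ξ k t)]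
      let L : (Fin n → ℂ) → H t := fun a => ∑ k : Fin n, a k • ξ k t
      have hL : Continuous L := by fun_prop
      have h2 := image_closure_subset_closure_image hL
        (s := Set.range (TopologicalSpace.denseSeq (Fin n → ℂ)))
      rw [(TopologicalSpace.denseRange_denseSeq (Fin n → ℂ)).closure_range] at h2
      rw [e]
      refine closure_mono ?_ (h2 ⟨fun k => c k, Set.mem_univ _, rfl⟩)
      rintro _ ⟨_, ⟨j, rfl⟩, rfl⟩
      exact ⟨⟨n, j⟩, rfl⟩
    rw [dense_iff_closure_eq, Set.eq_univ_iff_forall]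
    intro x
    have hx : x ∈ (Submodule.span ℂ (Set.range fun n => ξ n t)).topologicalClosure := by
      rw [htot]; exact Submodule.mem_top
    rw [← SetLike.mem_coe, Submodule.topologicalClosure_coe] at hx
    exact closure_minimal h1 isClosed_closure hx
  have hnorm : ∀ x : ∀ t, H t, (∀ n, Measurable fun t => inner ℂ (ξ n t) (x t)) →
      Measurable fun t => ((‖x t‖ : ℝ) : ℂ) ^ 2 := by
    intro x hx
    have hid : ∀ t i, 2 * (inner ℂ (q i t) (x t) : ℂ).re - ‖q i t‖ ^ 2 =
        ‖x t‖ ^ 2 - ‖q i t - x t‖ ^ 2 := by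
      intro t i
      have := @norm_sub_sq ℂ _ _ _ _ (q i t) (x t)
      simp only [RCLike.re_to_complex] at this
      linarith
    have e : ∀ t, ‖x t‖ ^ 2 = ⨆ i, (2 * (inner ℂ (q i t) (x t) : ℂ).re - ‖q i t‖ ^ 2) := by
      intro t
      simp only [hid]
      refine (ciSup_eq_of_forall_le_of_forall_lt_exists_gt (fun i => ?_) fun w hw => ?_).symm
      · linarith [sq_nonneg ‖q i t - x t‖]
      · have hc : Continuous fun y : H t => ‖x t‖ ^ 2 - ‖y - x t‖ ^ 2 := by fun_prop
        obtain ⟨_, hy, ⟨i, rfl⟩⟩ := (hdense t).inter_open_nonempty _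
          (isOpen_lt continuous_const hc : IsOpen {y | w < ‖x t‖ ^ 2 - ‖y - x t‖ ^ 2})
          ⟨x t, by simpa using hw⟩
        exact ⟨i, hy⟩
    have hm : Measurable fun t => ‖x t‖ ^ 2 := by
      simp only [e]
      refine Measurable.iSup fun i => ?_
      refine ((Complex.measurable_re.comp (hqm i x hx)).const_mul 2).sub ?_
      have h3 := Complex.measurable_re.comp (hqq i)
      have h4 : ∀ t, ‖q i t‖ ^ 2 = (inner ℂ (q i t) (q i t) : ℂ).re := fun t =>
        (inner_self_eq_norm_sq (𝕜 := ℂ) (q i t)).symm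
      simp only [h4]
      exact h3
    exact_mod_cast Complex.measurable_ofReal.comp hm
  simp only [inner_eq_sum_norm_sq_div_four (𝕜 := ℂ)]
  have hadd : ∀ x y : ∀ t, H t, (∀ n, Measurable fun t => inner ℂ (ξ n t) (x t)) →
      (∀ n, Measurable fun t => inner ℂ (ξ n t) (y t)) →
      ∀ c : ℂ, Measurable fun t => ((‖x t + c • y t‖ : ℝ) : ℂ) ^ 2 := by
    intro x y hx hy c
    refine hnorm _ fun n => ?_
    simp only [inner_add_right, inner_smul_right]
    exact (hx n).add ((hy n).const_mul c)
  have h1 := hadd f g hf hg 1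
  have h2 := hadd f g hf hg (-1)
  have h3 := hadd f g hf hg (-RCLike.I)
  have h4 := hadd f g hf hg RCLike.I
  simp only [one_smul, neg_smul, ← sub_eq_add_neg] at h1 h2 h3
  exact ((h1.sub h2).add ((h3.sub h4).mul_const _)).div_const 4

/-- Two weakly measurable functions into a separable Hilbert space have a measurable inner
product. -/
theorem measurable_inner_of_weak {Ω H : Type*} [MeasurableSpace Ω] [NormedAddCommGroup H]
    [InnerProductSpace ℂ H] [TopologicalSpace.SeparableSpace H] {f g : Ω → H}
    (hf : ∀ v, Measurable fun t => inner ℂ v (f t)) (hg : ∀ v, Measurable fun t => inner ℂ v (g t)) :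
    Measurable fun t => inner ℂ (f t) (g t) := by
  refine measurable_inner_sections (fun n _ => TopologicalSpace.denseSeq H n)
    (fun m n => measurable_const) (fun t => ?_) (fun n => hf _) (fun n => hg _)
  rw [eq_top_iff, ← SetLike.coe_subset_coe, Submodule.topologicalClosure_coe]
  refine Set.Subset.trans ?_ (closure_mono Submodule.subset_span)
  rw [(TopologicalSpace.denseRange_denseSeq H).closure_range]
  exact Set.subset_univ _

instance (A : ArvesonSystem.{u}) (t : ℝ≥0) : TopologicalSpace.SeparableSpace (A.space t) := by
  rw [← TopologicalSpace.isSeparable_univ_iff]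
  have h := ((Set.countable_range fun n => A.fund n t).isSeparable.span (R := ℂ)).closure
  rw [← Submodule.topologicalClosure_coe, A.total_fund t] at h
  exact h

theorem eq_zero_of_space_zero (A : ArvesonSystem.{u}) {T : ℝ≥0} (hT : 0 < T)
    (h : ∀ x : A.space T, x = 0) {t : ℝ≥0} (ht : 0 < t) (x : A.space t) : x = 0 := by
  have h2 : ∀ n : ℕ, ∀ x : A.space (T / 2 ^ n), x = 0 := by
    intro n
    induction n with
    | zero =>
      intro x
      have e : T / 2 ^ 0 = T := by simp
      revert x; rw [e]; exact h
    | succ n ih =>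
      intro x
      have e : T / 2 ^ (n + 1) + T / 2 ^ (n + 1) = T / 2 ^ n := by
        rw [← two_mul, pow_succ]; field_simp
      have := norm_bilin _ (A.inner_mul_mul e) x x
      rw [ih (A.mul e x x), norm_zero] at this
      exact norm_eq_zero.1 (mul_self_eq_zero.1 this.symm)
  obtain ⟨n, hn⟩ : ∃ n : ℕ, T / 2 ^ n < t := by
    obtain ⟨n, hn⟩ := pow_unbounded_of_one_lt (T / t) (one_lt_two : (1 : ℝ≥0) < 2)
    refine ⟨n, ?_⟩
    rw [div_lt_iff₀ ht] at hn
    rw [div_lt_iff₀ (by positivity), mul_comm]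
    exact hn
  have e : T / 2 ^ n + (t - T / 2 ^ n) = t := add_tsub_cancel_of_le hn.le
  have : (⊤ : Submodule ℂ (A.space t)) ≤ ⊥ := by
    rw [← A.total_mul e]
    refine Submodule.topologicalClosure_minimal _ ?_ (by simp)
    rw [Submodule.span_le]
    rintro _ ⟨y, z, rfl⟩
    rw [h2 n y]
    simp
  exact (Submodule.mem_bot ℂ).1 (this Submodule.mem_top)

/-- The products of members of the fundamental sequence, inside one fixed space, are weakly
measurable. -/
theorem measurable_weak_mul (A : ArvesonSystem.{u}) {N : ℝ≥0} {a b : ℝ≥0 → ℝ≥0}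
    (ha : Measurable a) (hb : Measurable b) (h : ∀ t, a t + b t = N) (m n : ℕ) (v : A.space N) :
    Measurable fun t => inner ℂ v (A.mul (h t) (A.fund m (a t)) (A.fund n (b t))) := by
  have h0 : ∀ k, Measurable fun t =>
      inner ℂ (A.fund k N) (A.mul (h t) (A.fund m (a t)) (A.fund n (b t))) := by
    intro k
    have aux : ∀ (p : ℝ≥0 × ℝ≥0) (r : ℝ≥0) (hr : p.1 + p.2 = r),
        inner ℂ (A.fund k r) (A.mul hr (A.fund m p.1) (A.fund n p.2)) =
          inner ℂ (A.fund k (p.1 + p.2)) (A.mul rfl (A.fund m p.1) (A.fund n p.2)) := by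
      rintro p r rfl; rfl
    have := (A.measurable_mul k m n).comp (ha.prodMk hb)
    have e : ∀ t, _ := fun t => aux (a t, b t) N (h t)
    simp only [e]
    exact this
  have hv : v ∈ (Submodule.span ℂ (Set.range fun k => A.fund k N)).topologicalClosure := by
    rw [A.total_fund]; exact Submodule.mem_top
  rw [← SetLike.mem_coe, Submodule.topologicalClosure_coe, mem_closure_iff_seq_limit] at hv
  obtain ⟨x, hx, hlim⟩ := hv
  refine measurable_of_tendsto_metrizable (f := fun i t =>
    inner ℂ (x i) (A.mul (h t) (A.fund m (a t)) (A.fund n (b t)))) (fun i => ?_) ?_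
  · have := hx i
    generalize x i = y at this
    induction this using Submodule.span_induction with
    | mem y hy => obtain ⟨k, rfl⟩ := hy; exact h0 k
    | zero => simp
    | add y z _ _ hy hz => simp only [inner_add_left]; exact hy.add hz
    | smul c y _ hy => simp only [inner_smul_left]; exact hy.const_mul _
  · rw [tendsto_pi_nhds]
    exact fun t => hlim.inner tendsto_const_nhds

/-- A monotone family of projections is weakly measurable. -/
theorem measurable_projections {H : Type*} [NormedAddCommGroup H] [InnerProductSpace ℂ H]
    (D : ℝ≥0 → Submodule ℂ H) [∀ t, (D t).HasOrthogonalProjection] (hD : Antitone D) (v w : H) :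
    Measurable fun t => inner ℂ v ((D t).starProjection w) := by
  have h1 : ∀ x, Measurable fun t => ((‖(D t).starProjection x‖ : ℝ) : ℂ) := by
    intro x
    refine Complex.measurable_ofReal.comp (Antitone.measurable ?_)
    intro s t hst
    have := Submodule.starProjection_comp_starProjection_of_le (hD hst)
    change ‖(D t).starProjection x‖ ≤ ‖(D s).starProjection x‖
    rw [← this]
    exact Submodule.norm_starProjection_apply_le _ _
  have h2 : ∀ t, inner ℂ v ((D t).starProjection w) =
      inner ℂ ((D t).starProjection v) ((D t).starProjection w) := by
    intro t
    rw [Submodule.inner_starProjection_left_eq_right,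
      Submodule.starProjection_eq_self_iff.2 (Submodule.starProjection_apply_mem _ w)]
  simp only [h2, inner_eq_sum_norm_sq_div_four, ← map_add, ← map_sub, ← map_smul]
  have := h1
  exact (((((h1 _).pow_const 2).sub ((h1 _).pow_const 2)).add
    ((((h1 _).pow_const 2).sub ((h1 _).pow_const 2)).mul_const _))).div_const 4

namespace Subsystem

/-- The family of projections onto a product subsystem is automatically measurable. -/
theorem measurable_starProjection (S : Subsystem A) (m n : ℕ) :
    Measurable fun t => inner ℂ (A.fund m t) ((S.carrier t).starProjection (A.fund n t)) := by
  set F : ℝ≥0 → ℂ := fun t => inner ℂ (A.fund m t) ((S.carrier t).starProjection (A.fund n t))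
    with hF
  by_cases hz : ∃ T : ℝ≥0, 0 < T ∧ ∀ x : A.space T, x = 0
  · obtain ⟨T, hT, h0⟩ := hz
    have : F = fun t => if t = 0 then F 0 else 0 := by
      funext t
      split_ifs with ht
      · rw [ht]
      · simp only [hF]
        rw [A.eq_zero_of_space_zero hT h0 (pos_iff_ne_zero.2 ht) (A.fund m t), inner_zero_left]
    rw [this]
    exact Measurable.ite (measurableSet_singleton 0) measurable_const measurable_const
  push Not at hz
  have hadd : ∀ (N t : ℝ≥0), min t N + (N - t) = N := by
    intro N t
    rcases le_total t N with h | h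
    · rw [min_eq_left h, add_tsub_cancel_of_le h]
    · rw [min_eq_right h, tsub_eq_zero_of_le h, add_zero]
  let D : ∀ N : ℝ≥0, ℝ≥0 → Submodule ℂ (A.space N) := fun N t =>
    (Submodule.span ℂ {z | ∃ x ∈ S.carrier (min t N), ∃ y, A.mul (hadd N t) x y = z}).topologicalClosure
  have hDcl : ∀ N t, IsClosed (D N t : Set (A.space N)) := fun N t =>
    Submodule.isClosed_topologicalClosure _
  have hDc : ∀ N t, CompleteSpace (D N t) := fun N t => (hDcl N t).completeSpace_coe
  have hDanti : ∀ N, Antitone (D N) := by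
    intro N t t' htt
    refine Submodule.topologicalClosure_minimal _ ?_ (hDcl N t)
    rw [Submodule.span_le]
    rintro _ ⟨x, hx, y, rfl⟩
    have e1 : min t N + (min t' N - min t N) = min t' N :=
      add_tsub_cancel_of_le (min_le_min_right N htt)
    have e2 : (min t' N - min t N) + (N - t') = N - t := by
      have h1 := hadd N t
      have h2 := hadd N t'
      rw [← e1, add_assoc] at h2
      exact add_left_cancel (h2.trans h1.symm)
    rw [← S.mul_eq e1] at hx
    refine bilin_mem (A.mulL (hadd N t')) _ {y} (D N t) (hDcl N t) ?_ hx
      (Submodule.le_topologicalClosure _ (Submodule.subset_span rfl))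
    rintro _ ⟨x₁, hx₁, x₂, -, rfl⟩ y rfl
    refine Submodule.le_topologicalClosure _ (Submodule.subset_span
      ⟨x₁, hx₁, A.mul e2 x₂ y, ?_⟩)
    exact (A.mul_assoc e1 e2 (hadd N t') (hadd N t) x₁ x₂ y).symm
  have hP : ∀ N t (x : A.space (min t N)) (y : A.space (N - t)),
      (D N t).starProjection (A.mul (hadd N t) x y) =
        A.mul (hadd N t) ((S.carrier (min t N)).starProjection x) y := by
    intro N t x y
    refine Submodule.eq_starProjection_of_mem_orthogonal ?_ ?_
    · exact Submodule.le_topologicalClosure _ (Submodule.subset_span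
        ⟨_, Submodule.starProjection_apply_mem _ _, y, rfl⟩)
    · have e : A.mul (hadd N t) x y - A.mul (hadd N t) ((S.carrier (min t N)).starProjection x) y =
          A.mul (hadd N t) (x - (S.carrier (min t N)).starProjection x) y := by
        rw [map_sub, LinearMap.sub_apply]
      rw [e]
      set w := A.mul (hadd N t) (x - (S.carrier (min t N)).starProjection x) y with hw
      have : D N t ≤ (ℂ ∙ w)ᗮ := by
        refine Submodule.topologicalClosure_minimal _ ?_ (Submodule.isClosed_orthogonal _)
        rw [Submodule.span_le]
        rintro _ ⟨x', hx', y', rfl⟩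
        refine Submodule.mem_orthogonal_singleton_iff_inner_left.2 ?_
        rw [hw, A.inner_mul_mul, Submodule.sub_starProjection_mem_orthogonal x x' hx', zero_mul]
      exact fun d hd => Submodule.mem_orthogonal_singleton_iff_inner_left.1 (this hd)
  -- the compressed function is measurable
  have hg : ∀ (N : ℝ≥0) (k : ℕ), Measurable fun t =>
      F (min t N) * inner ℂ (A.fund k (N - t)) (A.fund k (N - t)) := by
    intro N k
    have hm : Measurable fun t : ℝ≥0 => min t N := measurable_id.min measurable_const
    have hs : Measurable fun t : ℝ≥0 => N - t := measurable_const.sub measurable_id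
    have hw := A.measurable_weak_mul hm hs (hadd N)
    have h1 : ∀ v, Measurable fun t => inner ℂ v
        ((D N t).starProjection (A.mul (hadd N t) (A.fund n (min t N)) (A.fund k (N - t)))) := by
      intro v
      simp only [← Submodule.inner_starProjection_left_eq_right]
      exact measurable_inner_of_weak (fun u => measurable_projections (D N) (hDanti N) u v)
        (hw n k)
    have h2 := measurable_inner_of_weak (hw m k) h1
    simp only [hP, A.inner_mul_mul] at h2
    exact h2
  have hc : ∀ (N : ℝ≥0) (k : ℕ), Measurable fun t =>
      (inner ℂ (A.fund k (N - t)) (A.fund k (N - t)) : ℂ) := fun N k =>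
    (A.measurable_inner_fund k k).comp (measurable_const.sub measurable_id)
  intro U hU
  have : F ⁻¹' U = ⋃ (N : ℕ), ⋃ (k : ℕ), {t : ℝ≥0 | t < N} ∩
      ({t | (inner ℂ (A.fund k (N - t)) (A.fund k (N - t)) : ℂ) ≠ 0} ∩
      (fun t => F (min t N) * inner ℂ (A.fund k (N - t)) (A.fund k (N - t)) /
        inner ℂ (A.fund k (N - t)) (A.fund k (N - t))) ⁻¹' U) := by
    ext t
    simp only [Set.mem_preimage, Set.mem_iUnion, Set.mem_inter_iff, Set.mem_ofPred_eq]
    constructor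
    · intro ht
      obtain ⟨N, hN⟩ := exists_nat_gt t
      have : ∃ k, A.fund k ((N : ℝ≥0) - t) ≠ 0 := by
        by_contra! hk
        obtain ⟨x, hx⟩ := hz ((N : ℝ≥0) - t) (tsub_pos_of_lt hN)
        have ht := A.total_fund ((N : ℝ≥0) - t)
        have hle : (⊤ : Submodule ℂ (A.space ((N : ℝ≥0) - t))) ≤ ⊥ := by
          rw [← ht]
          refine Submodule.topologicalClosure_minimal _ ?_ (by simp)
          rw [Submodule.span_le]
          rintro _ ⟨k, rfl⟩
          simp [hk k]
        exact hx ((Submodule.mem_bot ℂ).1 (hle Submodule.mem_top))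
      obtain ⟨k, hk⟩ := this
      have hk' : (inner ℂ (A.fund k ((N : ℝ≥0) - t)) (A.fund k ((N : ℝ≥0) - t)) : ℂ) ≠ 0 :=
        inner_self_ne_zero.2 hk
      refine ⟨N, k, hN, hk', ?_⟩
      rw [mul_div_cancel_right₀ _ hk', min_eq_left hN.le]
      exact ht
    · rintro ⟨N, k, hN, hk, h⟩
      rwa [mul_div_cancel_right₀ _ hk, min_eq_left hN.le] at h
  rw [this]
  refine MeasurableSet.iUnion fun N => MeasurableSet.iUnion fun k => ?_
  refine (measurableSet_lt measurable_id measurable_const).inter (MeasurableSet.inter ?_ ?_)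
  · exact (hc N k) (measurableSet_singleton 0).compl
  · exact ((hg N k).div (hc N k)) hU

theorem starProjection_mul (S : Subsystem A) {s t r : ℝ≥0} (h : s + t = r) (x : A.space s)
    (y : A.space t) : (S.carrier r).starProjection (A.mul h x y) =
      A.mul h ((S.carrier s).starProjection x) ((S.carrier t).starProjection y) := by
  refine Submodule.eq_starProjection_of_mem_orthogonal
    (S.mul_mem h (Submodule.starProjection_apply_mem _ _) (Submodule.starProjection_apply_mem _ _)) ?_
  set P := (S.carrier s).starProjection x with hP
  set Q := (S.carrier t).starProjection y with hQ
  have e : A.mul h x y - A.mul h P Q = A.mul h (x - P) y + A.mul h P (y - Q) := by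
    simp only [map_sub, LinearMap.sub_apply]; abel
  set w := A.mul h x y - A.mul h P Q with hw
  have : S.carrier r ≤ (ℂ ∙ w)ᗮ := by
    rw [← S.mul_eq h]
    refine Submodule.topologicalClosure_minimal _ ?_ (Submodule.isClosed_orthogonal _)
    rw [Submodule.span_le]
    rintro _ ⟨x', hx', y', hy', rfl⟩
    refine Submodule.mem_orthogonal_singleton_iff_inner_left.2 ?_
    rw [e, inner_add_right, A.inner_mul_mul, A.inner_mul_mul,
      Submodule.sub_starProjection_mem_orthogonal x x' hx',
      Submodule.sub_starProjection_mem_orthogonal y y' hy', zero_mul, mul_zero, add_zero]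
  exact fun d hd => Submodule.mem_orthogonal_singleton_iff_inner_left.1 (this hd)

/-- A product subsystem is an Arveson system, with the restricted product and the measurable
structure given by projecting the fundamental sequence. -/
noncomputable def toArvesonSystem (S : Subsystem A) : ArvesonSystem.{u} where
  space t := S.carrier t
  fund n t := (S.carrier t).orthogonalProjectionOnto (A.fund n t)
  measurable_inner_fund m n := by
    simp only [Submodule.coe_inner, Submodule.coe_orthogonalProjectionOnto_apply,
      Submodule.inner_starProjection_left_eq_right]
    have h : ∀ t, (S.carrier t).starProjection ((S.carrier t).starProjection (A.fund n t)) =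
        (S.carrier t).starProjection (A.fund n t) := fun t =>
      Submodule.starProjection_eq_self_iff.2 (Submodule.starProjection_apply_mem _ _)
    simp only [h]
    exact S.measurable_starProjection m n
  total_fund t := by
    set M := (Submodule.span ℂ (Set.range fun n =>
      (S.carrier t).orthogonalProjectionOnto (A.fund n t))).topologicalClosure with hM
    have h : (⊤ : Submodule ℂ (A.space t)) ≤
        M.comap ((S.carrier t).orthogonalProjectionOnto).toLinearMap := by
      rw [← A.total_fund t]
      refine Submodule.topologicalClosure_minimal _ ?_
        ((Submodule.isClosed_topologicalClosure _).preimage (ContinuousLinearMap.continuous _))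
      rw [Submodule.span_le]
      rintro _ ⟨n, rfl⟩
      exact Submodule.le_topologicalClosure _ (Submodule.subset_span ⟨n, rfl⟩)
    rw [eq_top_iff]
    rintro x -
    have hx := h (Submodule.mem_top (x := (x : A.space t)))
    change (S.carrier t).orthogonalProjectionOnto (x : A.space t) ∈ M at hx
    rwa [Submodule.orthogonalProjectionOnto_mem_subspace_eq_self] at hx
  mul {s t r} h := LinearMap.mk₂ ℂ
    (fun x y => (⟨A.mul h x y, S.mul_mem h x.2 y.2⟩ : S.carrier r))
    (fun x x' y => Subtype.ext (by simp)) (fun c x y => Subtype.ext (by simp))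
    (fun x y y' => Subtype.ext (by simp)) (fun c x y => Subtype.ext (by simp))
  inner_mul_mul h x x' y y' := A.inner_mul_mul h x x' y y'
  total_mul {s t r} h := by
    set G : Set (S.carrier r) := {z | ∃ (x : S.carrier s) (y : S.carrier t), _} with hG
    set M := (Submodule.span ℂ G).topologicalClosure with hM
    have h1 : S.carrier r ≤ M.map (S.carrier r).subtype := by
      conv_lhs => rw [← S.mul_eq h]
      refine Submodule.topologicalClosure_minimal _ ?_ ?_
      · rw [Submodule.span_le]
        rintro _ ⟨x, hx, y, hy, rfl⟩
        refine ⟨⟨A.mul h x y, S.mul_mem h hx hy⟩, ?_, rfl⟩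
        exact Submodule.le_topologicalClosure _ (Submodule.subset_span ⟨⟨x, hx⟩, ⟨y, hy⟩, rfl⟩)
      · rw [Submodule.map_coe]
        exact (S.isClosed r).isClosedEmbedding_subtypeVal.isClosedMap _
          (Submodule.isClosed_topologicalClosure _)
    rw [eq_top_iff]
    rintro x -
    obtain ⟨x', hx', e⟩ := h1 x.2
    rwa [← Subtype.ext (a1 := x') (a2 := x) e]
  measurable_mul k m n := by
    have e : ∀ p : ℝ≥0 × ℝ≥0, inner ℂ
        ((S.carrier (p.1 + p.2)).starProjection (A.fund k (p.1 + p.2)))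
        (A.mul rfl ((S.carrier p.1).starProjection (A.fund m p.1))
          ((S.carrier p.2).starProjection (A.fund n p.2))) =
        inner ℂ ((S.carrier (p.1 + p.2)).starProjection (A.fund k (p.1 + p.2)))
          (A.mul rfl (A.fund m p.1) (A.fund n p.2)) := by
      intro p
      rw [← S.starProjection_mul, ← Submodule.inner_starProjection_left_eq_right,
        Submodule.starProjection_eq_self_iff.2 (Submodule.starProjection_apply_mem _ _)]
    simp only [Submodule.coe_inner, LinearMap.mk₂_apply,
      Submodule.coe_orthogonalProjectionOnto_apply, e]
    have ha : Measurable fun p : ℝ≥0 × ℝ≥0 => p.1 + p.2 := measurable_fst.add measurable_snd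
    exact measurable_inner_sections (H := fun p : ℝ≥0 × ℝ≥0 => A.space (p.1 + p.2))
      (fun j p => A.fund j (p.1 + p.2))
      (fun i j => (A.measurable_inner_fund i j).comp ha) (fun p => A.total_fund _)
      (fun j => (S.measurable_starProjection j k).comp ha) (fun j => A.measurable_mul j m n)
  mul_assoc hrs hst h₁ h₂ x y z := Subtype.ext (A.mul_assoc hrs hst h₁ h₂ _ _ _)

end Subsystem

/-- A unital unit: a measurable section of unit vectors with `u_{s+t} = u_s ⊗ u_t`. A spatial
Arveson system is an Arveson system with such a unit. -/
structure UnitalUnit (A : ArvesonSystem.{u}) where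
  sec : ∀ t, A.space t
  measurable_sec : ∀ n, Measurable fun t => inner ℂ (A.fund n t) (sec t)
  norm_sec : ∀ t, ‖sec t‖ = 1
  mul_sec : ∀ {s t r : ℝ≥0} (h : s + t = r), A.mul h (sec s) (sec t) = sec r

/-- The elementary tensor `x ⊗ y` in the fibre `E_t ⊗ F_t` of the tensor product. -/
noncomputable def tmul (E : ArvesonSystem.{u}) (F : ArvesonSystem.{v}) {t : ℝ≥0} (x : E.space t)
    (y : F.space t) : (E.tensor F).space t :=
  ((x ⊗ₜ[ℂ] y : E.space t ⊗[ℂ] F.space t) : Completion (E.space t ⊗[ℂ] F.space t))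

/-- The spatial product of `(E, u)` and `(F, v)`: the smallest product subsystem of `E ⊗ F` that
contains all the subspaces `u_t ⊗ F_t` and `E_t ⊗ v_t`. -/
noncomputable def spatialProduct {E : ArvesonSystem.{u}} {F : ArvesonSystem.{v}} (u : UnitalUnit E)
    (v : UnitalUnit F) : Subsystem (E.tensor F) :=
  Subsystem.sInf {S | ∀ t, (∀ y : F.space t, tmul E F (u.sec t) y ∈ S.carrier t) ∧
    ∀ x : E.space t, tmul E F x (v.sec t) ∈ S.carrier t}

/-- An isomorphism of Arveson systems: a measurable family of unitaries `E_t → F_t` that respects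
the products. -/
structure Iso (E : ArvesonSystem.{u}) (F : ArvesonSystem.{v}) where
  toEquiv : ∀ t, E.space t ≃ₗᵢ[ℂ] F.space t
  map_mul : ∀ {s t r : ℝ≥0} (h : s + t = r) (x : E.space s) (y : E.space t),
    toEquiv r (E.mul h x y) = F.mul h (toEquiv s x) (toEquiv t y)
  measurable_toEquiv : ∀ m n, Measurable fun t => inner ℂ (F.fund m t) (toEquiv t (E.fund n t))

end ArvesonSystem

section Semigroups

open ContinuousLinearMap (adjoint)

/-- An `E₀`-semigroup on `B(H)`: a point-strongly continuous one-parameter semigroup of normal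
unital `*`-endomorphisms. Normality is the preservation of suprema of increasing nets. -/
structure EZeroSemigroup (H : Type u) [NormedAddCommGroup H] [InnerProductSpace ℂ H]
    [CompleteSpace H] where
  toHom : ℝ≥0 → (H →L[ℂ] H) →⋆ₐ[ℂ] (H →L[ℂ] H)
  zero : ∀ a, toHom 0 a = a
  add : ∀ s t a, toHom (s + t) a = toHom s (toHom t a)
  normal : ∀ t, ScottContinuous (toHom t)
  continuous : ∀ a x, Continuous fun t => toHom t a x

variable {H H₁ H₂ K : Type*}
  [NormedAddCommGroup H] [InnerProductSpace ℂ H] [CompleteSpace H]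
  [NormedAddCommGroup H₁] [InnerProductSpace ℂ H₁] [CompleteSpace H₁]
  [NormedAddCommGroup H₂] [InnerProductSpace ℂ H₂] [CompleteSpace H₂]
  [NormedAddCommGroup K] [InnerProductSpace ℂ K] [CompleteSpace K]

/-- An intertwining semigroup of isometries: a strongly continuous one-parameter semigroup of
isometries with `ϑ_t(a) U_t = U_t a`. -/
structure IntertwiningSemigroup (ϑ : EZeroSemigroup H) where
  op : ℝ≥0 → H →L[ℂ] H
  isometry : ∀ t x, ‖op t x‖ = ‖x‖
  zero : op 0 = 1
  add : ∀ s t, op (s + t) = op s * op t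
  continuous : ∀ x, Continuous fun t => op t x
  intertwines : ∀ t a, ϑ.toHom t a * op t = op t * a

/-- The operator on `H₁ ⊕ H₂` with the given matrix entries. -/
noncomputable def blockOperator (a₁₁ : H₁ →L[ℂ] H₁) (a₁₂ : H₂ →L[ℂ] H₁) (a₂₁ : H₁ →L[ℂ] H₂)
    (a₂₂ : H₂ →L[ℂ] H₂) : WithLp 2 (H₁ × H₂) →L[ℂ] WithLp 2 (H₁ × H₂) :=
  (WithLp.prodContinuousLinearEquiv 2 ℂ H₁ H₂).symm.toContinuousLinearMap ∘L
    ((a₁₁.coprod a₁₂).prod (a₂₁.coprod a₂₂)) ∘L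
      (WithLp.prodContinuousLinearEquiv 2 ℂ H₁ H₂).toContinuousLinearMap

/-- The canonical embedding of `H₁` into `H₁ ⊕ H₂`. -/
noncomputable def inlL (H₁ H₂ : Type*) [NormedAddCommGroup H₁] [InnerProductSpace ℂ H₁]
    [NormedAddCommGroup H₂] [InnerProductSpace ℂ H₂] : H₁ →L[ℂ] WithLp 2 (H₁ × H₂) :=
  (WithLp.prodContinuousLinearEquiv 2 ℂ H₁ H₂).symm.toContinuousLinearMap ∘L
    ContinuousLinearMap.inl ℂ H₁ H₂

/-- The canonical embedding of `H₂` into `H₁ ⊕ H₂`. -/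
noncomputable def inrL (H₁ H₂ : Type*) [NormedAddCommGroup H₁] [InnerProductSpace ℂ H₁]
    [NormedAddCommGroup H₂] [InnerProductSpace ℂ H₂] : H₂ →L[ℂ] WithLp 2 (H₁ × H₂) :=
  (WithLp.prodContinuousLinearEquiv 2 ℂ H₁ H₂).symm.toContinuousLinearMap ∘L
    ContinuousLinearMap.inr ℂ H₁ H₂

/-- The Powers sum of two `E₀`-semigroups with respect to intertwining semigroups of isometries: the
semigroup on `B(H₁ ⊕ H₂)` that sends the operator matrix `(a_ij)` to the operator matrix with
diagonal entries `ϑ¹_t(a₁₁)`, `ϑ²_t(a₂₂)` and off-diagonal entries `U¹_t a₁₂ U²_t*`,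
`U²_t a₂₁ U¹_t*`. -/
noncomputable def powersSum (ϑ₁ : EZeroSemigroup H₁) (ϑ₂ : EZeroSemigroup H₂)
    (U₁ : IntertwiningSemigroup ϑ₁) (U₂ : IntertwiningSemigroup ϑ₂) (t : ℝ≥0)
    (a : WithLp 2 (H₁ × H₂) →L[ℂ] WithLp 2 (H₁ × H₂)) :
    WithLp 2 (H₁ × H₂) →L[ℂ] WithLp 2 (H₁ × H₂) :=
  blockOperator
    (ϑ₁.toHom t (adjoint (inlL H₁ H₂) ∘L a ∘L inlL H₁ H₂))
    (U₁.op t ∘L (adjoint (inlL H₁ H₂) ∘L a ∘L inrL H₁ H₂) ∘L adjoint (U₂.op t))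
    (U₂.op t ∘L (adjoint (inrL H₁ H₂) ∘L a ∘L inlL H₁ H₂) ∘L adjoint (U₁.op t))
    (ϑ₂.toHom t (adjoint (inrL H₁ H₂) ∘L a ∘L inrL H₁ H₂))

/-- The operator `J a J*` on `K`, which is `a` regarded as an operator on the subspace `J H`. -/
noncomputable def ampliate (J : H →ₗᵢ[ℂ] K) (a : H →L[ℂ] H) : K →L[ℂ] K :=
  J.toContinuousLinearMap ∘L a ∘L adjoint J.toContinuousLinearMap

/-- `θ` is a minimal dilation of the semigroup `T` of maps of `B(H)`, where `H` is regarded as a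
subspace of `K` by the isometry `J`: `T_t(a)` is the compression of `θ_t(a)` to `H`, and the vectors
`θ_{t₁}(a₁) ⋯ θ_{tₙ}(aₙ) h` with `t₁ ≥ ⋯ ≥ tₙ ≥ 0`, `a_i ∈ B(H)`, `h ∈ H` are total in `K`. -/
structure IsMinimalDilation (T : ℝ≥0 → (H →L[ℂ] H) → (H →L[ℂ] H)) (θ : EZeroSemigroup K)
    (J : H →ₗᵢ[ℂ] K) : Prop where
  dilation : ∀ t a, T t a =
    adjoint J.toContinuousLinearMap ∘L θ.toHom t (ampliate J a) ∘L J.toContinuousLinearMap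
  minimal : (Submodule.span ℂ {x : K | ∃ (l : List (ℝ≥0 × (H →L[ℂ] H))) (h : H),
      l.Pairwise (fun p q => q.1 ≤ p.1) ∧
      x = l.foldr (fun p y => θ.toHom p.1 (ampliate J p.2) y) (J h)}).topologicalClosure = ⊤

/-- Cocycle conjugacy of `E₀`-semigroups: up to a unitary identification `W` of the Hilbert spaces,
`θ` is the perturbation of `θ'` by a strongly continuous unitary cocycle, that is, a family of
unitaries with `C_{s+t} = C_s θ'_s(C_t)`. -/
def CocycleConjugate {K K' : Type*} [NormedAddCommGroup K] [InnerProductSpace ℂ K]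
    [CompleteSpace K] [NormedAddCommGroup K'] [InnerProductSpace ℂ K'] [CompleteSpace K']
    (θ : EZeroSemigroup K) (θ' : EZeroSemigroup K') : Prop :=
  ∃ (W : K ≃ₗᵢ[ℂ] K') (C : ℝ≥0 → unitary (K' →L[ℂ] K')),
    (∀ s t, (C (s + t) : K' →L[ℂ] K') = C s * θ'.toHom s (C t)) ∧
    (∀ x, Continuous fun t => (C t : K' →L[ℂ] K') x) ∧
    ∀ t (a : K →L[ℂ] K), ampliate W.toLinearIsometry (θ.toHom t a) =
      C t * θ'.toHom t (ampliate W.toLinearIsometry a) * star (C t : K' →L[ℂ] K')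

end Semigroups

/-! For (1) it suffices that a product subsystem `S` of E ⊗ F containing all E_t ⊗ f_t and e_t ⊗ F_t
also contains e'_r ⊗ y for every other unit e' (`TensorEmbedding.sec_mem`); exchanging the factors
and using minimality gives the rest. Put z = e'_r ⊗ y and let P_a project onto S_a ⊗ A_{r-a}. These
projections decrease from the identity at a = 0 to the projection onto S_r at a = r, so the claim is
that ‖P_a z‖² is constant. On an interval of length s, the part of z that may lie outside `S` has
both its component along e_s and its component along f_s removed. Its squared norm is therefore (1 -
|⟨e_s, e'_s⟩|²) times the squared distance of y from the vectors that carry f_s on this interval.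
The first factor is O(s), since the overlap of two units is multiplicative in time
(`exists_one_sub_norm_inner_sq_le`). The second tends to 0, because units asymptotically commute
with every vector (`exists_norm_mul_sub_mul_lt`, a Steinhaus argument). So ‖P_a z‖² has right
derivative 0 everywhere, and being continuous it is constant.

For (2), an E₀-semigroup θ on B(K) and a unit vector h give the Arveson system θ_t(|h⟩⟨h|)K, for
which K is fibre ⊗ K with θ_t(a) acting as 1 ⊗ a; the intertwining semigroups become units. In a
minimal dilation of a Powers sum the systems of ϑ¹ and ϑ² embed with mixed inner products ⟨x, u⟩⟨v,
y⟩, exactly as E ⊗ v and u ⊗ F sit in the spatial product, and by minimality they generate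
(`IsMinimalDilation.total_words`). Comparing Gram matrices of words identifies the system of the
dilation with the spatial product (`SpatialEmbedding.exists_equiv`). By (1) the spatial products for
the two pairs of units coincide, so the dilations have isomorphic Arveson systems. Such an
isomorphism yields a unitary cocycle (`EZeroSemigroup.cocycleConjugate_of_equiv`); its strong
continuity comes from a section of unit vectors that is well behaved at time 0 on both sides. -/

/-! ### Gram matrices, nearest points and a Steinhaus argument. -/

/-- Two total families with the same Gram matrix are related by a unitary. -/
theorem exists_linearIsometryEquiv_of_gram {ι Z Z' : Type*} [NormedAddCommGroup Z]
    [InnerProductSpace ℂ Z] [CompleteSpace Z] [NormedAddCommGroup Z'] [InnerProductSpace ℂ Z']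
    [CompleteSpace Z'] (f : ι → Z) (g : ι → Z')
    (hfg : ∀ i j, inner ℂ (f i) (f j) = inner ℂ (g i) (g j))
    (hf : (Submodule.span ℂ (Set.range f)).topologicalClosure = ⊤)
    (hg : (Submodule.span ℂ (Set.range g)).topologicalClosure = ⊤) :
    ∃ Φ : Z ≃ₗᵢ[ℂ] Z', ∀ i, Φ (f i) = g i := by
  have dense : ∀ {Y : Type _} [NormedAddCommGroup Y] [InnerProductSpace ℂ Y] (k : ι → Y),
      (Submodule.span ℂ (Set.range k)).topologicalClosure = ⊤ →
      DenseRange (Finsupp.linearCombination ℂ k) := by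
    intro Y _ _ k hk
    rw [DenseRange, ← LinearMap.coe_range, Finsupp.range_linearCombination,
      Submodule.dense_iff_topologicalClosure_eq_top]
    exact hk
  have dense' : DenseRange (Finsupp.linearCombination ℂ g) := by
    rw [DenseRange, ← LinearMap.coe_range, Finsupp.range_linearCombination,
      Submodule.dense_iff_topologicalClosure_eq_top]
    exact hg
  have hnorm : ∀ c : ι →₀ ℂ, ‖Finsupp.linearCombination ℂ g (LinearEquiv.refl ℂ _ c)‖ =
      ‖Finsupp.linearCombination ℂ f c‖ := by
    intro c
    have h : inner ℂ (Finsupp.linearCombination ℂ g c) (Finsupp.linearCombination ℂ g c) =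
        inner ℂ (Finsupp.linearCombination ℂ f c) (Finsupp.linearCombination ℂ f c) := by
      simp only [Finsupp.linearCombination_apply, Finsupp.sum, sum_inner, inner_sum,
        inner_smul_left, inner_smul_right, hfg]
    simp only [inner_self_eq_norm_sq_to_K] at h
    exact (pow_left_inj₀ (norm_nonneg _) (norm_nonneg _) two_ne_zero).1 (by exact_mod_cast h)
  refine ⟨(LinearEquiv.refl ℂ (ι →₀ ℂ)).extendOfIsometry _ _ (dense f hf) dense' hnorm,
    fun i => ?_⟩
  have := (LinearEquiv.refl ℂ (ι →₀ ℂ)).extendOfIsometry_eq _ _ (dense f hf) dense' hnorm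
    (Finsupp.single i 1)
  simpa using this

/-- The orthogonal projection is the nearest point. -/
theorem norm_sub_starProjection_le {H : Type*} [NormedAddCommGroup H] [InnerProductSpace ℂ H]
    (U : Submodule ℂ H) [U.HasOrthogonalProjection] (x : H) {y : H} (hy : y ∈ U) :
    ‖x - U.starProjection x‖ ≤ ‖x - y‖ := by
  have h : x - U.starProjection x = Uᗮ.starProjection (x - y) := by
    rw [Submodule.starProjection_orthogonal]
    simp [Submodule.starProjection_eq_self_iff.2 hy]
  rw [h]
  exact Submodule.norm_starProjection_apply_le _ _

/-- For an isometry `V`, `V V* x` is the point of the range of `V` nearest to `x`. -/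
theorem norm_sub_adjoint_le {H K : Type*} [NormedAddCommGroup H] [InnerProductSpace ℂ H]
    [CompleteSpace H] [NormedAddCommGroup K] [InnerProductSpace ℂ K] [CompleteSpace K]
    (V : H →L[ℂ] K) (hV : ∀ x, ‖V x‖ = ‖x‖) (x : K) (y : H) :
    ‖x - V (ContinuousLinearMap.adjoint V x)‖ ≤ ‖x - V y‖ := by
  have hV' : ∀ a, ContinuousLinearMap.adjoint V (V a) = a := fun a =>
    DFunLike.congr_fun ((ContinuousLinearMap.norm_map_iff_adjoint_comp_self V).1 hV) a
  set z := x - V (ContinuousLinearMap.adjoint V x) with hz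
  have e : x - V y = z + V (ContinuousLinearMap.adjoint V x - y) := by
    rw [hz, map_sub]; abel
  have h0 : inner ℂ z (V (ContinuousLinearMap.adjoint V x - y)) = 0 := by
    rw [← ContinuousLinearMap.adjoint_inner_left, hz, map_sub, hV', sub_self, inner_zero_left]
  have h1 := norm_add_sq_eq_norm_sq_add_norm_sq_of_inner_eq_zero z _ h0
  rw [e]
  refine (pow_le_pow_iff_left₀ (norm_nonneg _) (norm_nonneg _) two_ne_zero).1
    (by nlinarith [norm_nonneg (V (ContinuousLinearMap.adjoint V x - y))])

/-- A Steinhaus argument: a measurable path in a separable metric space has small increments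
everywhere. -/
theorem exists_dist_add_lt {X : Type*} [PseudoMetricSpace X] [TopologicalSpace.SeparableSpace X]
    (g : ℝ → X) (hg : ∀ d, Measurable fun a => dist (g a) d) {T : ℝ} (hT : 0 < T) {ε : ℝ}
    (hε : 0 < ε) :
    ∃ δ > 0, ∀ s, 0 ≤ s → s < δ → ∃ a, 0 ≤ a ∧ a + s ≤ T ∧ dist (g a) (g (a + s)) < ε := by
  have : Nonempty X := ⟨g 0⟩
  -- Any two values of the path on one of these sets are less than ε apart; countably many of the
  -- sets cover [0, T], so one has positive measure.
  let A : ℕ → Set ℝ := fun n => {a | dist (g a) (TopologicalSpace.denseSeq X n) < ε / 2} ∩ Set.Icc 0 T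
  have hA : ∀ n, MeasurableSet (A n) := fun n =>
    ((hg _) measurableSet_Iio).inter measurableSet_Icc
  have hU : Set.Icc 0 T ⊆ ⋃ n, A n := by
    intro a ha
    obtain ⟨n, hn⟩ := (TopologicalSpace.denseRange_denseSeq X).exists_dist_lt (g a) (half_pos hε)
    exact Set.mem_iUnion.2 ⟨n, hn, ha⟩
  obtain ⟨n, hn⟩ : ∃ n, 0 < MeasureTheory.volume (A n) := by
    by_contra! h
    have h0 : MeasureTheory.volume (⋃ n, A n) = 0 :=
      MeasureTheory.measure_iUnion_null fun n => le_antisymm (h n) zero_le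
    have := (MeasureTheory.measure_mono (μ := MeasureTheory.volume) hU).trans h0.le
    rw [Real.volume_Icc] at this
    simp at this
    linarith
  -- Steinhaus: the difference set of a set of positive measure is a neighbourhood of 0, so every
  -- small s is a difference of two times in `A n`.
  have hs := MeasureTheory.Measure.sub_mem_nhds_zero_of_addHaar_pos MeasureTheory.volume (A n) (hA n) hn
  obtain ⟨δ, hδ, hball⟩ := Metric.mem_nhds_iff.1 hs
  refine ⟨δ, hδ, fun s hs0 hsδ => ?_⟩
  have : s ∈ Metric.ball (0 : ℝ) δ := by simpa [abs_of_nonneg hs0] using hsδ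
  obtain ⟨x, hx, a, ha, e⟩ := hball this
  have e' : a + s = x := by simp only [] at e; linarith
  refine ⟨a, ha.2.1, e' ▸ hx.2.2, ?_⟩
  rw [e']
  have h1 : dist (g a) _ < ε / 2 := ha.1
  have h2 : dist (g x) _ < ε / 2 := hx.1
  linarith [dist_triangle_right (g a) (g x) (TopologicalSpace.denseSeq X n)]

/-! ### Products of measurable sections. -/

namespace ArvesonSystem

variable {A : ArvesonSystem.{u}}

theorem mulL_apply {s t r : ℝ≥0} (h : s + t = r) (x : A.space s) (y : A.space t) :
    A.mulL h x y = A.mul h x y := rfl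

theorem norm_mul {s t r : ℝ≥0} (h : s + t = r) (x : A.space s) (y : A.space t) :
    ‖A.mul h x y‖ = ‖x‖ * ‖y‖ := norm_bilin _ (A.inner_mul_mul h) x y

/-- The pointwise product of measurable sections is measurable. -/
theorem measurable_mul_sections {Ω : Type*} [MeasurableSpace Ω] {α β γ : Ω → ℝ≥0}
    (hα : Measurable α) (hβ : Measurable β) (h : ∀ ω, α ω + β ω = γ ω)
    {x : ∀ ω, A.space (α ω)} {y : ∀ ω, A.space (β ω)}
    (hx : ∀ n, Measurable fun ω => inner ℂ (A.fund n (α ω)) (x ω))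
    (hy : ∀ n, Measurable fun ω => inner ℂ (A.fund n (β ω)) (y ω)) (k : ℕ) :
    Measurable fun ω => inner ℂ (A.fund k (γ ω)) (A.mul (h ω) (x ω) (y ω)) := by
  have hsec : ∀ {δ : Ω → ℝ≥0} (_ : Measurable δ) {f g : ∀ ω, A.space (δ ω)}
      (_ : ∀ n, Measurable fun ω => inner ℂ (A.fund n (δ ω)) (f ω))
      (_ : ∀ n, Measurable fun ω => inner ℂ (A.fund n (δ ω)) (g ω)),
      Measurable fun ω => inner ℂ (f ω) (g ω) := fun hδ _ _ hf hg =>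
    measurable_inner_sections (fun n ω => A.fund n _)
      (fun m n => (A.measurable_inner_fund m n).comp hδ) (fun ω => A.total_fund _) hf hg
  have aux : ∀ (m n : ℕ) (p : ℝ≥0 × ℝ≥0) (r : ℝ≥0) (hr : p.1 + p.2 = r),
      inner ℂ (A.fund k r) (A.mul hr (A.fund m p.1) (A.fund n p.2)) =
        inner ℂ (A.fund k (p.1 + p.2)) (A.mul rfl (A.fund m p.1) (A.fund n p.2)) := by
    rintro m n p r rfl; rfl
  -- One factor at a time: multiplication by a fundamental section is moved to the other side by its
  -- adjoint, and what remains is the inner product of two measurable sections.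
  have h1 : ∀ m, Measurable fun ω =>
      inner ℂ (A.fund k (γ ω)) (A.mul (h ω) (A.fund m (α ω)) (y ω)) := by
    intro m
    have := hsec hβ (f := fun ω => ContinuousLinearMap.adjoint (A.mulL (h ω) (A.fund m (α ω)))
      (A.fund k (γ ω))) (fun n => ?_) hy
    · simpa only [ContinuousLinearMap.adjoint_inner_left, mulL_apply] using this
    · simp only [ContinuousLinearMap.adjoint_inner_right, mulL_apply]
      have := Complex.continuous_conj.measurable.comp
        ((A.measurable_mul k m n).comp (hα.prodMk hβ))
      simp only [← inner_conj_symm (A.mul _ _ _)]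
      simpa only [Function.comp_def, aux m n (_, _)] using this
  have := hsec hα (f := fun ω => ContinuousLinearMap.adjoint ((A.mulL (h ω)).flip (y ω))
      (A.fund k (γ ω))) (fun n => ?_) hx
  · simpa only [ContinuousLinearMap.adjoint_inner_left, ContinuousLinearMap.flip_apply,
      mulL_apply] using this
  · simp only [ContinuousLinearMap.adjoint_inner_right, ContinuousLinearMap.flip_apply, mulL_apply]
    simp only [← inner_conj_symm (A.mul _ _ _)]
    exact Complex.continuous_conj.measurable.comp (h1 n)

end ArvesonSystem

/-! ### Units at small times and the overlap of two units. -/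

namespace ArvesonSystem

variable {A : ArvesonSystem.{u}}

/-- Left multiplication by the unit vector e is isometric, and e(ex - x) = (ee)x - ex = 0. -/
theorem idempotent_mul {e : A.space 0} (he : ‖e‖ = 1)
    (hee : A.mul (zero_add 0) e e = e) {t : ℝ≥0} (h : 0 + t = t) (x : A.space t) : A.mul h e x = x := by
  have h1 : A.mul h e (A.mul h e x - x) = 0 := by
    rw [map_sub, ← A.mul_assoc (zero_add 0) h h h, hee, sub_self]
  have h2 := norm_mul h e (A.mul h e x - x)
  rw [h1, he, norm_zero, one_mul] at h2
  exact sub_eq_zero.1 (norm_eq_zero.1 h2.symm)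

theorem mul_idempotent {e : A.space 0} (he : ‖e‖ = 1)
    (hee : A.mul (zero_add 0) e e = e) {t : ℝ≥0} (h : t + 0 = t) (x : A.space t) : A.mul h x e = x := by
  have h1 : A.mul h (A.mul h x e - x) e = 0 := by
    rw [map_sub, LinearMap.sub_apply, A.mul_assoc h (zero_add 0) h h, hee, sub_self]
  have h2 := norm_mul h (A.mul h x e - x) e
  rw [h1, he, norm_zero, mul_one] at h2
  exact sub_eq_zero.1 (norm_eq_zero.1 h2.symm)

/-- An idempotent unit vector spans the fibre at `0`. -/
theorem eq_inner_smul_idempotent {e : A.space 0} (he : ‖e‖ = 1)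
    (hee : A.mul (zero_add 0) e e = e) (x : A.space 0) : x = (inner ℂ e x : ℂ) • e := by
  refine ext_inner_right ℂ fun d => ?_
  have h0 : (0 : ℝ≥0) + 0 = 0 := zero_add 0
  -- Against e d, the product e x e gives ⟨x, d⟩ in one bracketing and ⟨x, e⟩⟨e, d⟩ in the other.
  have h1 := A.inner_mul_mul h0 (A.mul h0 e x) e e d
  rw [A.mul_assoc h0 h0 h0 h0, A.inner_mul_mul, mul_idempotent he hee, idempotent_mul he hee,
    inner_self_eq_norm_sq_to_K, he, RCLike.ofReal_one, one_pow, one_mul] at h1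
  rw [h1, inner_smul_left, inner_conj_symm]

namespace UnitalUnit

theorem inner_self_sec (e : A.UnitalUnit) (t : ℝ≥0) : inner ℂ (e.sec t) (e.sec t) = 1 := by
  rw [inner_self_eq_norm_sq_to_K, e.norm_sec]; simp

theorem zero_mul (e : A.UnitalUnit) {t : ℝ≥0} (h : 0 + t = t) (x : A.space t) :
    A.mul h (e.sec 0) x = x := idempotent_mul (e.norm_sec 0) (e.mul_sec _) h x

theorem mul_zero (e : A.UnitalUnit) {t : ℝ≥0} (h : t + 0 = t) (x : A.space t) :
    A.mul h x (e.sec 0) = x := mul_idempotent (e.norm_sec 0) (e.mul_sec _) h x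

end UnitalUnit

/-- Units asymptotically commute with vectors at small times. -/
theorem exists_norm_mul_sub_mul_lt (e e' : A.UnitalUnit) {t : ℝ≥0} (y : A.space t) {ε : ℝ}
    (hε : 0 < ε) :
    ∃ δ > 0, ∀ s : ℝ≥0, (s : ℝ) < δ → ∀ {r : ℝ≥0} (h : s + t = r) (h' : t + s = r),
      ‖A.mul h (e.sec s) y - A.mul h' y (e'.sec s)‖ < ε := by
  -- Clamping to [0, 1] gives α a + β a = 1 for every real a, so the path `g` stays in a single
  -- fibre.
  let α : ℝ → ℝ≥0 := fun a => min a.toNNReal 1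
  let β : ℝ → ℝ≥0 := fun a => 1 - α a
  have hα : Measurable α := measurable_real_toNNReal.min measurable_const
  have hβ : Measurable β := measurable_const.sub hα
  have hγ : Measurable fun a => t + β a := measurable_const.add hβ
  have hαβ : ∀ a, α a + (t + β a) = t + 1 := by
    intro a
    rw [add_left_comm, add_tsub_cancel_of_le (min_le_right _ _)]
  -- Passing from a to a + s replaces y e'_s by e_s y between the fixed factors e_a and e'_{1-a-s}.
  -- The increment thus has norm ‖e_s y - y e'_s‖ whatever a is, and one small increment suffices.
  let g : ℝ → A.space (t + 1) := fun a =>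
    A.mul (hαβ a) (e.sec (α a)) (A.mul rfl y (e'.sec (β a)))
  have hgm : ∀ k, Measurable fun a => inner ℂ (A.fund k (t + 1)) (g a) :=
    measurable_mul_sections hα hγ hαβ (fun n => (e.measurable_sec n).comp hα)
      (measurable_mul_sections (α := fun _ => t) measurable_const hβ (fun _ => rfl)
        (fun n => measurable_const) (fun n => (e'.measurable_sec n).comp hβ))
  have hgd : ∀ d, Measurable fun a => dist (g a) d := by
    intro d
    have h1 : ∀ k, Measurable fun a => inner ℂ (A.fund k (t + 1)) (g a - d) := fun k => by
      simp only [inner_sub_right]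
      exact (hgm k).sub measurable_const
    have h2 := measurable_inner_sections (fun n (_ : ℝ) => A.fund n (t + 1))
      (fun m n => measurable_const) (fun _ => A.total_fund _) h1 h1
    have h3 : ∀ a, dist (g a) d = √(inner ℂ (g a - d) (g a - d) : ℂ).re := by
      intro a
      rw [dist_eq_norm]
      exact norm_eq_sqrt_re_inner (𝕜 := ℂ) _
    simp only [h3]
    exact (Complex.measurable_re.comp h2).sqrt
  obtain ⟨δ, hδ, H⟩ := exists_dist_add_lt g hgd one_pos hε
  refine ⟨δ, hδ, fun s hs r h h' => ?_⟩
  obtain ⟨a, ha, has, hd⟩ := H s s.coe_nonneg hs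
  have key : ∀ {α α' β β' γ γ' N : ℝ≥0} (_ : α + s = α') (_ : s + β' = β) (hγ : t + β = γ)
      (hγ' : t + β' = γ') (hN : α + γ = N) (hN' : α' + γ' = N),
      dist (A.mul hN (e.sec α) (A.mul hγ y (e'.sec β)))
        (A.mul hN' (e.sec α') (A.mul hγ' y (e'.sec β'))) =
      ‖A.mul h (e.sec s) y - A.mul h' y (e'.sec s)‖ := by
    intro α α' β β' γ γ' N h1 h2 hγ hγ' hN hN'
    have e1 : r + β' = γ := by rw [← h', add_assoc, h2, hγ]
    have e2 : s + γ' = γ := by rw [← hγ', ← e1, ← h, add_assoc]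
    rw [← e.mul_sec h1, ← e'.mul_sec h2, A.mul_assoc h1 e2 hN' hN, ← A.mul_assoc h hγ' e1 e2,
      ← A.mul_assoc h' h2 e1 hγ, dist_comm, dist_eq_norm, ← map_sub, norm_mul, e.norm_sec, one_mul,
      ← LinearMap.sub_apply, ← map_sub, norm_mul, e'.norm_sec, mul_one]
  have ha1 : α a = a.toNNReal := min_eq_left (by
    rw [← NNReal.coe_le_coe, Real.coe_toNNReal _ ha]
    exact (le_add_of_nonneg_right s.coe_nonneg).trans has)
  have ha2 : α (a + s) = a.toNNReal + s := by
    have : (a + s).toNNReal = a.toNNReal + s := by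
      rw [Real.toNNReal_add ha s.coe_nonneg, Real.toNNReal_coe]
    rw [← this]
    refine min_eq_left ?_
    rw [← NNReal.coe_le_coe, Real.coe_toNNReal _ (add_nonneg ha s.coe_nonneg)]
    exact has
  rw [key (by rw [ha1, ha2]) ?_] at hd
  · exact hd
  · have h3 : a.toNNReal + s ≤ 1 := by rw [← ha2]; exact min_le_right _ _
    simp only [β, ha1, ha2]
    rw [← tsub_tsub, add_tsub_cancel_of_le]
    exact le_tsub_of_add_le_left h3

/-- The case y = e_0 of asymptotic commutation: e_0 is neutral on both sides. -/
theorem exists_norm_sec_sub_lt (e e' : A.UnitalUnit) {ε : ℝ} (hε : 0 < ε) :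
    ∃ δ > 0, ∀ s : ℝ≥0, (s : ℝ) < δ → ‖e.sec s - e'.sec s‖ < ε := by
  obtain ⟨δ, hδ, H⟩ := exists_norm_mul_sub_mul_lt e e' (e.sec 0) hε
  refine ⟨δ, hδ, fun s hs => ?_⟩
  have := H s hs (add_zero s) (zero_add s)
  rwa [e.mul_zero, e.zero_mul] at this

theorem inner_sec_add (e e' : A.UnitalUnit) (s t : ℝ≥0) :
    inner ℂ (e.sec (s + t)) (e'.sec (s + t)) =
      inner ℂ (e.sec s) (e'.sec s) * inner ℂ (e.sec t) (e'.sec t) := by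
  rw [← e.mul_sec rfl, ← e'.mul_sec rfl, A.inner_mul_mul]

theorem inner_sec_nsmul (e e' : A.UnitalUnit) (s : ℝ≥0) (n : ℕ) :
    inner ℂ (e.sec (n • s)) (e'.sec (n • s)) = inner ℂ (e.sec s) (e'.sec s) ^ n := by
  induction n with
  | zero =>
    rw [zero_nsmul, pow_zero, ← inner_conj_symm]
    have : e.sec 0 = e'.sec 0 := by
      have := e'.mul_zero (zero_add 0) (e.sec 0)
      rw [e.zero_mul] at this
      exact this.symm
    rw [this, e'.inner_self_sec, map_one]
  | succ n ih => rw [succ_nsmul, inner_sec_add, ih, pow_succ]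

theorem norm_inner_sec_le (e e' : A.UnitalUnit) (s : ℝ≥0) :
    ‖(inner ℂ (e.sec s) (e'.sec s) : ℂ)‖ ≤ 1 := by
  simpa [e.norm_sec, e'.norm_sec] using norm_inner_le_norm (𝕜 := ℂ) (e.sec s) (e'.sec s)

/-- For short times the two unit vectors are less than 1 apart, whereas orthogonal ones are √2
apart. The overlap at t is a power of the overlap at t / n. -/
theorem inner_sec_ne_zero (e e' : A.UnitalUnit) (t : ℝ≥0) :
    (inner ℂ (e.sec t) (e'.sec t) : ℂ) ≠ 0 := by
  obtain ⟨δ, hδ, H⟩ := exists_norm_sec_sub_lt e e' one_pos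
  obtain ⟨n, hn⟩ := exists_nat_gt ((t : ℝ) / δ)
  have hn0 : (0 : ℝ) < n := lt_of_le_of_lt (by positivity) hn
  have hn1 : (n : ℝ≥0) ≠ 0 := by exact_mod_cast hn0.ne'
  have ht : t = n • (t / n) := by rw [nsmul_eq_mul, mul_div_cancel₀ _ hn1]
  rw [ht, inner_sec_nsmul]
  refine pow_ne_zero _ fun h0 => ?_
  have h1 := H (t / n) (by
    rw [NNReal.coe_div, NNReal.coe_natCast, div_lt_iff₀ hn0, mul_comm]
    exact (div_lt_iff₀ hδ).1 hn)
  have h2 := norm_sub_sq (𝕜 := ℂ) (e.sec (t / n)) (e'.sec (t / n))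
  rw [h0, e.norm_sec, e'.norm_sec] at h2
  simp only [map_zero, mul_zero, sub_zero] at h2
  nlinarith [norm_nonneg (e.sec (t / n) - e'.sec (t / n))]

/-- The overlap of two units differs from `1` at most linearly in time. -/
theorem exists_one_sub_norm_inner_sq_le (e e' : A.UnitalUnit) :
    ∃ c : ℝ, 0 ≤ c ∧ ∀ s : ℝ≥0, 1 - ‖(inner ℂ (e.sec s) (e'.sec s) : ℂ)‖ ^ 2 ≤ c * s := by
  set f : ℝ≥0 → ℝ := fun s => ‖(inner ℂ (e.sec s) (e'.sec s) : ℂ)‖ with hf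
  have hpos : ∀ s, 0 < f s := fun s => norm_pos_iff.2 (inner_sec_ne_zero e e' s)
  have hle : ∀ s, f s ≤ 1 := norm_inner_sec_le e e'
  have hadd : ∀ s t, f (s + t) = f s * f t := fun s t => by
    simp only [hf, inner_sec_add, Complex.norm_mul]
  have hpow : ∀ s (n : ℕ), f (n • s) = f s ^ n := fun s n => by
    simp only [hf, inner_sec_nsmul, norm_pow]
  have hlog : 0 ≤ -Real.log (f 1) := by
    have := Real.log_nonpos (hpos 1).le (hle 1); linarith
  -- The first summand serves 0 < s ≤ 1; the 2 serves s > 1, where the left side is at most 1.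
  refine ⟨4 * (-Real.log (f 1)) + 2, by linarith, fun s => ?_⟩
  rcases eq_or_ne s 0 with rfl | hs0
  · have : f 0 = 1 := by simpa using hpow 0 0
    change 1 - f 0 ^ 2 ≤ _
    simp [this]
  have hs : (0 : ℝ) < s := by exact_mod_cast pos_iff_ne_zero.2 hs0
  rcases le_or_gt (s : ℝ) 1 with h1 | h1
  -- At least one copy of s fits into [0, 1], n copies fit and n + 1 do not. Multiplicativity gives
  -- f 1 ≤ (f s)^n, so k = -log (f s) satisfies k ≤ (n + 1) s k ≤ 2 n s k ≤ 2 s (-log (f 1));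
  -- finally 1 - (f s)² ≤ 2 k.
  · set n := ⌊(1 : ℝ) / s⌋₊ with hn
    have hn1 : (n : ℝ) * s ≤ 1 := by
      have := Nat.floor_le (a := (1 : ℝ) / s) (by positivity)
      rwa [le_div_iff₀ hs] at this
    have hn2 : 1 < ((n : ℝ) + 1) * s := by
      have := Nat.lt_floor_add_one ((1 : ℝ) / s)
      rwa [div_lt_iff₀ hs] at this
    have hn3 : (1 : ℝ) ≤ n := by
      have : 1 ≤ n := Nat.le_floor (by rw [Nat.cast_one, le_div_iff₀ hs]; linarith)
      exact_mod_cast this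
    have hns : n • s ≤ 1 := by
      rw [nsmul_eq_mul, ← NNReal.coe_le_coe]; push_cast; exact hn1
    have hmono : f 1 ≤ f s ^ n := by
      rw [← hpow, ← add_tsub_cancel_of_le hns, hadd, hpow]
      exact mul_le_of_le_one_right (pow_nonneg (hpos s).le n) (hle _)
    have hl : Real.log (f 1) ≤ n * Real.log (f s) := by
      rw [← Real.log_pow]
      exact Real.log_le_log (hpos 1) hmono
    have hls : Real.log (f s) ≤ 0 := Real.log_nonpos (hpos s).le (hle s)
    have h2 : 1 - f s ^ 2 ≤ -(2 * Real.log (f s)) := by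
      have := Real.add_one_le_exp (2 * Real.log (f s))
      have e2 : Real.exp (2 * Real.log (f s)) = f s ^ 2 := by
        rw [two_mul, Real.exp_add, Real.exp_log (hpos s), sq]
      linarith
    have h3 : -Real.log (f s) ≤ 2 * (-Real.log (f 1)) * s := by
      set k := -Real.log (f s) with hk
      have hk0 : 0 ≤ k := by linarith
      have h5 : (n + 1) * k ≤ 2 * (-Real.log (f 1)) := by nlinarith
      have h6 : k ≤ ((n : ℝ) + 1) * s * k := by nlinarith
      nlinarith
    nlinarith
  · have := sq_nonneg (f s)
    nlinarith

/-- A bilinear multiplicative embedding of the elementary tensors of `E ⊗ F` into an Arveson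
system. -/
structure TensorEmbedding (E : ArvesonSystem.{u}) (F : ArvesonSystem.{v})
    (A : ArvesonSystem.{w}) where
  toFun : ∀ t, E.space t →ₗ[ℂ] F.space t →ₗ[ℂ] A.space t
  inner_map : ∀ t x x' y y', inner ℂ (toFun t x y) (toFun t x' y') = inner ℂ x x' * inner ℂ y y'
  map_mul : ∀ {s t r : ℝ≥0} (h : s + t = r) x x' y y',
    A.mul h (toFun s x y) (toFun t x' y') = toFun r (E.mul h x x') (F.mul h y y')

/-- Exchange of the two factors. -/
def TensorEmbedding.flip {E : ArvesonSystem.{u}} {F : ArvesonSystem.{v}} {A : ArvesonSystem.{w}}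
    (τ : TensorEmbedding E F A) : TensorEmbedding F E A where
  toFun t := (τ.toFun t).flip
  inner_map t x x' y y' := by
    simp only [LinearMap.flip_apply, τ.inner_map]; ring
  map_mul h x x' y y' := by simp only [LinearMap.flip_apply, τ.map_mul]

/-- The elementary tensors of the tensor product. -/
noncomputable def tensorEmbedding (E : ArvesonSystem.{u}) (F : ArvesonSystem.{v}) :
    TensorEmbedding E F (E.tensor F) where
  toFun t := (TensorProduct.mk ℂ (E.space t) (F.space t)).compr₂
    (UniformSpace.Completion.toComplₗᵢ (𝕜 := ℂ) (E := E.space t ⊗[ℂ] F.space t)).toLinearMap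
  inner_map t x x' y y' := by
    refine (UniformSpace.Completion.inner_coe _ _).trans ?_
    simp
  map_mul h x x' y y' := by
    refine (tensorMul_coe E F h _ _).trans ?_
    simp
    rfl

end ArvesonSystem

/-! ### Projections onto S_a ⊗ A_{r-a} and insertion of units. -/

namespace ArvesonSystem

variable {A : ArvesonSystem.{u}}

namespace Subsystem

/-- The closed subspace `S_a ⊗ A_{r - a}` of `A_r`. -/
noncomputable def leftSpan (S : Subsystem A) (r a : ℝ≥0) : Submodule ℂ (A.space r) :=
  (Submodule.span ℂ {z | ∃ (b : ℝ≥0) (h : a + b = r), ∃ x ∈ S.carrier a, ∃ y,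
    A.mul h x y = z}).topologicalClosure

/-- The closed subspace `A_a ⊗ S_s ⊗ A_b` of `A_r`. -/
noncomputable def midSpan (S : Subsystem A) {a s b sb r : ℝ≥0} (h : s + b = sb) (h' : a + sb = r) :
    Submodule ℂ (A.space r) :=
  (Submodule.span ℂ {z | ∃ x, ∃ g ∈ S.carrier s, ∃ y,
    A.mul h' x (A.mul h g y) = z}).topologicalClosure

variable (S : Subsystem A)

theorem isClosed_leftSpan (r a : ℝ≥0) : IsClosed (S.leftSpan r a : Set (A.space r)) :=
  Submodule.isClosed_topologicalClosure _

instance (r a : ℝ≥0) : CompleteSpace (S.leftSpan r a) :=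
  (S.isClosed_leftSpan r a).completeSpace_coe

theorem mul_mem_leftSpan {a b r : ℝ≥0} (h : a + b = r) {x : A.space a} (hx : x ∈ S.carrier a)
    (y : A.space b) : A.mul h x y ∈ S.leftSpan r a :=
  Submodule.le_topologicalClosure _ (Submodule.subset_span ⟨b, h, x, hx, y, rfl⟩)

/-- S_{a'} = S_a ⊗ S_{a'-a}, and the second factor is absorbed into the unrestricted part. -/
theorem leftSpan_anti {r a a' : ℝ≥0} (haa : a ≤ a') : S.leftSpan r a' ≤ S.leftSpan r a := by
  refine Submodule.topologicalClosure_minimal _ ?_ (S.isClosed_leftSpan r a)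
  rw [Submodule.span_le]
  rintro _ ⟨b, h, x, hx, y, rfl⟩
  have e1 : a + (a' - a) = a' := add_tsub_cancel_of_le haa
  have e2 : a + ((a' - a) + b) = r := by rw [← add_assoc, e1, h]
  rw [← S.mul_eq e1] at hx
  refine bilin_mem (A.mulL h) _ {y} (S.leftSpan r a) (S.isClosed_leftSpan r a) ?_ hx
      (Submodule.le_topologicalClosure _ (Submodule.subset_span rfl))
  rintro _ ⟨x₁, hx₁, x₂, -, rfl⟩ y rfl
  rw [mulL_apply, A.mul_assoc e1 rfl h e2]
  exact S.mul_mem_leftSpan e2 hx₁ _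

theorem starProjection_leftSpan {a b r : ℝ≥0} (h : a + b = r) (x : A.space a) (y : A.space b) :
    (S.leftSpan r a).starProjection (A.mul h x y) =
      A.mul h ((S.carrier a).starProjection x) y := by
  refine Submodule.eq_starProjection_of_mem_orthogonal ?_ ?_
  · exact S.mul_mem_leftSpan h (Submodule.starProjection_apply_mem _ _) y
  · rw [← LinearMap.sub_apply, ← map_sub]
    set w := A.mul h (x - (S.carrier a).starProjection x) y with hw
    have : S.leftSpan r a ≤ (ℂ ∙ w)ᗮ := by
      refine Submodule.topologicalClosure_minimal _ ?_ (Submodule.isClosed_orthogonal _)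
      rw [Submodule.span_le]
      rintro _ ⟨b', h', x', hx', y', rfl⟩
      obtain rfl : b' = b := add_left_cancel (h'.trans h.symm)
      refine Submodule.mem_orthogonal_singleton_iff_inner_left.2 ?_
      rw [hw, A.inner_mul_mul, Submodule.sub_starProjection_mem_orthogonal x x' hx', zero_mul]
    exact fun d hd => Submodule.mem_orthogonal_singleton_iff_inner_left.1 (this hd)

/-- Every z equals e z, so at a = 0 there is no restriction. -/
theorem leftSpan_zero {e : A.space 0} (he : ‖e‖ = 1) (hee : A.mul (zero_add 0) e e = e)
    (hS : e ∈ S.carrier 0) (r : ℝ≥0) :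
    S.leftSpan r 0 = ⊤ := by
  rw [eq_top_iff]
  rintro z -
  rw [← idempotent_mul he hee (zero_add r) z]
  exact S.mul_mem_leftSpan _ hS z

/-- The fibre at 0 is spanned by the neutral vector e, so at a = r the unrestricted factor only
contributes scalars. -/
theorem leftSpan_self_le {e : A.space 0} (he : ‖e‖ = 1) (hee : A.mul (zero_add 0) e e = e)
    (r : ℝ≥0) : S.leftSpan r r ≤ S.carrier r := by
  refine Submodule.topologicalClosure_minimal _ ?_ (S.isClosed r)
  rw [Submodule.span_le]
  rintro _ ⟨b, h, x, hx, y, rfl⟩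
  obtain rfl : b = 0 := add_eq_left.1 h
  rw [eq_inner_smul_idempotent he hee y, map_smul, mul_idempotent he hee]
  exact (S.carrier r).smul_mem _ hx

/-- The projection acts on the first factor only. It takes A_a ⊗ S_s ⊗ A_b into S_a ⊗ S_s ⊗ A_b,
which lies in S_{a+s} ⊗ A_b. -/
theorem starProjection_leftSpan_mem {a s b sb a' r : ℝ≥0} (h : s + b = sb) (h' : a + sb = r)
    (ha : a + s = a') {z : A.space r} (hz : z ∈ S.midSpan h h') :
    (S.leftSpan r a).starProjection z ∈ S.leftSpan r a' := by
  have : S.midSpan h h' ≤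
      (S.leftSpan r a').comap (S.leftSpan r a).starProjection.toLinearMap := by
    refine Submodule.topologicalClosure_minimal _ ?_
      ((S.isClosed_leftSpan r a').preimage (ContinuousLinearMap.continuous _))
    rw [Submodule.span_le]
    rintro _ ⟨x, g, hg, y, rfl⟩
    change (S.leftSpan r a).starProjection _ ∈ S.leftSpan r a'
    have h2 : a' + b = r := by rw [← ha, add_assoc, h, h']
    rw [starProjection_leftSpan, ← A.mul_assoc ha h h2 h']
    exact S.mul_mem_leftSpan h2 (S.mul_mem ha (Submodule.starProjection_apply_mem _ _) hg) y
  exact this hz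

/-- By Pythagoras the left side is the squared distance of P z from the smaller space S_{a+s} ⊗ A_b.
Since P (z - w) belongs to that space, the distance is at most ‖P w‖. -/
theorem norm_sq_sub_le {a s b sb a' r : ℝ≥0} (h : s + b = sb) (h' : a + sb = r)
    (ha : a + s = a') {z w : A.space r} (hz : z - w ∈ S.midSpan h h') :
    ‖(S.leftSpan r a).starProjection z‖ ^ 2 - ‖(S.leftSpan r a').starProjection z‖ ^ 2 ≤
      ‖w‖ ^ 2 := by
  set P := (S.leftSpan r a).starProjection with hP
  set Q := (S.leftSpan r a').starProjection with hQ
  have h1 : Q (P z) = Q z := DFunLike.congr_fun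
    (Submodule.starProjection_comp_starProjection_of_le
      (S.leftSpan_anti (r := r) (ha ▸ le_self_add : a ≤ a'))) z
  have h2 : ‖P z‖ ^ 2 = ‖Q (P z)‖ ^ 2 + ‖P z - Q (P z)‖ ^ 2 := by
    have := norm_add_sq_eq_norm_sq_add_norm_sq_of_inner_eq_zero (𝕜 := ℂ) (Q (P z)) (P z - Q (P z))
      (Submodule.sub_starProjection_mem_orthogonal (P z) _ (Submodule.starProjection_apply_mem _ _))
    rw [add_sub_cancel] at this
    nlinarith
  have h3 : ‖P z - Q (P z)‖ ≤ ‖w‖ := by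
    refine (norm_sub_starProjection_le _ _
      (S.starProjection_leftSpan_mem h h' ha hz)).trans ?_
    rw [← map_sub, sub_sub_cancel]
    exact Submodule.norm_starProjection_apply_le _ _
  have h4 := pow_le_pow_left₀ (norm_nonneg _) h3 2
  rw [← h1]
  linarith

end Subsystem

/-- The closed subspace `A_a ⊗ e_s ⊗ A_b` of `A_r`. -/
noncomputable def insertSpan (e : A.UnitalUnit) (a s b : ℝ≥0) {sb r : ℝ≥0} (h : s + b = sb)
    (h' : a + sb = r) : Submodule ℂ (A.space r) :=
  (Submodule.span ℂ {z | ∃ x y, A.mul h' x (A.mul h (e.sec s) y) = z}).topologicalClosure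

instance (e : A.UnitalUnit) (a s b : ℝ≥0) {sb r : ℝ≥0} (h : s + b = sb) (h' : a + sb = r) :
    CompleteSpace (insertSpan e a s b h h') :=
  (Submodule.isClosed_topologicalClosure _).completeSpace_coe

theorem mul_mem_insertSpan (e : A.UnitalUnit) {a s b sb r : ℝ≥0} (h : s + b = sb)
    (h' : a + sb = r) (x : A.space a) (y : A.space b) :
    A.mul h' x (A.mul h (e.sec s) y) ∈ insertSpan e a s b h h' :=
  Submodule.le_topologicalClosure _ (Submodule.subset_span ⟨x, y, rfl⟩)

theorem starProjection_insertSpan (e : A.UnitalUnit) {a s b sb r : ℝ≥0} (h : s + b = sb)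
    (h' : a + sb = r) (x : A.space a) (m : A.space s) (y : A.space b) :
    (insertSpan e a s b h h').starProjection (A.mul h' x (A.mul h m y)) =
      (inner ℂ (e.sec s) m : ℂ) • A.mul h' x (A.mul h (e.sec s) y) := by
  refine Submodule.eq_starProjection_of_mem_orthogonal
    (Submodule.smul_mem _ _ (mul_mem_insertSpan e h h' x y)) ?_
  set w := A.mul h' x (A.mul h m y) -
    (inner ℂ (e.sec s) m : ℂ) • A.mul h' x (A.mul h (e.sec s) y) with hw
  have : insertSpan e a s b h h' ≤ (ℂ ∙ w)ᗮ := by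
    refine Submodule.topologicalClosure_minimal _ ?_ (Submodule.isClosed_orthogonal _)
    rw [Submodule.span_le]
    rintro _ ⟨x', y', rfl⟩
    refine Submodule.mem_orthogonal_singleton_iff_inner_left.2 ?_
    rw [hw, inner_sub_right, inner_smul_right]
    simp only [A.inner_mul_mul, e.inner_self_sec]
    ring
  exact fun d hd => Submodule.mem_orthogonal_singleton_iff_inner_left.1 (this hd)

/-- Triple products are total. -/
theorem total_mul_mul {a s b sb r : ℝ≥0} (h : s + b = sb) (h' : a + sb = r)
    (M : Submodule ℂ (A.space r)) (hM : IsClosed (M : Set (A.space r)))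
    (H : ∀ x m y, A.mul h' x (A.mul h m y) ∈ M) : M = ⊤ := by
  rw [eq_top_iff, ← A.total_mul h']
  refine Submodule.topologicalClosure_minimal _ ?_ hM
  rw [Submodule.span_le]
  rintro _ ⟨x, y, rfl⟩
  have : y ∈ (Submodule.span ℂ {z | ∃ x y, A.mul h x y = z}).topologicalClosure := by
    rw [A.total_mul h]; exact Submodule.mem_top
  refine bilin_mem (A.mulL h') {x} _ M hM ?_
    (Submodule.le_topologicalClosure _ (Submodule.subset_span rfl)) this
  rintro x rfl _ ⟨m, y, rfl⟩
  exact H x m y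

/-- Cutting out a short piece and replacing it by the unit changes a vector little. -/
theorem exists_norm_sub_insertSpan_lt (e : A.UnitalUnit) {a c r : ℝ≥0} (hac : a + c = r)
    (z : A.space r) {ε : ℝ} (hε : 0 < ε) :
    ∃ δ > 0, ∀ s : ℝ≥0, (s : ℝ) < δ → ∀ {b : ℝ≥0} (h : s + b = c),
      ‖z - (insertSpan e a s b h hac).starProjection z‖ < ε := by
  -- vectors with the property form a closed subspace
  let M : Submodule ℂ (A.space r) :=
    { carrier := {z | ∀ ε : ℝ, 0 < ε → ∃ δ > 0, ∀ s : ℝ≥0, (s : ℝ) < δ → ∀ {b : ℝ≥0} (h : s + b = c),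
        ‖z - (insertSpan e a s b h hac).starProjection z‖ < ε}
      zero_mem' := fun ε hε => ⟨1, one_pos, fun s _ b h => by simpa using hε⟩
      add_mem' := by
        intro x y hx hy ε hε
        obtain ⟨δ₁, h₁, H₁⟩ := hx (ε / 2) (half_pos hε)
        obtain ⟨δ₂, h₂, H₂⟩ := hy (ε / 2) (half_pos hε)
        refine ⟨min δ₁ δ₂, lt_min h₁ h₂, fun s hs b h => ?_⟩
        have e1 := H₁ s (hs.trans_le (min_le_left _ _)) h
        have e2 := H₂ s (hs.trans_le (min_le_right _ _)) h
        rw [map_add, add_sub_add_comm]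
        exact (norm_add_le _ _).trans_lt (by linarith)
      smul_mem' := by
        intro k x hx ε hε
        obtain ⟨δ, hδ, H⟩ := hx (ε / (‖k‖ + 1)) (by positivity)
        refine ⟨δ, hδ, fun s hs b h => ?_⟩
        have := H s hs h
        rw [lt_div_iff₀ (by positivity)] at this
        rw [map_smul, ← smul_sub, norm_smul]
        nlinarith [norm_nonneg (x - (insertSpan e a s b h hac).starProjection x)] }
  have hM : IsClosed (M : Set (A.space r)) := by
    refine isClosed_of_closure_subset fun x hx ε hε => ?_
    obtain ⟨y, hy, hxy⟩ := Metric.mem_closure_iff.1 hx (ε / 2) (half_pos hε)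
    obtain ⟨δ, hδ, H⟩ := hy (ε / 2) (half_pos hε)
    refine ⟨δ, hδ, fun s hs b h => ?_⟩
    have h1 := norm_sub_starProjection_le (insertSpan e a s b h hac) x
      (Submodule.starProjection_apply_mem _ y)
    have h2 := norm_add_le (x - y) (y - (insertSpan e a s b h hac).starProjection y)
    rw [sub_add_sub_cancel, ← dist_eq_norm x y] at h2
    linarith [H s hs h]
  suffices h : M = ⊤ by
    have : z ∈ M := h ▸ Submodule.mem_top
    exact this ε hε
  rw [eq_top_iff, ← A.total_mul hac]
  refine Submodule.topologicalClosure_minimal _ ?_ hM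
  rw [Submodule.span_le]
  rintro _ ⟨x, y, rfl⟩ ε hε
  -- For x y it is enough to approximate y by some e_s y' with y' in A_b. The denominator ‖x‖ + 1
  -- absorbs the factor x and avoids dividing by 0.
  obtain ⟨δ, hδ, H⟩ := exists_norm_mul_sub_mul_lt e e y (ε := ε / (‖x‖ + 1)) (by positivity)
  refine ⟨δ, hδ, fun s hs b h => ?_⟩
  have h1 := H s hs rfl (add_comm c s)
  -- the projection of `y` onto `e_s A_b`
  have hiso : ∀ {p q : ℝ≥0} (h : s + p = q) (x : A.space p), ‖A.mulL h (e.sec s) x‖ = ‖x‖ :=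
    fun h x => by rw [mulL_apply, norm_mul, e.norm_sec, one_mul]
  set L := ContinuousLinearMap.adjoint (A.mulL h (e.sec s)) with hL
  set L' := ContinuousLinearMap.adjoint (A.mulL (rfl : s + c = s + c) (e.sec s)) with hL'
  have hbs : b + s = c := by rw [add_comm, h]
  -- Removing e_s on the left commutes with appending e_s on the right.
  have hL'y : L' (A.mul (add_comm c s) y (e.sec s)) = A.mul hbs (L y) (e.sec s) := by
    have ht := A.total_mul hbs
    refine Dense.eq_of_inner_left (𝕜 := ℂ)
      (S := (Submodule.span ℂ {z | ∃ x y, A.mul hbs x y = z} : Set (A.space c)))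
      (Submodule.dense_iff_topologicalClosure_eq_top.2 ht) fun m hm => ?_
    induction hm using Submodule.span_induction with
    | mem m hm =>
      obtain ⟨m₁, m₂, rfl⟩ := hm
      rw [hL', ContinuousLinearMap.adjoint_inner_left, mulL_apply,
        ← A.mul_assoc h hbs (add_comm c s) rfl, A.inner_mul_mul, A.inner_mul_mul, hL,
        ContinuousLinearMap.adjoint_inner_left, mulL_apply]
    | zero => simp
    | add m m' _ _ h h' => rw [inner_add_right, inner_add_right, h, h']
    | smul k m _ h => rw [inner_smul_right, inner_smul_right, h]
  -- Appending e_s on the right preserves norms, so the left side becomes the distance of y e_s from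
  -- e_s A_c. This is at most ‖y e_s - e_s y‖, which is small.
  have h2 : ‖y - A.mul h (e.sec s) (L y)‖ < ε / (‖x‖ + 1) := by
    have e1 : ‖y - A.mul h (e.sec s) (L y)‖ =
        ‖A.mul (add_comm c s) y (e.sec s) - A.mulL rfl (e.sec s)
          (L' (A.mul (add_comm c s) y (e.sec s)))‖ := by
      rw [hL'y, mulL_apply, ← A.mul_assoc h hbs (add_comm c s) rfl, ← LinearMap.sub_apply,
        ← map_sub, norm_mul, e.norm_sec, mul_one]
    rw [e1]
    refine (norm_sub_adjoint_le (A.mulL rfl (e.sec s)) (hiso rfl) _ y).trans_lt ?_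
    rw [norm_sub_rev]
    exact h1
  refine (norm_sub_starProjection_le _ _ (mul_mem_insertSpan e h hac x (L y))).trans_lt ?_
  rw [← map_sub, norm_mul]
  rw [lt_div_iff₀ (by positivity)] at h2
  nlinarith [norm_nonneg x, norm_nonneg (y - A.mul h (e.sec s) (L y))]

end ArvesonSystem

/-! ### Independence of the spatial product from the units. -/

namespace ArvesonSystem

namespace TensorEmbedding

variable {E : ArvesonSystem.{u}} {F : ArvesonSystem.{v}} {A : ArvesonSystem.{w}}
  (τ : TensorEmbedding E F A)

/-- `y ↦ x ⊗ y` as a continuous map. -/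
noncomputable def mapL (t : ℝ≥0) (x : E.space t) : F.space t →L[ℂ] A.space t :=
  bilinL (τ.toFun t) (τ.inner_map t) x

theorem norm_map (t : ℝ≥0) (x : E.space t) (y : F.space t) : ‖τ.toFun t x y‖ = ‖x‖ * ‖y‖ :=
  norm_bilin _ (τ.inner_map t) x y

theorem mul_sec_sec (e : E.UnitalUnit) (f : F.UnitalUnit) {s t r : ℝ≥0} (h : s + t = r) :
    A.mul h (τ.toFun s (e.sec s) (f.sec s)) (τ.toFun t (e.sec t) (f.sec t)) =
      τ.toFun r (e.sec r) (f.sec r) := by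
  rw [τ.map_mul, e.mul_sec, f.mul_sec]

variable (S : Subsystem A) (e e' : E.UnitalUnit) (f : F.UnitalUnit)

/-- Let p and q be the projections onto e_s and f_s. Then 1 - (1 - p) ⊗ (1 - q) = 1 ⊗ q + p ⊗ (1 -
q) has range in the closed span of E_s ⊗ f_s and e_s ⊗ F_s, hence in S_s. The statement applies this
on the middle interval to e'_r ⊗ y; the vector subtracted is the part with 1 - p and 1 - q. -/
theorem sub_mem_midSpan (hx : ∀ t x, τ.toFun t x (f.sec t) ∈ S.carrier t)
    (hy : ∀ t y, τ.toFun t (e.sec t) y ∈ S.carrier t) {a s b sb r : ℝ≥0} (h : s + b = sb)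
    (h' : a + sb = r) (y : F.space r) :
    τ.toFun r (e'.sec r) y - τ.toFun r (E.mul h' (e'.sec a) (E.mul h
      (e'.sec s - (inner ℂ (e.sec s) (e'.sec s) : ℂ) • e.sec s) (e'.sec b)))
      (y - (insertSpan f a s b h h').starProjection y) ∈ S.midSpan h h' := by
  set x₀ := E.mul h' (e'.sec a) (E.mul h
      (e'.sec s - (inner ℂ (e.sec s) (e'.sec s) : ℂ) • e.sec s) (e'.sec b)) with hx₀
  let L : F.space r →L[ℂ] A.space r := τ.mapL r (e'.sec r) - (τ.mapL r x₀).comp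
    (ContinuousLinearMap.id ℂ _ - (insertSpan f a s b h h').starProjection)
  have hcl : IsClosed (S.midSpan h h' : Set (A.space r)) := Submodule.isClosed_topologicalClosure _
  suffices hM : (S.midSpan h h').comap L.toLinearMap = ⊤ by
    have : y ∈ (S.midSpan h h').comap L.toLinearMap := hM ▸ Submodule.mem_top
    exact this
  refine total_mul_mul h h' _ (hcl.preimage L.continuous) fun y₁ m y₂ => ?_
  change τ.toFun r (e'.sec r) (F.mul h' y₁ (F.mul h m y₂)) - τ.toFun r x₀ (F.mul h' y₁ (F.mul h m y₂)
    - (insertSpan f a s b h h').starProjection (F.mul h' y₁ (F.mul h m y₂))) ∈ S.midSpan h h'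
  have e1 : F.mul h' y₁ (F.mul h m y₂) - (insertSpan f a s b h h').starProjection
      (F.mul h' y₁ (F.mul h m y₂)) =
      F.mul h' y₁ (F.mul h (m - (inner ℂ (f.sec s) m : ℂ) • f.sec s) y₂) := by
    rw [starProjection_insertSpan, map_sub, LinearMap.sub_apply, map_sub, map_smul,
      LinearMap.smul_apply, map_smul]
  rw [e1, hx₀, ← e'.mul_sec h', ← e'.mul_sec h, ← τ.map_mul h', ← τ.map_mul h, ← τ.map_mul h',
    ← τ.map_mul h, ← map_sub, ← LinearMap.sub_apply, ← map_sub]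
  refine Submodule.le_topologicalClosure _ (Submodule.subset_span ⟨_, _, ?_, _, rfl⟩)
  have e2 : τ.toFun s (e'.sec s) m - τ.toFun s
      (e'.sec s - (inner ℂ (e.sec s) (e'.sec s) : ℂ) • e.sec s)
      (m - (inner ℂ (f.sec s) m : ℂ) • f.sec s) =
      (inner ℂ (f.sec s) m : ℂ) • τ.toFun s (e'.sec s) (f.sec s) +
        (inner ℂ (e.sec s) (e'.sec s) : ℂ) •
          τ.toFun s (e.sec s) (m - (inner ℂ (f.sec s) m : ℂ) • f.sec s) := by
    simp only [map_sub, map_smul, LinearMap.sub_apply, LinearMap.smul_apply]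
    module
  rw [e2]
  exact Submodule.add_mem _ (Submodule.smul_mem _ _ (hx s _)) (Submodule.smul_mem _ _ (hy s _))

theorem norm_sq_sec_sub (s : ℝ≥0) :
    ‖e'.sec s - (inner ℂ (e.sec s) (e'.sec s) : ℂ) • e.sec s‖ ^ 2 =
      1 - ‖(inner ℂ (e.sec s) (e'.sec s) : ℂ)‖ ^ 2 := by
  set k : ℂ := inner ℂ (e.sec s) (e'.sec s) with hk
  have h0 : inner ℂ (e'.sec s - k • e.sec s) (k • e.sec s) = 0 := by
    rw [inner_smul_right, inner_sub_left, inner_smul_left, e.inner_self_sec, mul_one,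
      ← inner_conj_symm, ← hk, sub_self, mul_zero]
  have h1 := norm_add_sq_eq_norm_sq_add_norm_sq_of_inner_eq_zero _ _ h0
  rw [sub_add_cancel, norm_smul, e.norm_sec, e'.norm_sec] at h1
  nlinarith

/-- A product subsystem that contains `E_t ⊗ f_t` and `e_t ⊗ F_t` contains `e'_t ⊗ F_t` for every
other unit `e'`. -/
theorem sec_mem (hx : ∀ t x, τ.toFun t x (f.sec t) ∈ S.carrier t)
    (hy : ∀ t y, τ.toFun t (e.sec t) y ∈ S.carrier t) (r : ℝ≥0) (y : F.space r) :
    τ.toFun r (e'.sec r) y ∈ S.carrier r := by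
  obtain ⟨c, hc, hcs⟩ := exists_one_sub_norm_inner_sq_le e e'
  set z := τ.toFun r (e'.sec r) y with hz
  let P : ℝ≥0 → A.space r → A.space r := fun a => (S.leftSpan r a).starProjection
  -- Since H 0 = ‖z‖², constancy of H on [0, r] forces P r z = z, which places z in S_r.
  let H : ℝ → ℝ := fun a => ‖P a.toNNReal z‖ ^ 2
  -- the basic estimate
  have hstep : ∀ {a s b sb : ℝ≥0} (h : s + b = sb) (h' : a + sb = r),
      ‖P a z‖ ^ 2 - ‖P (a + s) z‖ ^ 2 ≤
        c * s * ‖y - (insertSpan f a s b h h').starProjection y‖ ^ 2 := by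
    intro a s b sb h h'
    have h1 := S.norm_sq_sub_le h h' rfl (τ.sub_mem_midSpan S e e' f hx hy h h' y)
    rw [τ.norm_map, mul_pow, ArvesonSystem.norm_mul, ArvesonSystem.norm_mul, e'.norm_sec,
      e'.norm_sec, one_mul, mul_one, norm_sq_sec_sub] at h1
    exact h1.trans (mul_le_mul_of_nonneg_right (hcs s) (sq_nonneg _))
  have hmono : ∀ {a a' : ℝ≥0}, a ≤ a' → ‖P a' z‖ ^ 2 ≤ ‖P a z‖ ^ 2 := by
    intro a a' haa
    refine pow_le_pow_left₀ (norm_nonneg _) ?_ 2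
    have := Submodule.starProjection_comp_starProjection_of_le (S.leftSpan_anti (r := r) haa)
    change ‖(S.leftSpan r a').starProjection z‖ ≤ _
    rw [← this]
    exact Submodule.norm_starProjection_apply_le _ _
  have hnn : ∀ {a a' : ℝ}, 0 ≤ a → a ≤ a' → a'.toNNReal = a.toNNReal + (a' - a).toNNReal :=
    fun ha haa => by rw [← Real.toNNReal_add ha (sub_nonneg.2 haa), add_sub_cancel]
  -- Here the second factor is only bounded by ‖y‖²; this suffices for continuity.
  have hlip : ∀ {a a' : ℝ}, 0 ≤ a → a ≤ a' → a' ≤ r → |H a' - H a| ≤ c * ‖y‖ ^ 2 * (a' - a) := by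
    intro a a' ha haa har
    have h1 := hmono (Real.toNNReal_le_toNNReal haa)
    have hsum : a.toNNReal + ((a' - a).toNNReal + (r - a'.toNNReal)) = r := by
      rw [← add_assoc, ← hnn ha haa, add_tsub_cancel_of_le (Real.toNNReal_le_iff_le_coe.2 har)]
    have h2 := hstep rfl hsum
    rw [← hnn ha haa, Real.coe_toNNReal _ (sub_nonneg.2 haa)] at h2
    have h3 : ‖y - (insertSpan f a.toNNReal (a' - a).toNNReal (r - a'.toNNReal) rfl
        hsum).starProjection y‖ ^ 2 ≤ ‖y‖ ^ 2 := by
      refine pow_le_pow_left₀ (norm_nonneg _) ?_ 2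
      simpa using norm_sub_starProjection_le (insertSpan f a.toNNReal (a' - a).toNNReal
        (r - a'.toNNReal) rfl hsum) y (Submodule.zero_mem _)
    have h4 : 0 ≤ c * (a' - a) := mul_nonneg hc (sub_nonneg.2 haa)
    rw [abs_sub_comm, abs_of_nonneg (sub_nonneg.2 h1)]
    change H a - H a' ≤ _ at h2
    nlinarith
  have hcont : ContinuousOn H (Set.Icc 0 r) := by
    have : LipschitzOnWith (c * ‖y‖ ^ 2).toNNReal H (Set.Icc 0 r) := by
      refine LipschitzOnWith.of_dist_le_mul fun a ha a' ha' => ?_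
      rw [Real.coe_toNNReal _ (by positivity), Real.dist_eq, Real.dist_eq]
      rcases le_total a a' with h | h
      · rw [abs_sub_comm, abs_sub_comm a a', abs_of_nonneg (sub_nonneg.2 h)]
        exact hlip ha.1 h ha'.2
      · rw [abs_of_nonneg (sub_nonneg.2 h)]
        exact hlip ha'.1 h ha.2
    exact this.continuousOn
  -- At fixed a the second factor tends to 0 with the length of the interval, so the decrease of H
  -- is o(a' - a). Monotonicity makes the one-sided estimate a bound for the absolute value.
  have hderiv : ∀ a ∈ Set.Ico (0 : ℝ) r, HasDerivWithinAt H 0 (Set.Ici a) a := by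
    intro a ha
    rw [hasDerivWithinAt_iff_isLittleO, Asymptotics.isLittleO_iff]
    intro ε hε
    have har : a.toNNReal ≤ r := Real.toNNReal_le_iff_le_coe.2 ha.2.le
    -- The tolerance is chosen so that c times its square is at most ε; c + 1 keeps the denominator
    -- positive.
    obtain ⟨δ, hδ, hd⟩ := exists_norm_sub_insertSpan_lt f (add_tsub_cancel_of_le har) y
      (ε := √(ε / (c + 1))) (by positivity)
    have hm : 0 < min δ (r - a) := lt_min hδ (sub_pos.2 ha.2)
    filter_upwards [inter_mem_nhdsWithin (Set.Ici a) (Metric.ball_mem_nhds a hm)] with a' ha'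
    have haa : a ≤ a' := ha'.1
    have hs : a' - a < min δ (r - a) := by
      have := ha'.2
      rwa [Metric.mem_ball, Real.dist_eq, abs_of_nonneg (sub_nonneg.2 haa)] at this
    have har' : a' ≤ r := by linarith [min_le_right δ (r - a)]
    have hsb : (a' - a).toNNReal + (r - a'.toNNReal) = r - a.toNNReal := by
      refine (tsub_eq_of_eq_add ?_).symm
      rw [add_right_comm, add_comm _ a.toNNReal, ← hnn ha.1 haa,
        add_tsub_cancel_of_le (Real.toNNReal_le_iff_le_coe.2 har')]
    have h2 := hstep hsb (add_tsub_cancel_of_le har)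
    rw [← hnn ha.1 haa, Real.coe_toNNReal _ (sub_nonneg.2 haa)] at h2
    have h3 := hd (a' - a).toNNReal (by
      rw [Real.coe_toNNReal _ (sub_nonneg.2 haa)]; exact hs.trans_le (min_le_left _ _)) hsb
    have h4 := pow_le_pow_left₀ (norm_nonneg _) h3.le 2
    rw [Real.sq_sqrt (by positivity), le_div_iff₀ (by positivity)] at h4
    have h1 := hmono (Real.toNNReal_le_toNNReal haa)
    rw [smul_zero, sub_zero, Real.norm_eq_abs, Real.norm_eq_abs, abs_sub_comm,
      abs_of_nonneg (sub_nonneg.2 h1), abs_of_nonneg (sub_nonneg.2 haa)]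
    refine h2.trans ?_
    rw [mul_right_comm]
    refine mul_le_mul_of_nonneg_right ?_ (sub_nonneg.2 haa)
    nlinarith [sq_nonneg ‖y - (insertSpan f a.toNNReal (a' - a).toNNReal (r - a'.toNNReal) hsb
      (add_tsub_cancel_of_le har)).starProjection y‖]
  have hconst : H r = H 0 := constant_of_has_deriv_right_zero hcont hderiv r ⟨r.2, le_rfl⟩
  have hn : ‖τ.toFun 0 (e.sec 0) (f.sec 0)‖ = 1 := by
    rw [τ.norm_map, e.norm_sec, f.norm_sec, one_mul]
  have hi := τ.mul_sec_sec e f (zero_add 0)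
  have h0 : P 0 z = z := by
    refine Submodule.starProjection_eq_self_iff.2 ?_
    rw [S.leftSpan_zero hn hi (hx 0 _)]
    exact Submodule.mem_top
  simp only [H, Real.toNNReal_coe, Real.toNNReal_zero, h0] at hconst
  refine S.leftSpan_self_le hn hi r ?_
  rw [← Submodule.starProjection_eq_self_iff]
  have h5 := norm_add_sq_eq_norm_sq_add_norm_sq_of_inner_eq_zero (𝕜 := ℂ) (P r z) (z - P r z)
      (Submodule.sub_starProjection_mem_orthogonal z _ (Submodule.starProjection_apply_mem _ _))
  rw [add_sub_cancel] at h5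
  have h6 : ‖z - P r z‖ = 0 := by
    have := norm_nonneg (z - P r z)
    nlinarith
  exact (sub_eq_zero.1 (norm_eq_zero.1 h6)).symm

end TensorEmbedding

section SpatialProduct

variable {E : ArvesonSystem.{u}} {F : ArvesonSystem.{v}}

theorem tmul_sec_right_mem (e : E.UnitalUnit) (f : F.UnitalUnit) {t : ℝ≥0} (x : E.space t) :
    tmul E F x (f.sec t) ∈ (spatialProduct e f).carrier t := by
  simp only [spatialProduct, Subsystem.sInf, Submodule.mem_iInf]
  exact fun S hS => (hS t).2 x

theorem tmul_sec_left_mem (e : E.UnitalUnit) (f : F.UnitalUnit) {t : ℝ≥0} (y : F.space t) :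
    tmul E F (e.sec t) y ∈ (spatialProduct e f).carrier t := by
  simp only [spatialProduct, Subsystem.sInf, Submodule.mem_iInf]
  exact fun S hS => (hS t).1 y

theorem spatialProduct_le (e : E.UnitalUnit) (f : F.UnitalUnit) {S : Subsystem (E.tensor F)}
    (hx : ∀ t x, tmul E F x (f.sec t) ∈ S.carrier t)
    (hy : ∀ t y, tmul E F (e.sec t) y ∈ S.carrier t) (t : ℝ≥0) :
    (spatialProduct e f).carrier t ≤ S.carrier t :=
  iInf₂_le S fun t => ⟨hy t, hx t⟩

/-- Minimality of the left side reduces this to the two kinds of generators. `sec_mem` gives e'_t ⊗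
F_t, and the same lemma with the factors exchanged gives E_t ⊗ f'_t. -/
theorem spatialProduct_carrier_le (e e' : E.UnitalUnit) (f f' : F.UnitalUnit) (t : ℝ≥0) :
    (spatialProduct e' f').carrier t ≤ (spatialProduct e f).carrier t :=
  spatialProduct_le e' f'
    (fun t x => (tensorEmbedding E F).flip.sec_mem _ f f' e
      (fun _ _ => tmul_sec_left_mem e f _) (fun _ _ => tmul_sec_right_mem e f _) t x)
    (fun t y => (tensorEmbedding E F).sec_mem _ e e' f
      (fun _ _ => tmul_sec_right_mem e f _) (fun _ _ => tmul_sec_left_mem e f _) t y) t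

/-- The spatial product does not depend on the reference units. -/
theorem spatialProduct_eq (e e' : E.UnitalUnit) (f f' : F.UnitalUnit) :
    spatialProduct e f = spatialProduct e' f' := by
  ext1
  funext t
  exact le_antisymm (spatialProduct_carrier_le e' e f' f t) (spatialProduct_carrier_le e e' f f' t)

/-- The identity isomorphism. -/
def Iso.refl (A : ArvesonSystem.{u}) : Iso A A where
  toEquiv t := LinearIsometryEquiv.refl ℂ (A.space t)
  map_mul _ _ _ := rfl
  measurable_toEquiv := A.measurable_inner_fund

theorem nonempty_iso_of_eq {A : ArvesonSystem.{u}} {S T : Subsystem A} (h : S = T) :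
    Nonempty (S.toArvesonSystem.Iso T.toArvesonSystem) := by
  subst h
  exact ⟨Iso.refl _⟩

end SpatialProduct

end ArvesonSystem

/-! ### The Arveson system of an E₀-semigroup. -/

namespace EZeroSemigroup

open InnerProductSpace (rankOne)
open ContinuousLinearMap (adjoint)

section

variable {K : Type*} [NormedAddCommGroup K] [InnerProductSpace ℂ K]

theorem mul_rankOne (a : K →L[ℂ] K) (x y : K) : a * rankOne ℂ x y = rankOne ℂ (a x) y :=
  InnerProductSpace.comp_rankOne x y a

theorem rankOne_mul_rankOne (x y z w : K) :
    rankOne ℂ x y * rankOne ℂ z w = rankOne ℂ ((inner ℂ y z : ℂ) • x) w := by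
  rw [mul_rankOne, InnerProductSpace.rankOne_apply]

/-- The projections of finite rank. -/
def finiteRankProjections (K : Type*) [NormedAddCommGroup K] [InnerProductSpace ℂ K] :
    Set (K →L[ℂ] K) :=
  {p | ∃ (U : Submodule ℂ K) (_ : FiniteDimensional ℂ U), p = U.starProjection}

theorem directedOn_finiteRankProjections : DirectedOn (· ≤ ·) (finiteRankProjections K) := by
  rintro _ ⟨U, _, rfl⟩ _ ⟨V, _, rfl⟩
  exact ⟨_, ⟨U ⊔ V, inferInstance, rfl⟩, Submodule.starProjection_le_starProjection_iff.2 le_sup_left,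
    Submodule.starProjection_le_starProjection_iff.2 le_sup_right⟩

variable [CompleteSpace K]

theorem star_rankOne (x y : K) : star (rankOne ℂ x y) = rankOne ℂ y x :=
  InnerProductSpace.adjoint_rankOne x y

variable (θ : EZeroSemigroup K)

theorem inner_toHom_left (t : ℝ≥0) (a : K →L[ℂ] K) (x y : K) :
    inner ℂ (θ.toHom t a x) y = inner ℂ x (θ.toHom t (star a) y) := by
  rw [map_star, ContinuousLinearMap.star_eq_adjoint, ContinuousLinearMap.adjoint_inner_right]

theorem toHom_mul_apply (t : ℝ≥0) (a b : K →L[ℂ] K) (x : K) :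
    θ.toHom t (a * b) x = θ.toHom t a (θ.toHom t b x) := by
  rw [map_mul]; rfl

theorem norm_toHom_apply_le (t : ℝ≥0) (a : K →L[ℂ] K) (x : K) :
    ‖θ.toHom t a x‖ ≤ ‖a‖ * ‖x‖ :=
  (ContinuousLinearMap.le_opNorm _ _).trans
    (mul_le_mul_of_nonneg_right (NonUnitalStarAlgHom.norm_apply_le (θ.toHom t) a) (norm_nonneg _))

/-- The vector `θ_t(|k⟩⟨h|) x`. If `θ_t(|h⟩⟨h|) x = x`, then `x = X h` for a unique operator `X` that
intertwines `θ_t` with the identity, and this vector is `X k`. -/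
noncomputable def act (h : K) (t : ℝ≥0) : K →ₗ[ℂ] K →ₗ[ℂ] K :=
  LinearMap.mk₂ ℂ (fun x k => θ.toHom t (rankOne ℂ k h) x) (by simp) (by simp) (by simp) (by simp)

theorem act_apply (h : K) (t : ℝ≥0) (x k : K) :
    θ.act h t x k = θ.toHom t (rankOne ℂ k h) x := rfl

variable {h : K}

/-- This is θ_t applied to |h⟩⟨k| |k'⟩⟨h| = ⟨k, k'⟩ |h⟩⟨h|. For x' in the fibre over h the right
side is the inner product of elementary tensors x ⊗ k. -/
theorem inner_act (h : K) (t : ℝ≥0) (x x' k k' : K) :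
    inner ℂ (θ.act h t x k) (θ.act h t x' k') =
      inner ℂ x (θ.toHom t (rankOne ℂ h h) x') * inner ℂ k k' := by
  rw [act_apply, inner_toHom_left, act_apply, ← toHom_mul_apply, star_rankOne,
    rankOne_mul_rankOne, map_smul, smul_apply, map_smul,
    smul_apply, inner_smul_right, mul_comm]

/-- Because a |k⟩⟨h| = |a k⟩⟨h|. In the picture fibre ⊗ K, θ_t(a) acts as 1 ⊗ a. -/
theorem toHom_act (t : ℝ≥0) (a : K →L[ℂ] K) (x k : K) :
    θ.toHom t a (θ.act h t x k) = θ.act h t x (a k) := by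
  rw [act_apply, ← toHom_mul_apply, mul_rankOne, act_apply]

theorem act_toHom (hh : ‖h‖ = 1) (t : ℝ≥0) (x k : K) :
    θ.act h t (θ.toHom t (rankOne ℂ h h) x) k = θ.act h t x k := by
  rw [act_apply, ← toHom_mul_apply, rankOne_mul_rankOne, inner_self_eq_norm_sq_to_K, hh, act_apply]
  simp

/-- The source of associativity: write θ_{s+t} = θ_s θ_t and let the inner operator act on the
second tensor factor. -/
theorem act_act (s t : ℝ≥0) (x y z : K) :
    θ.act h (s + t) (θ.act h s x y) z = θ.act h s x (θ.act h t y z) := by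
  rw [act_apply _ _ (s + t), θ.add, toHom_act, act_apply _ _ t]

theorem norm_act_le (t : ℝ≥0) (x k : K) : ‖θ.act h t x k‖ ≤ ‖k‖ * ‖h‖ * ‖x‖ := by
  rw [act_apply]
  refine (θ.norm_toHom_apply_le _ _ _).trans_eq ?_
  rw [InnerProductSpace.norm_rankOne]

theorem continuous_act : Continuous fun p : ℝ≥0 × K × K => θ.act h p.1 p.2.1 p.2.2 := by
  rw [continuous_iff_continuousAt]
  rintro ⟨t₀, x₀, k₀⟩
  -- Only t varies in the first term, which is an orbit of the semigroup; the errors are bounded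
  -- uniformly in t by `norm_act_le`.
  have e : ∀ p : ℝ≥0 × K × K, θ.act h p.1 p.2.1 p.2.2 = θ.act h p.1 x₀ k₀ +
      (θ.act h p.1 (p.2.1 - x₀) p.2.2 + θ.act h p.1 x₀ (p.2.2 - k₀)) := by
    intro p
    simp only [map_sub, LinearMap.sub_apply]
    abel
  have h1 : ∀ f : ℝ≥0 × K × K → K, (∃ g : ℝ≥0 × K × K → ℝ, Continuous g ∧ g (t₀, x₀, k₀) = 0 ∧
      ∀ p, ‖f p‖ ≤ g p) → Filter.Tendsto f (nhds (t₀, x₀, k₀)) (nhds 0) := by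
    rintro f ⟨g, hg, hg0, hfg⟩
    exact squeeze_zero_norm hfg (hg0 ▸ hg.tendsto _)
  rw [ContinuousAt]
  simp only [e]
  have h2 := ((θ.continuous (rankOne ℂ k₀ h) x₀).comp
    (continuous_fst (X := ℝ≥0) (Y := K × K))).tendsto (t₀, x₀, k₀)
  have h3 := h2.add (h1 (fun p => θ.act h p.1 (p.2.1 - x₀) p.2.2 +
    θ.act h p.1 x₀ (p.2.2 - k₀)) ?_)
  · rw [add_zero] at h3
    exact h3
  · refine ⟨fun p => ‖p.2.2‖ * ‖h‖ * ‖p.2.1 - x₀‖ + ‖p.2.2 - k₀‖ * ‖h‖ * ‖x₀‖, by fun_prop,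
      by simp, fun p => ?_⟩
    exact (norm_add_le _ _).trans (add_le_add (θ.norm_act_le _ _ _) (θ.norm_act_le _ _ _))

/-- The identity is the supremum of the projections of finite rank. -/
theorem isLUB_finiteRankProjections : IsLUB (finiteRankProjections K) 1 := by
  constructor
  · rintro _ ⟨U, _, rfl⟩
    have : (⊤ : Submodule ℂ K).starProjection = 1 := Submodule.starProjection_top
    rw [← this]
    exact Submodule.starProjection_le_starProjection_iff.2 le_top
  · intro a ha
    have h1 : ∀ (U : Submodule ℂ K) [FiniteDimensional ℂ U], (a - U.starProjection).IsPositive :=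
      fun U _ => ha ⟨U, inferInstance, rfl⟩
    -- The zero projection shows that an upper bound is positive, in particular selfadjoint.
    have h0 : IsSelfAdjoint a := by simpa using (h1 ⊥).isSelfAdjoint
    change (a - 1).IsPositive
    refine ContinuousLinearMap.isPositive_def'.2 ⟨h0.sub (IsSelfAdjoint.one _), fun x => ?_⟩
    -- Testing at x against the projection onto the line through x gives ‖x‖² ≤ ⟨a x, x⟩.
    have h2 := (h1 (ℂ ∙ x)).2 x
    have h3 : (ℂ ∙ x).starProjection x = x :=
      Submodule.starProjection_eq_self_iff.2 (Submodule.mem_span_singleton_self x)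
    simpa [ContinuousLinearMap.reApplyInnerSelf, h3] using h2

/-- By normality, the vectors `θ_t(|k⟩⟨h|) x` are total. -/
theorem total_act (hh : ‖h‖ = 1) (t : ℝ≥0) :
    (Submodule.span ℂ {z | ∃ x k, θ.act h t x k = z}).topologicalClosure = ⊤ := by
  set M := (Submodule.span ℂ {z | ∃ x k, θ.act h t x k = z}).topologicalClosure with hM
  have : CompleteSpace M := (Submodule.isClosed_topologicalClosure _).completeSpace_coe
  have hmem : ∀ x k, θ.act h t x k ∈ M := fun x k =>
    Submodule.le_topologicalClosure _ (Submodule.subset_span ⟨x, k, rfl⟩)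
  have hne : (finiteRankProjections K).Nonempty := ⟨_, ⊥, inferInstance, rfl⟩
  -- Normality makes 1 = θ_t(1) the supremum of the θ_t(p) with p of finite rank. Each is a
  -- projection with range in M, since |b⟩⟨b| = |b⟩⟨h| |h⟩⟨b|; hence 1 is below the projection onto
  -- M.
  have hlub := θ.normal t hne directedOn_finiteRankProjections isLUB_finiteRankProjections
  rw [map_one] at hlub
  have hle : (1 : K →L[ℂ] K) ≤ M.starProjection := by
    refine hlub.2 ?_
    rintro _ ⟨_, ⟨U, _, rfl⟩, rfl⟩
    have hU : ∀ x, θ.toHom t U.starProjection x ∈ M := by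
      intro x
      rw [(stdOrthonormalBasis ℂ U).starProjection_eq_sum_rankOne, map_sum,
        sum_apply]
      refine Submodule.sum_mem _ fun i _ => ?_
      set b : K := ((stdOrthonormalBasis ℂ U i : U) : K) with hb
      have e : rankOne ℂ b b = rankOne ℂ b h * rankOne ℂ h b := by
        rw [rankOne_mul_rankOne, inner_self_eq_norm_sq_to_K, hh]; simp
      rw [e, toHom_mul_apply]
      exact hmem _ _
    have hq : IsStarProjection (θ.toHom t U.starProjection) := by
      have hp : IsStarProjection U.starProjection := isStarProjection_starProjection
      exact ⟨by rw [IsIdempotentElem, ← map_mul, hp.1.eq], by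
        rw [IsSelfAdjoint, ← map_star, hp.2.star_eq]⟩
    rw [isStarProjection_iff_eq_starProjection_range] at hq
    obtain ⟨_, hq⟩ := hq
    rw [hq, Submodule.starProjection_le_starProjection_iff]
    rintro _ ⟨x, rfl⟩
    exact hU x
  have htop : (⊤ : Submodule ℂ K).starProjection = 1 := Submodule.starProjection_top
  rw [← htop, Submodule.starProjection_le_starProjection_iff] at hle
  exact top_le_iff.1 hle

/-- The range of the projection `θ_t(|h⟩⟨h|)`. -/
def fiber (h : K) (t : ℝ≥0) : Submodule ℂ K where
  carrier := {x | θ.toHom t (rankOne ℂ h h) x = x}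
  zero_mem' := map_zero _
  add_mem' hx hy := by rw [Set.mem_ofPred_eq] at *; rw [map_add, hx, hy]
  smul_mem' c x hx := by rw [Set.mem_ofPred_eq] at *; rw [map_smul, hx]

theorem mem_fiber {t : ℝ≥0} {x : K} : x ∈ θ.fiber h t ↔ θ.toHom t (rankOne ℂ h h) x = x := Iff.rfl

theorem isClosed_fiber (h : K) (t : ℝ≥0) : IsClosed (θ.fiber h t : Set K) :=
  isClosed_eq (ContinuousLinearMap.continuous _) continuous_id

instance (h : K) (t : ℝ≥0) : CompleteSpace (θ.fiber h t) := (θ.isClosed_fiber h t).completeSpace_coe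

theorem act_eq_self {t : ℝ≥0} {x : K} (hx : x ∈ θ.fiber h t) : θ.act h t x h = x := hx

theorem act_mem {s t r : ℝ≥0} (hr : s + t = r) (x : K) {y : K} (hy : y ∈ θ.fiber h t) :
    θ.act h s x y ∈ θ.fiber h r := by
  subst hr
  rw [mem_fiber, θ.add, toHom_act, θ.mem_fiber.1 hy]

theorem toHom_mem (hh : ‖h‖ = 1) (t : ℝ≥0) (x : K) :
    θ.toHom t (rankOne ℂ h h) x ∈ θ.fiber h t := by
  rw [mem_fiber, ← toHom_mul_apply, rankOne_mul_rankOne, inner_self_eq_norm_sq_to_K, hh]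
  simp

theorem inner_act_of_mem {t : ℝ≥0} (x : K) {x' : K} (k k' : K) (hx' : x' ∈ θ.fiber h t) :
    inner ℂ (θ.act h t x k) (θ.act h t x' k') = inner ℂ x x' * inner ℂ k k' := by
  rw [inner_act, θ.mem_fiber.1 hx']

/-- The projection onto `θ_t(|h⟩⟨h|) K`. -/
noncomputable def fiberProj (hh : ‖h‖ = 1) (t : ℝ≥0) : K →L[ℂ] θ.fiber h t :=
  (θ.toHom t (rankOne ℂ h h)).codRestrict _ (θ.toHom_mem hh t)

theorem fiberProj_coe (hh : ‖h‖ = 1) (t : ℝ≥0) (x : θ.fiber h t) : θ.fiberProj hh t x = x :=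
  Subtype.ext x.2

end

variable {K : Type u} [NormedAddCommGroup K] [InnerProductSpace ℂ K] [CompleteSpace K]

theorem continuous_toHom_apply (θ : EZeroSemigroup K) (a : K →L[ℂ] K) {Ω : Type*}
    [TopologicalSpace Ω] {f : Ω → ℝ≥0} (hf : Continuous f) (x : K) :
    Continuous fun ω => θ.toHom (f ω) a x := (θ.continuous a x).comp hf

/-- The Arveson system of an `E₀`-semigroup, realised on the fibres `θ_t(|h⟩⟨h|) K` for a unit vector
`h`: the space of operators intertwining `θ_t` with the identity is identified with this fibre by
`X ↦ X h`. -/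
noncomputable def arveson [TopologicalSpace.SeparableSpace K] (θ : EZeroSemigroup K) {h : K}
    (hh : ‖h‖ = 1) : ArvesonSystem.{u} where
  space t := θ.fiber h t
  fund n t := θ.fiberProj hh t (TopologicalSpace.denseSeq K n)
  measurable_inner_fund m n :=
    (Continuous.inner (𝕜 := ℂ) (θ.continuous _ _) (θ.continuous _ _)).measurable
  total_fund t := by
    have h0 : Function.Surjective (θ.fiberProj hh t) := fun x => ⟨x, θ.fiberProj_coe hh t x⟩
    have h1 : DenseRange fun n => θ.fiberProj hh t (TopologicalSpace.denseSeq K n) :=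
      h0.denseRange.comp
        (TopologicalSpace.denseRange_denseSeq K) (ContinuousLinearMap.continuous _)
    exact Submodule.dense_iff_topologicalClosure_eq_top.1 (h1.mono Submodule.subset_span)
  mul {s t r} hr := LinearMap.mk₂ ℂ
    (fun x y => (⟨θ.act h s x y, θ.act_mem hr x y.2⟩ : θ.fiber h r))
    (fun x x' y => Subtype.ext (by simp)) (fun c x y => Subtype.ext (by simp))
    (fun x y y' => Subtype.ext (by simp)) (fun c x y => Subtype.ext (by simp))
  inner_mul_mul hr x x' y y' := θ.inner_act_of_mem _ _ _ x'.2
  total_mul {s t r} hr := by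
    subst hr
    set M := Submodule.topologicalClosure (Submodule.span ℂ
      {z : θ.fiber h (s + t) | ∃ (x : θ.fiber h s) (y : θ.fiber h t), _}) with hM
    -- The vectors θ_s(|k⟩⟨h|) x are total in K, and projecting one onto the fibre at s + t yields
    -- the product of the projections of x and of k.
    have h1 : (⊤ : Submodule ℂ K) ≤ M.comap (θ.fiberProj hh (s + t)).toLinearMap := by
      rw [← θ.total_act hh s]
      refine Submodule.topologicalClosure_minimal _ ?_
        ((Submodule.isClosed_topologicalClosure _).preimage (ContinuousLinearMap.continuous _))
      rw [Submodule.span_le]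
      rintro _ ⟨x, k, rfl⟩
      refine Submodule.le_topologicalClosure _ (Submodule.subset_span
        ⟨θ.fiberProj hh s x, θ.fiberProj hh t k, Subtype.ext ?_⟩)
      change θ.act h s (θ.toHom s (rankOne ℂ h h) x) (θ.toHom t (rankOne ℂ h h) k) =
        θ.toHom (s + t) (rankOne ℂ h h) (θ.act h s x k)
      rw [act_toHom _ hh, θ.add, toHom_act]
    rw [eq_top_iff]
    rintro z -
    rw [← θ.fiberProj_coe hh (s + t) z]
    exact h1 Submodule.mem_top
  measurable_mul k m n := by
    refine (Continuous.inner (𝕜 := ℂ) (θ.continuous_toHom_apply _ (by fun_prop) _)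
      (θ.continuous_act.comp (?_ : Continuous fun p : ℝ≥0 × ℝ≥0 =>
        (p.1, θ.toHom p.1 (rankOne ℂ h h) (TopologicalSpace.denseSeq K m),
          θ.toHom p.2 (rankOne ℂ h h) (TopologicalSpace.denseSeq K n))))).measurable
    exact continuous_fst.prodMk ((θ.continuous_toHom_apply _ continuous_fst _).prodMk
      (θ.continuous_toHom_apply _ continuous_snd _))
  mul_assoc {r s t rs st rst} hrs hst h₁ h₂ x y z := by
    subst hrs hst h₁
    exact Subtype.ext (θ.act_act _ _ _ _ _)

variable [TopologicalSpace.SeparableSpace K] (θ : EZeroSemigroup K) {h : K} (hh : ‖h‖ = 1)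

end EZeroSemigroup

/-! ### Units from intertwining semigroups. -/

namespace IntertwiningSemigroup

open InnerProductSpace (rankOne)

variable {H : Type u} [NormedAddCommGroup H] [InnerProductSpace ℂ H] [CompleteSpace H]
  {ϑ : EZeroSemigroup H} (U : IntertwiningSemigroup ϑ)

theorem toHom_op (t : ℝ≥0) (a : H →L[ℂ] H) (x : H) :
    ϑ.toHom t a (U.op t x) = U.op t (a x) :=
  DFunLike.congr_fun (U.intertwines t a) x

theorem op_mem_fiber {h : H} (hh : ‖h‖ = 1) (t : ℝ≥0) : U.op t h ∈ ϑ.fiber h t := by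
  rw [EZeroSemigroup.mem_fiber, toHom_op, InnerProductSpace.rankOne_apply,
    inner_self_eq_norm_sq_to_K, hh]
  simp

/-- Under X ↦ X h, the operator belonging to the vector U_t h is U_t itself. -/
theorem act_op {h : H} (hh : ‖h‖ = 1) (t : ℝ≥0) (x : H) : ϑ.act h t (U.op t h) x = U.op t x := by
  rw [EZeroSemigroup.act_apply, toHom_op, InnerProductSpace.rankOne_apply,
    inner_self_eq_norm_sq_to_K, hh]
  simp

/-- The unital unit of the Arveson system that is given by an intertwining semigroup. -/
noncomputable def unit [TopologicalSpace.SeparableSpace H] {h : H} (hh : ‖h‖ = 1) :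
    (ϑ.arveson hh).UnitalUnit where
  sec t := (⟨U.op t h, U.op_mem_fiber hh t⟩ : ϑ.fiber h t)
  measurable_sec n :=
    (Continuous.inner (𝕜 := ℂ) (ϑ.continuous _ _) (U.continuous _)).measurable
  norm_sec t := (U.isometry t h).trans hh
  mul_sec {s t r} hr := by
    subst hr
    refine Subtype.ext ?_
    change ϑ.act h s (U.op s h) (U.op t h) = U.op (s + t) h
    rw [U.act_op hh, U.add]
    rfl

end IntertwiningSemigroup

/-! ### Words: comparing two Arveson systems through corresponding generators. -/

namespace ArvesonSystem

variable {A : ArvesonSystem.{u}} {T : ArvesonSystem.{v}}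

/-- The product of pairs of vectors from two Arveson systems. -/
noncomputable def mulPair {s t r : ℝ≥0} (h : s + t = r) (p : A.space s × T.space s)
    (q : A.space t × T.space t) : A.space r × T.space r :=
  (A.mul h p.1 q.1, T.mul h p.2 q.2)

theorem mulPair_assoc {r s t rs st rst : ℝ≥0} (hrs : r + s = rs) (hst : s + t = st)
    (h₁ : rs + t = rst) (h₂ : r + st = rst) (p : A.space r × T.space r) (q : A.space s × T.space s)
    (k : A.space t × T.space t) :
    mulPair h₁ (mulPair hrs p q) k = mulPair h₂ p (mulPair hst q k) :=
  Prod.ext (A.mul_assoc hrs hst h₁ h₂ _ _ _) (T.mul_assoc hrs hst h₁ h₂ _ _ _)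

/-- Spans and closures are taken in the product space, so both components are approximated by the
same linear combinations. This lets relations pass from one system to the other. -/
theorem mulPair_mem {s t r : ℝ≥0} (h : s + t = r) {P : Set (A.space s × T.space s)}
    {Q : Set (A.space t × T.space t)} {M : Submodule ℂ (A.space r × T.space r)}
    (hM : IsClosed (M : Set (A.space r × T.space r))) (H : ∀ p ∈ P, ∀ q ∈ Q, mulPair h p q ∈ M)
    {p : A.space s × T.space s} (hp : p ∈ (Submodule.span ℂ P).topologicalClosure)
    {q : A.space t × T.space t} (hq : q ∈ (Submodule.span ℂ Q).topologicalClosure) :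
    mulPair h p q ∈ M := by
  have h1 : ∀ p ∈ P, mulPair h p q ∈ M := by
    intro p hp
    let L := (A.mulL h p.1).prodMap (T.mulL h p.2)
    have : (Submodule.span ℂ Q).topologicalClosure ≤ M.comap L.toLinearMap := by
      refine Submodule.topologicalClosure_minimal _ ?_ (hM.preimage L.continuous)
      rw [Submodule.span_le]
      exact fun q hq => H p hp q hq
    exact this hq
  let L := ((A.mulL h).flip q.1).prodMap ((T.mulL h).flip q.2)
  have : (Submodule.span ℂ P).topologicalClosure ≤ M.comap L.toLinearMap := by
    refine Submodule.topologicalClosure_minimal _ ?_ (hM.preimage L.continuous)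
    rw [Submodule.span_le]
    exact h1
  exact this hp

/-- The pairs of corresponding products of generators of two Arveson systems. -/
inductive IsWord (gen : ∀ t, Set (A.space t × T.space t)) : ∀ t, A.space t × T.space t → Prop
  | of {t : ℝ≥0} {p : A.space t × T.space t} (hp : p ∈ gen t) : IsWord gen t p
  | mul {s t r : ℝ≥0} (h : s + t = r) {p : A.space s × T.space s} {q : A.space t × T.space t}
    (hp : IsWord gen s p) (hq : IsWord gen t q) : IsWord gen r (mulPair h p q)

/-- Every generator can be split at every intermediate time. -/
def IsSplit (gen : ∀ t, Set (A.space t × T.space t)) : Prop :=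
  ∀ {s t r : ℝ≥0} (h : s + t = r), ∀ p ∈ gen r,
    p ∈ (Submodule.span ℂ {k | ∃ p ∈ gen s, ∃ q ∈ gen t, mulPair h p q = k}).topologicalClosure

/-- Corresponding generators have the same inner products. -/
def IsGram (gen : ∀ t, Set (A.space t × T.space t)) : Prop :=
  ∀ t, ∀ p ∈ gen t, ∀ q ∈ gen t, inner ℂ p.1 q.1 = inner ℂ p.2 q.2

variable {gen : ∀ t, Set (A.space t × T.space t)}

/-- A cut of a product of two words falls into one of the factors: split that factor and
reassociate. -/
theorem IsWord.split (hs : IsSplit gen) {r : ℝ≥0} {p : A.space r × T.space r}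
    (hp : IsWord gen r p) : ∀ {s t : ℝ≥0} (h : s + t = r),
    p ∈ (Submodule.span ℂ {k | ∃ p, IsWord gen s p ∧ ∃ q, IsWord gen t q ∧
      mulPair h p q = k}).topologicalClosure := by
  induction hp with
  | of hp =>
    intro s t h
    refine Submodule.topologicalClosure_mono (Submodule.span_mono ?_) (hs h _ hp)
    rintro _ ⟨p, hp, q, hq, rfl⟩
    exact ⟨p, .of hp, q, .of hq, rfl⟩
  | @mul s₀ t₀ r h₀ p q hp hq ihp ihq =>
    intro s t h
    have hcl := Submodule.isClosed_topologicalClosure (Submodule.span ℂ {k |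
      ∃ p, IsWord gen s p ∧ ∃ q, IsWord gen t q ∧ mulPair h p q = k})
    rcases le_total s s₀ with hle | hle
    · have e1 : s + (s₀ - s) = s₀ := add_tsub_cancel_of_le hle
      have e2 : (s₀ - s) + t₀ = t := add_left_cancel (a := s) (by rw [← add_assoc, e1, h₀, h])
      refine mulPair_mem h₀ hcl ?_ (ihp e1)
        (Submodule.le_topologicalClosure _ (Submodule.subset_span (Set.mem_singleton q)))
      rintro _ ⟨p₁, hp₁, p₂, hp₂, rfl⟩ q rfl
      refine Submodule.le_topologicalClosure _ (Submodule.subset_span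
        ⟨p₁, hp₁, mulPair e2 p₂ q, hp₂.mul e2 hq, ?_⟩)
      exact (mulPair_assoc e1 e2 h₀ h p₁ p₂ q).symm
    · have e1 : s₀ + (s - s₀) = s := add_tsub_cancel_of_le hle
      have e2 : (s - s₀) + t = t₀ := add_left_cancel (a := s₀) (by rw [← add_assoc, e1, h₀, h])
      refine mulPair_mem h₀ hcl ?_
        (Submodule.le_topologicalClosure _ (Submodule.subset_span (Set.mem_singleton p))) (ihq e2)
      rintro p rfl _ ⟨q₁, hq₁, q₂, hq₂, rfl⟩
      refine Submodule.le_topologicalClosure _ (Submodule.subset_span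
        ⟨mulPair e1 p q₁, hp.mul e1 hq₁, q₂, hq₂, ?_⟩)
      exact mulPair_assoc e1 e2 h h₀ p q₁ q₂

theorem inner_eq_of_mem_closure {X Y : Type*} [NormedAddCommGroup X] [InnerProductSpace ℂ X]
    [NormedAddCommGroup Y] [InnerProductSpace ℂ Y] {P : Set (X × Y)} {p : X × Y}
    (H : ∀ q ∈ P, inner ℂ p.1 q.1 = inner ℂ p.2 q.2) {q : X × Y}
    (hq : q ∈ (Submodule.span ℂ P).topologicalClosure) : inner ℂ p.1 q.1 = inner ℂ p.2 q.2 := by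
  let L : X × Y →L[ℂ] ℂ := (innerSL ℂ p.1).comp (ContinuousLinearMap.fst ℂ X Y) -
    (innerSL ℂ p.2).comp (ContinuousLinearMap.snd ℂ X Y)
  have : (Submodule.span ℂ P).topologicalClosure ≤ L.ker := by
    refine Submodule.topologicalClosure_minimal _ ?_ L.isClosed_ker
    rw [Submodule.span_le]
    intro q hq
    exact sub_eq_zero.2 (H q hq)
  exact sub_eq_zero.1 (this hq)

theorem inner_mulPair {s t r : ℝ≥0} (h : s + t = r) {p p' : A.space s × T.space s}
    {q q' : A.space t × T.space t} (hp : inner ℂ p.1 p'.1 = inner ℂ p.2 p'.2)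
    (hq : inner ℂ q.1 q'.1 = inner ℂ q.2 q'.2) :
    inner ℂ (mulPair h p q).1 (mulPair h p' q').1 =
      inner ℂ (mulPair h p q).2 (mulPair h p' q').2 := by
  simp only [mulPair, A.inner_mul_mul, T.inner_mul_mul, hp, hq]

theorem inner_eq_symm {X Y : Type*} [NormedAddCommGroup X] [InnerProductSpace ℂ X]
    [NormedAddCommGroup Y] [InnerProductSpace ℂ Y] {p q : X × Y}
    (h : inner ℂ p.1 q.1 = inner ℂ p.2 q.2) : inner ℂ q.1 p.1 = inner ℂ q.2 p.2 := by
  rw [← inner_conj_symm, h, inner_conj_symm]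

/-- Induction on the word: cut the generator where the word is a product, and inner products
factorise. -/
theorem IsWord.inner_gen (hs : IsSplit gen) (hg : IsGram gen) {t : ℝ≥0}
    {q : A.space t × T.space t} (hq : IsWord gen t q) :
    ∀ p ∈ gen t, inner ℂ q.1 p.1 = inner ℂ q.2 p.2 := by
  induction hq with
  | of hq => exact fun p hp => hg _ _ hq _ hp
  | mul h _ _ ihp ihq =>
    intro p hp
    refine inner_eq_of_mem_closure ?_ (hs h p hp)
    rintro _ ⟨p₁, hp₁, p₂, hp₂, rfl⟩
    exact inner_mulPair h (ihp _ hp₁) (ihq _ hp₂)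

/-- The same induction on the first word, now cutting the second word by `IsWord.split`; the base
case is `IsWord.inner_gen`. -/
theorem IsWord.inner_eq (hs : IsSplit gen) (hg : IsGram gen) {t : ℝ≥0}
    {p : A.space t × T.space t} (hp : IsWord gen t p) :
    ∀ {q}, IsWord gen t q → inner ℂ p.1 q.1 = inner ℂ p.2 q.2 := by
  induction hp with
  | of hp => exact fun hq => inner_eq_symm (hq.inner_gen hs hg _ hp)
  | mul h _ _ ihp ihq =>
    intro q hq
    refine inner_eq_of_mem_closure ?_ (hq.split hs h)
    rintro _ ⟨q₁, hq₁, q₂, hq₂, rfl⟩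
    exact inner_mulPair h (ihp hq₁) (ihq hq₂)

/-- The closed linear span of the second components of the words. -/
noncomputable def wordSpan (gen : ∀ t, Set (A.space t × T.space t)) (t : ℝ≥0) :
    Submodule ℂ (T.space t) :=
  (Submodule.span ℂ {z | ∃ p, IsWord gen t p ∧ p.2 = z}).topologicalClosure

/-- The product subsystem that is generated by the second components. -/
noncomputable def wordSubsystem (hs : IsSplit gen) : Subsystem T where
  carrier t := wordSpan gen t
  isClosed t := Submodule.isClosed_topologicalClosure _
  mul_eq {s t r} h := by
    apply le_antisymm
    · refine Submodule.topologicalClosure_minimal _ ?_ (Submodule.isClosed_topologicalClosure _)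
      rw [Submodule.span_le]
      rintro _ ⟨x, hx, y, hy, rfl⟩
      refine bilin_mem (T.mulL h) _ _ _ (Submodule.isClosed_topologicalClosure _) ?_ hx hy
      rintro _ ⟨p, hp, rfl⟩ _ ⟨q, hq, rfl⟩
      exact Submodule.le_topologicalClosure _ (Submodule.subset_span ⟨_, hp.mul h hq, rfl⟩)
    · refine Submodule.topologicalClosure_minimal _ ?_ (Submodule.isClosed_topologicalClosure _)
      rw [Submodule.span_le]
      rintro _ ⟨p, hp, rfl⟩
      let L := ContinuousLinearMap.snd ℂ (A.space r) (T.space r)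
      set M := (Submodule.span ℂ {z | ∃ x ∈ wordSpan gen s, ∃ y ∈ wordSpan gen t,
        T.mul h x y = z}).topologicalClosure
      have : (Submodule.span ℂ {k | ∃ p, IsWord gen s p ∧ ∃ q, IsWord gen t q ∧
          mulPair h p q = k}).topologicalClosure ≤ M.comap L.toLinearMap := by
        refine Submodule.topologicalClosure_minimal _ ?_
          ((Submodule.isClosed_topologicalClosure _).preimage L.continuous)
        rw [Submodule.span_le]
        rintro _ ⟨p, hp, q, hq, rfl⟩
        exact Submodule.le_topologicalClosure _ (Submodule.subset_span
          ⟨_, Submodule.le_topologicalClosure _ (Submodule.subset_span ⟨p, hp, rfl⟩),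
            _, Submodule.le_topologicalClosure _ (Submodule.subset_span ⟨q, hq, rfl⟩), rfl⟩)
      exact this (hp.split hs h)

theorem IsWord.mem_wordSubsystem (hs : IsSplit gen) {t : ℝ≥0} {p : A.space t × T.space t}
    (hp : IsWord gen t p) : p.2 ∈ (wordSubsystem hs).carrier t :=
  Submodule.le_topologicalClosure _ (Submodule.subset_span ⟨p, hp, rfl⟩)

theorem wordSubsystem_le (hs : IsSplit gen) (S : Subsystem T)
    (H : ∀ t, ∀ p ∈ gen t, p.2 ∈ S.carrier t) (t : ℝ≥0) :
    (wordSubsystem hs).carrier t ≤ S.carrier t := by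
  refine Submodule.topologicalClosure_minimal _ ?_ (S.isClosed t)
  rw [Submodule.span_le]
  rintro _ ⟨p, hp, rfl⟩
  change p.2 ∈ S.carrier t
  induction hp with
  | of hp => exact H _ _ hp
  | mul h _ _ ihp ihq => exact S.mul_mem h ihp ihq

/-- If the first components of the words are total, then mapping the first components to the second
ones defines a multiplicative family of unitaries. -/
theorem exists_equiv_wordSubsystem (hs : IsSplit gen) (hg : IsGram gen)
    (htot : ∀ t, (Submodule.span ℂ {x | ∃ p, IsWord gen t p ∧ p.1 = x}).topologicalClosure = ⊤) :
    ∃ Ψ : ∀ t, A.space t ≃ₗᵢ[ℂ] (wordSubsystem hs).carrier t,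
      (∀ t p, IsWord gen t p → (Ψ t p.1 : T.space t) = p.2) ∧
      ∀ {s t r : ℝ≥0} (h : s + t = r) (x : A.space s) (y : A.space t),
        (Ψ r (A.mul h x y) : T.space r) = T.mul h (Ψ s x) (Ψ t y) := by
  have hex : ∀ t, ∃ Ψ : A.space t ≃ₗᵢ[ℂ] (wordSubsystem hs).carrier t,
      ∀ p : {p // IsWord gen t p}, Ψ p.1.1 = ⟨p.1.2, p.2.mem_wordSubsystem hs⟩ := by
    intro t
    refine exists_linearIsometryEquiv_of_gram (fun p : {p // IsWord gen t p} => p.1.1)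
      (fun p => (⟨p.1.2, p.2.mem_wordSubsystem hs⟩ : (wordSubsystem hs).carrier t))
      (fun p q => p.2.inner_eq hs hg q.2) ?_ ?_
    · rw [← htot t]
      congr 2
      ext x
      constructor
      · rintro ⟨p, rfl⟩
        exact ⟨p.1, p.2, rfl⟩
      · rintro ⟨p, hp, rfl⟩
        exact ⟨⟨p, hp⟩, rfl⟩
    · set M := Submodule.topologicalClosure (Submodule.span ℂ (Set.range fun p :
        {p // IsWord gen t p} => (⟨p.1.2, p.2.mem_wordSubsystem hs⟩ :
          (wordSubsystem hs).carrier t))) with hM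
      have h1 : (wordSubsystem hs).carrier t ≤ M.map ((wordSubsystem hs).carrier t).subtype := by
        refine Submodule.topologicalClosure_minimal _ ?_ ?_
        · rw [Submodule.span_le]
          rintro _ ⟨p, hp, rfl⟩
          exact ⟨⟨p.2, hp.mem_wordSubsystem hs⟩,
            Submodule.le_topologicalClosure _ (Submodule.subset_span ⟨⟨p, hp⟩, rfl⟩), rfl⟩
        · rw [Submodule.map_coe]
          exact ((wordSubsystem hs).isClosed t).isClosedEmbedding_subtypeVal.isClosedMap _
            (Submodule.isClosed_topologicalClosure _)
      rw [eq_top_iff]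
      rintro x -
      obtain ⟨x', hx', e⟩ := h1 x.2
      rwa [← Subtype.ext (a1 := x') (a2 := x) e]
  choose Ψ hΨ using hex
  -- `R t` turns out to be the graph of `Ψ t`. Being a closed span of words, it is stable under
  -- products of pairs, and this is multiplicativity of Ψ.
  let R : ∀ t, Submodule ℂ (A.space t × T.space t) := fun t =>
    (Submodule.span ℂ {p | IsWord gen t p}).topologicalClosure
  have hR : ∀ t, IsClosed (R t : Set (A.space t × T.space t)) := fun t =>
    Submodule.isClosed_topologicalClosure _
  have hgraph : ∀ t x, (x, (Ψ t x : T.space t)) ∈ R t := by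
    intro t x
    let L : A.space t →L[ℂ] A.space t × T.space t := (ContinuousLinearMap.id ℂ _).prod
      (((wordSubsystem hs).carrier t).subtypeL.comp (Ψ t).toContinuousLinearEquiv.toContinuousLinearMap)
    have : (⊤ : Submodule ℂ (A.space t)) ≤ (R t).comap L.toLinearMap := by
      rw [← htot t]
      refine Submodule.topologicalClosure_minimal _ ?_ ((hR t).preimage L.continuous)
      rw [Submodule.span_le]
      rintro _ ⟨p, hp, rfl⟩
      have e : L p.1 = p := Prod.ext rfl (congrArg Subtype.val (hΨ t ⟨p, hp⟩))
      change L p.1 ∈ R t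
      rw [e]
      exact Submodule.le_topologicalClosure _ (Submodule.subset_span hp)
    exact this Submodule.mem_top
  have hgraph' : ∀ t p, p ∈ R t → (Ψ t p.1 : T.space t) = p.2 := by
    intro t p hp
    let L : A.space t × T.space t →L[ℂ] T.space t := (((wordSubsystem hs).carrier t).subtypeL.comp
      (Ψ t).toContinuousLinearEquiv.toContinuousLinearMap).comp (ContinuousLinearMap.fst ℂ _ _) -
        ContinuousLinearMap.snd ℂ _ _
    have : R t ≤ L.ker := by
      refine Submodule.topologicalClosure_minimal _ ?_ L.isClosed_ker
      rw [Submodule.span_le]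
      exact fun p hp => sub_eq_zero.2 (congrArg Subtype.val (hΨ t ⟨p, hp⟩))
    exact sub_eq_zero.1 (this hp)
  refine ⟨Ψ, fun t p hp => congrArg Subtype.val (hΨ t ⟨p, hp⟩), fun {s t r} h x y => ?_⟩
  refine hgraph' r (mulPair h (x, (Ψ s x : T.space s)) (y, (Ψ t y : T.space t)))
    (mulPair_mem h (hR r) ?_ (hgraph s x) (hgraph t y))
  exact fun p hp q hq => Submodule.le_topologicalClosure _ (Submodule.subset_span (hp.mul h hq))

end ArvesonSystem

/-! ### Recognising a spatial product. -/

namespace ArvesonSystem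

variable {E : ArvesonSystem.{u}} {F : ArvesonSystem.{v}} {e : E.UnitalUnit} {f : F.UnitalUnit}
  {A : ArvesonSystem.{w}}

/-- Embeddings of two spatial Arveson systems into a third one that identify the reference units and
that are orthogonal otherwise. -/
structure SpatialEmbedding (e : E.UnitalUnit) (f : F.UnitalUnit) (A : ArvesonSystem.{w}) where
  left : ∀ t, E.space t →L[ℂ] A.space t
  right : ∀ t, F.space t →L[ℂ] A.space t
  mul_left : ∀ {s t r : ℝ≥0} (h : s + t = r) x y,
    A.mul h (left s x) (left t y) = left r (E.mul h x y)
  mul_right : ∀ {s t r : ℝ≥0} (h : s + t = r) x y,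
    A.mul h (right s x) (right t y) = right r (F.mul h x y)
  inner_left_left : ∀ t x y, inner ℂ (left t x) (left t y) = inner ℂ x y
  inner_right_right : ∀ t x y, inner ℂ (right t x) (right t y) = inner ℂ x y
  inner_left_right : ∀ t x y,
    inner ℂ (left t x) (right t y) = inner ℂ x (e.sec t) * inner ℂ (f.sec t) y

namespace SpatialEmbedding

variable (ρ : SpatialEmbedding e f A)

/-- The generators of the embedded systems, paired with the generators of the spatial product. -/
def gen (t : ℝ≥0) : Set (A.space t × (E.tensor F).space t) :=
  {p | (∃ x, (ρ.left t x, tmul E F x (f.sec t)) = p) ∨ ∃ y, (ρ.right t y, tmul E F (e.sec t) y) = p}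

theorem left_mem_gen {t : ℝ≥0} (x : E.space t) :
    (ρ.left t x, tmul E F x (f.sec t)) ∈ ρ.gen t := Or.inl ⟨x, rfl⟩

theorem right_mem_gen {t : ℝ≥0} (y : F.space t) :
    (ρ.right t y, tmul E F (e.sec t) y) ∈ ρ.gen t := Or.inr ⟨y, rfl⟩

theorem mul_tmul {s t r : ℝ≥0} (h : s + t = r) (x : E.space s) (y : F.space s) (x' : E.space t)
    (y' : F.space t) : (E.tensor F).mul h (tmul E F x y) (tmul E F x' y') =
      tmul E F (E.mul h x x') (F.mul h y y') := (tensorEmbedding E F).map_mul h x x' y y'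

theorem inner_tmul {t : ℝ≥0} (x x' : E.space t) (y y' : F.space t) :
    inner ℂ (tmul E F x y) (tmul E F x' y') = inner ℂ x x' * inner ℂ y y' :=
  (tensorEmbedding E F).inner_map t x x' y y'

/-- Products are total in E_r and f_r = f_s f_t, so x ⊗ f_r is a limit of combinations of products
of generators, simultaneously with its partner; likewise for F. -/
theorem isSplit : IsSplit ρ.gen := by
  intro s t r h p hp
  set M := (Submodule.span ℂ {k | ∃ p ∈ ρ.gen s, ∃ q ∈ ρ.gen t, mulPair h p q = k}).topologicalClosure
  have hM : IsClosed (M : Set (A.space r × (E.tensor F).space r)) := Submodule.isClosed_topologicalClosure _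
  rcases hp with ⟨x, rfl⟩ | ⟨y, rfl⟩
  · let L : E.space r →L[ℂ] A.space r × (E.tensor F).space r :=
      (ρ.left r).prod ((tensorEmbedding E F).flip.mapL r (f.sec r))
    have : (⊤ : Submodule ℂ (E.space r)) ≤ M.comap L.toLinearMap := by
      rw [← E.total_mul h]
      refine Submodule.topologicalClosure_minimal _ ?_ (hM.preimage L.continuous)
      rw [Submodule.span_le]
      rintro _ ⟨x, y, rfl⟩
      refine Submodule.le_topologicalClosure _ (Submodule.subset_span
        ⟨_, ρ.left_mem_gen x, _, ρ.left_mem_gen y, ?_⟩)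
      rw [mulPair, mul_tmul, ρ.mul_left, f.mul_sec]
      rfl
    exact this Submodule.mem_top
  · let L : F.space r →L[ℂ] A.space r × (E.tensor F).space r :=
      (ρ.right r).prod ((tensorEmbedding E F).mapL r (e.sec r))
    have : (⊤ : Submodule ℂ (F.space r)) ≤ M.comap L.toLinearMap := by
      rw [← F.total_mul h]
      refine Submodule.topologicalClosure_minimal _ ?_ (hM.preimage L.continuous)
      rw [Submodule.span_le]
      rintro _ ⟨x, y, rfl⟩
      refine Submodule.le_topologicalClosure _ (Submodule.subset_span
        ⟨_, ρ.right_mem_gen x, _, ρ.right_mem_gen y, ?_⟩)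
      rw [mulPair, mul_tmul, ρ.mul_right, e.mul_sec]
      rfl
    exact this Submodule.mem_top

theorem isGram : IsGram ρ.gen := by
  rintro t _ (⟨x, rfl⟩ | ⟨x, rfl⟩) _ (⟨y, rfl⟩ | ⟨y, rfl⟩)
  · rw [ρ.inner_left_left, inner_tmul, f.inner_self_sec, mul_one]
  · rw [ρ.inner_left_right, inner_tmul]
  · refine inner_eq_symm (p := (ρ.left t y, tmul E F y (f.sec t)))
      (q := (ρ.right t x, tmul E F (e.sec t) x)) ?_
    rw [ρ.inner_left_right, inner_tmul]
  · rw [ρ.inner_right_right, inner_tmul, e.inner_self_sec, one_mul]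

/-- The second components of the generators are exactly the vectors that define the spatial product.
-/
theorem wordSubsystem_eq : wordSubsystem ρ.isSplit = spatialProduct e f := by
  ext1
  funext t
  refine le_antisymm (wordSubsystem_le _ _ ?_ t) (spatialProduct_le e f ?_ ?_ t)
  · rintro t _ (⟨x, rfl⟩ | ⟨y, rfl⟩)
    · exact tmul_sec_right_mem e f x
    · exact tmul_sec_left_mem e f y
  · exact fun t x => (IsWord.of (ρ.left_mem_gen x)).mem_wordSubsystem ρ.isSplit
  · exact fun t x => (IsWord.of (ρ.right_mem_gen x)).mem_wordSubsystem ρ.isSplit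

/-- If the embedded systems generate, then the ambient system is the spatial product. -/
theorem exists_equiv (htot : ∀ t, (Submodule.span ℂ {x | ∃ p, IsWord ρ.gen t p ∧
      p.1 = x}).topologicalClosure = ⊤) :
    ∃ Ψ : ∀ t, A.space t ≃ₗᵢ[ℂ] (spatialProduct e f).carrier t,
      (∀ t x, (Ψ t (ρ.left t x) : (E.tensor F).space t) = tmul E F x (f.sec t)) ∧
      ∀ {s t r : ℝ≥0} (h : s + t = r) (x : A.space s) (y : A.space t),
        (Ψ r (A.mul h x y) : (E.tensor F).space r) = (E.tensor F).mul h (Ψ s x) (Ψ t y) := by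
  rw [← ρ.wordSubsystem_eq]
  obtain ⟨Ψ, h1, h2⟩ := exists_equiv_wordSubsystem ρ.isSplit ρ.isGram htot
  exact ⟨Ψ, fun t x => h1 t _ (.of (ρ.left_mem_gen x)), h2⟩

end SpatialEmbedding

end ArvesonSystem

/-! ### Powers sums inside a dilation. -/

section

open InnerProductSpace (rankOne)
open ContinuousLinearMap (adjoint)

section DirectSum

variable {H₁ H₂ K : Type*} [NormedAddCommGroup H₁] [InnerProductSpace ℂ H₁]
  [NormedAddCommGroup H₂] [InnerProductSpace ℂ H₂] [NormedAddCommGroup K] [InnerProductSpace ℂ K]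

theorem inlL_apply (x : H₁) : inlL H₁ H₂ x = WithLp.toLp 2 (x, 0) := rfl

theorem inrL_apply (x : H₂) : inrL H₁ H₂ x = WithLp.toLp 2 (0, x) := rfl

theorem inner_inlL_inlL (x y : H₁) : inner ℂ (inlL H₁ H₂ x) (inlL H₁ H₂ y) = inner ℂ x y := by
  simp [inlL_apply, WithLp.prod_inner_apply]

theorem inner_inrL_inrL (x y : H₂) : inner ℂ (inrL H₁ H₂ x) (inrL H₁ H₂ y) = inner ℂ x y := by
  simp [inrL_apply, WithLp.prod_inner_apply]

theorem blockOperator_inlL (a₁₁ : H₁ →L[ℂ] H₁) (a₁₂ : H₂ →L[ℂ] H₁) (a₂₁ : H₁ →L[ℂ] H₂)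
    (a₂₂ : H₂ →L[ℂ] H₂) (x : H₁) :
    blockOperator a₁₁ a₁₂ a₂₁ a₂₂ (inlL H₁ H₂ x) = inlL H₁ H₂ (a₁₁ x) + inrL H₁ H₂ (a₂₁ x) := by
  simp [blockOperator, inlL, inrL, ← WithLp.toLp_add]

theorem blockOperator_inrL (a₁₁ : H₁ →L[ℂ] H₁) (a₁₂ : H₂ →L[ℂ] H₁) (a₂₁ : H₁ →L[ℂ] H₂)
    (a₂₂ : H₂ →L[ℂ] H₂) (x : H₂) :
    blockOperator a₁₁ a₁₂ a₂₁ a₂₂ (inrL H₁ H₂ x) = inlL H₁ H₂ (a₁₂ x) + inrL H₁ H₂ (a₂₂ x) := by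
  simp [blockOperator, inlL, inrL, ← WithLp.toLp_add]

/-- The embedding of the first summand. -/
noncomputable def inlᵢ (J : WithLp 2 (H₁ × H₂) →ₗᵢ[ℂ] K) : H₁ →ₗᵢ[ℂ] K where
  toLinearMap := J.toLinearMap ∘ₗ (inlL H₁ H₂).toLinearMap
  norm_map' x := (J.norm_map _).trans (by simp [inlL_apply])

/-- The embedding of the second summand. -/
noncomputable def inrᵢ (J : WithLp 2 (H₁ × H₂) →ₗᵢ[ℂ] K) : H₂ →ₗᵢ[ℂ] K where
  toLinearMap := J.toLinearMap ∘ₗ (inrL H₁ H₂).toLinearMap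
  norm_map' x := (J.norm_map _).trans (by simp [inrL_apply])

theorem inlᵢ_apply (J : WithLp 2 (H₁ × H₂) →ₗᵢ[ℂ] K) (x : H₁) : inlᵢ J x = J (inlL H₁ H₂ x) := rfl

theorem inrᵢ_apply (J : WithLp 2 (H₁ × H₂) →ₗᵢ[ℂ] K) (x : H₂) : inrᵢ J x = J (inrL H₁ H₂ x) := rfl

theorem apply_eq_add (J : WithLp 2 (H₁ × H₂) →ₗᵢ[ℂ] K) (x : WithLp 2 (H₁ × H₂)) :
    J x = inlᵢ J x.fst + inrᵢ J x.snd := by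
  rw [inlᵢ_apply, inrᵢ_apply, ← map_add]
  congr 1
  rw [inlL_apply, inrL_apply, ← WithLp.toLp_add]
  simp
  rfl

end DirectSum

section Dilation

variable {H H₁ H₂ K : Type*}
  [NormedAddCommGroup H] [InnerProductSpace ℂ H] [CompleteSpace H]
  [NormedAddCommGroup H₁] [InnerProductSpace ℂ H₁] [CompleteSpace H₁]
  [NormedAddCommGroup H₂] [InnerProductSpace ℂ H₂] [CompleteSpace H₂]
  [NormedAddCommGroup K] [InnerProductSpace ℂ K] [CompleteSpace K]

theorem adjoint_comp_self_apply (J : H →ₗᵢ[ℂ] K) (x : H) :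
    adjoint J.toContinuousLinearMap (J x) = x :=
  DFunLike.congr_fun ((ContinuousLinearMap.norm_map_iff_adjoint_comp_self
    J.toContinuousLinearMap).1 J.norm_map) x

theorem ampliate_apply (J : H →ₗᵢ[ℂ] K) (a : H →L[ℂ] H) (x : H) :
    ampliate J a (J x) = J (a x) := by
  change J (a (adjoint J.toContinuousLinearMap (J x))) = _
  rw [adjoint_comp_self_apply]

theorem star_ampliate_mul (J : H →ₗᵢ[ℂ] K) (a b : H →L[ℂ] H) :
    star (ampliate J a) * ampliate J b = ampliate J (star a * b) := by
  have : star (ampliate J a) = ampliate J (star a) := by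
    simp only [ampliate, ContinuousLinearMap.star_eq_adjoint, ContinuousLinearMap.adjoint_comp,
      ContinuousLinearMap.adjoint_adjoint]
    rfl
  rw [this]
  ext x
  exact ampliate_apply J (star a) _

theorem ampliate_rankOne (J : H →ₗᵢ[ℂ] K) (x y : H) :
    ampliate J (rankOne ℂ x y) = rankOne ℂ (J x) (J y) := by
  rw [ampliate, InnerProductSpace.rankOne_comp, InnerProductSpace.comp_rankOne,
    ContinuousLinearMap.adjoint_adjoint]
  rfl

/-- Vectors on which a dilated semigroup is multiplicative stay in the subspace. -/
theorem toHom_ampliate_apply {T : (H →L[ℂ] H) → (H →L[ℂ] H)} {θ : EZeroSemigroup K}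
    {J : H →ₗᵢ[ℂ] K} {t : ℝ≥0} (hT : ∀ a, T a =
      adjoint J.toContinuousLinearMap ∘L θ.toHom t (ampliate J a) ∘L J.toContinuousLinearMap)
    (a : H →L[ℂ] H) (x : H) (hx : inner ℂ x (T (star a * a) x) = inner ℂ (T a x) (T a x)) :
    θ.toHom t (ampliate J a) (J x) = J (T a x) := by
  set z := θ.toHom t (ampliate J a) (J x) with hz
  have h1 : adjoint J.toContinuousLinearMap z = T a x := by rw [hT]; rfl
  -- θ_t is multiplicative, so ‖z‖² is the expectation of T(a*a) at x, by hypothesis ‖T(a)x‖². As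
  -- T(a)x is the compression of z, no component outside the subspace is left.
  have h2 : inner ℂ z z = inner ℂ (T a x) (T a x) := by
    rw [← hx, hz, θ.inner_toHom_left, ← θ.toHom_mul_apply, star_ampliate_mul, hT]
    exact (ContinuousLinearMap.adjoint_inner_right J.toContinuousLinearMap _ _).symm
  have h3 : inner ℂ (J (T a x)) z = inner ℂ (T a x) (T a x) := by
    rw [← h1]
    exact (ContinuousLinearMap.adjoint_inner_right J.toContinuousLinearMap _ _).symm
  rw [← sub_eq_zero, ← inner_self_eq_zero (𝕜 := ℂ), inner_sub_left, inner_sub_right,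
    inner_sub_right, h2, h3, ← inner_conj_symm z, h3, inner_conj_symm, J.inner_map_map]
  ring

theorem adjoint_inlL_apply (x : WithLp 2 (H₁ × H₂)) : adjoint (inlL H₁ H₂) x = x.fst := by
  refine ext_inner_left ℂ fun y => ?_
  rw [ContinuousLinearMap.adjoint_inner_right]
  simp [inlL_apply, WithLp.prod_inner_apply]

theorem adjoint_inrL_apply (x : WithLp 2 (H₁ × H₂)) : adjoint (inrL H₁ H₂) x = x.snd := by
  refine ext_inner_left ℂ fun y => ?_
  rw [ContinuousLinearMap.adjoint_inner_right]
  simp [inrL_apply, WithLp.prod_inner_apply]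

variable {ϑ₁ : EZeroSemigroup H₁} {ϑ₂ : EZeroSemigroup H₂} (U₁ : IntertwiningSemigroup ϑ₁)
  (U₂ : IntertwiningSemigroup ϑ₂) (t : ℝ≥0)

theorem powersSum_inl_inl (x y h : H₁) :
    powersSum ϑ₁ ϑ₂ U₁ U₂ t (rankOne ℂ (inlL H₁ H₂ x) (inlL H₁ H₂ y)) (inlL H₁ H₂ h) =
      inlL H₁ H₂ (ϑ₁.toHom t (rankOne ℂ x y) h) := by
  have e1 : adjoint (inlL H₁ H₂) ∘L rankOne ℂ (inlL H₁ H₂ x) (inlL H₁ H₂ y) ∘L inlL H₁ H₂ =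
      rankOne ℂ x y := by
    ext z
    simp [adjoint_inlL_apply]
    simp [inlL_apply]
  have e2 : adjoint (inrL H₁ H₂) ∘L rankOne ℂ (inlL H₁ H₂ x) (inlL H₁ H₂ y) ∘L inlL H₁ H₂ = 0 := by
    ext z
    simp [adjoint_inrL_apply]
    simp [inlL_apply]
  rw [powersSum, blockOperator_inlL, e1, e2]
  simp

theorem powersSum_inr_inr (x y h : H₂) :
    powersSum ϑ₁ ϑ₂ U₁ U₂ t (rankOne ℂ (inrL H₁ H₂ x) (inrL H₁ H₂ y)) (inrL H₁ H₂ h) =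
      inrL H₁ H₂ (ϑ₂.toHom t (rankOne ℂ x y) h) := by
  have e1 : adjoint (inrL H₁ H₂) ∘L rankOne ℂ (inrL H₁ H₂ x) (inrL H₁ H₂ y) ∘L inrL H₁ H₂ =
      rankOne ℂ x y := by
    ext z
    simp [adjoint_inrL_apply]
    simp [inrL_apply]
  have e2 : adjoint (inlL H₁ H₂) ∘L rankOne ℂ (inrL H₁ H₂ x) (inrL H₁ H₂ y) ∘L inrL H₁ H₂ = 0 := by
    ext z
    simp [adjoint_inlL_apply]
    simp [inrL_apply]
  rw [powersSum, blockOperator_inrL, e1, e2]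
  simp

theorem powersSum_inl_inr (x : H₁) (y h : H₂) :
    powersSum ϑ₁ ϑ₂ U₁ U₂ t (rankOne ℂ (inlL H₁ H₂ x) (inrL H₁ H₂ y)) (inrL H₁ H₂ h) =
      inlL H₁ H₂ ((inner ℂ (U₂.op t y) h : ℂ) • U₁.op t x) := by
  have e1 : adjoint (inlL H₁ H₂) ∘L rankOne ℂ (inlL H₁ H₂ x) (inrL H₁ H₂ y) ∘L inrL H₁ H₂ =
      rankOne ℂ x y := by
    ext z
    simp [adjoint_inlL_apply]
    simp [inlL_apply, inrL_apply]
  have e2 : adjoint (inrL H₁ H₂) ∘L rankOne ℂ (inlL H₁ H₂ x) (inrL H₁ H₂ y) ∘L inrL H₁ H₂ = 0 := by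
    ext z
    simp [adjoint_inrL_apply]
    simp [inlL_apply]
  rw [powersSum, blockOperator_inrL, e1, e2]
  simp [ContinuousLinearMap.adjoint_inner_right]

variable {U₁ U₂ t} {θ : EZeroSemigroup K} {J : WithLp 2 (H₁ × H₂) →ₗᵢ[ℂ] K}

namespace IsMinimalDilation

/-- The diagonal corner of the Powers sum is the multiplicative ϑ¹, so the norm condition of
`toHom_ampliate_apply` holds and the dilation does not leave H₁ here. -/
theorem toHom_inl (hd : IsMinimalDilation (powersSum ϑ₁ ϑ₂ U₁ U₂) θ J) (x y h : H₁) :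
    θ.toHom t (rankOne ℂ (inlᵢ J x) (inlᵢ J y)) (inlᵢ J h) =
      inlᵢ J (ϑ₁.toHom t (rankOne ℂ x y) h) := by
  have := toHom_ampliate_apply (hd.dilation t) (rankOne ℂ (inlL H₁ H₂ x) (inlL H₁ H₂ y))
    (inlL H₁ H₂ h) ?_
  · rwa [ampliate_rankOne, powersSum_inl_inl] at this
  · rw [EZeroSemigroup.star_rankOne, EZeroSemigroup.rankOne_mul_rankOne, inner_inlL_inlL, ← map_smul,
      powersSum_inl_inl, powersSum_inl_inl, inner_inlL_inlL, inner_inlL_inlL, ϑ₁.inner_toHom_left,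
      ← ϑ₁.toHom_mul_apply, EZeroSemigroup.star_rankOne, EZeroSemigroup.rankOne_mul_rankOne]

theorem toHom_inr (hd : IsMinimalDilation (powersSum ϑ₁ ϑ₂ U₁ U₂) θ J) (x y h : H₂) :
    θ.toHom t (rankOne ℂ (inrᵢ J x) (inrᵢ J y)) (inrᵢ J h) =
      inrᵢ J (ϑ₂.toHom t (rankOne ℂ x y) h) := by
  have := toHom_ampliate_apply (hd.dilation t) (rankOne ℂ (inrL H₁ H₂ x) (inrL H₁ H₂ y))
    (inrL H₁ H₂ h) ?_
  · rwa [ampliate_rankOne, powersSum_inr_inr] at this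
  · rw [EZeroSemigroup.star_rankOne, EZeroSemigroup.rankOne_mul_rankOne, inner_inrL_inrL, ← map_smul,
      powersSum_inr_inr, powersSum_inr_inr, inner_inrL_inrL, inner_inrL_inrL, ϑ₂.inner_toHom_left,
      ← ϑ₂.toHom_mul_apply, EZeroSemigroup.star_rankOne, EZeroSemigroup.rankOne_mul_rankOne]

/-- The off-diagonal corner is not multiplicative, so only the compression is known. It is all that
is needed for the mixed inner products of the embedded systems. -/
theorem inner_inl_toHom_inr (hd : IsMinimalDilation (powersSum ϑ₁ ϑ₂ U₁ U₂) θ J) (h x : H₁) (y h' : H₂) :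
    inner ℂ (inlᵢ J h) (θ.toHom t (rankOne ℂ (inlᵢ J x) (inrᵢ J y)) (inrᵢ J h')) =
      inner ℂ h (U₁.op t x) * inner ℂ (U₂.op t y) h' := by
  have h1 := congrArg (inner ℂ (inlL H₁ H₂ h)) (powersSum_inl_inr U₁ U₂ t x y h')
  rw [inner_inlL_inlL, inner_smul_right, hd.dilation, ampliate_rankOne] at h1
  rw [mul_comm, ← h1]
  exact (ContinuousLinearMap.adjoint_inner_right J.toContinuousLinearMap _ _).symm

end IsMinimalDilation

end Dilation

end

/-! ### The Arveson system of a minimal dilation is generated by those of the summands. -/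

section

open InnerProductSpace (rankOne)
open ContinuousLinearMap (adjoint)

namespace EZeroSemigroup

variable {K : Type u} [NormedAddCommGroup K] [InnerProductSpace ℂ K] [CompleteSpace K]
  (θ : EZeroSemigroup K) {h : K} (hh : ‖h‖ = 1)

/-- `k ↦ θ_t(|k⟩⟨h|) x` as a continuous map. -/
noncomputable def actL (h : K) (t : ℝ≥0) (x : K) : K →L[ℂ] K :=
  (θ.act h t x).mkContinuous (‖h‖ * ‖x‖) fun k =>
    (θ.norm_act_le t x k).trans_eq (by ring)

variable [TopologicalSpace.SeparableSpace K]

/-- The inclusion of the fibres of the Arveson system into the Hilbert space. -/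
noncomputable def val (t : ℝ≥0) : (θ.arveson hh).space t →L[ℂ] K := (θ.fiber h t).subtypeL

/-- The elements of the fibres of the Arveson system. -/
def mkFiber {t : ℝ≥0} {x : K} (hx : x ∈ θ.fiber h t) : (θ.arveson hh).space t :=
  (⟨x, hx⟩ : θ.fiber h t)

theorem val_mkFiber {t : ℝ≥0} {x : K} (hx : x ∈ θ.fiber h t) :
    θ.val hh t (θ.mkFiber hh hx) = x := rfl

theorem val_mem {t : ℝ≥0} (x : (θ.arveson hh).space t) : θ.val hh t x ∈ θ.fiber h t :=
  Subtype.property (p := (· ∈ θ.fiber h t)) x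

theorem val_injective (t : ℝ≥0) : Function.Injective (θ.val hh t) := Subtype.val_injective

theorem inner_val {t : ℝ≥0} (x y : (θ.arveson hh).space t) :
    inner ℂ (θ.val hh t x) (θ.val hh t y) = inner ℂ x y := rfl

theorem norm_val {t : ℝ≥0} (x : (θ.arveson hh).space t) : ‖θ.val hh t x‖ = ‖x‖ := rfl

theorem val_mul {s t r : ℝ≥0} (hr : s + t = r) (x : (θ.arveson hh).space s)
    (y : (θ.arveson hh).space t) :
    θ.val hh r ((θ.arveson hh).mul hr x y) = θ.act h s (θ.val hh s x) (θ.val hh t y) := rfl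

/-- The vectors `θ_t(|k⟩⟨h|) x`, with `x` in the fibre, are total. -/
theorem total_act_val (t : ℝ≥0) :
    (Submodule.span ℂ {z | ∃ (x : (θ.arveson hh).space t) (k : K),
      θ.act h t (θ.val hh t x) k = z}).topologicalClosure = ⊤ := by
  rw [← θ.total_act hh t]
  congr 2
  ext z
  constructor
  · rintro ⟨x, k, rfl⟩
    exact ⟨_, k, rfl⟩
  · rintro ⟨x, k, rfl⟩
    exact ⟨θ.mkFiber hh (θ.toHom_mem hh t x), k, by rw [val_mkFiber, act_toHom _ hh]⟩

end EZeroSemigroup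

namespace IsMinimalDilation

open ArvesonSystem EZeroSemigroup

section

variable {H₁ : Type u} {H₂ : Type v} {K : Type w} [NormedAddCommGroup H₁]
  [InnerProductSpace ℂ H₁] [NormedAddCommGroup H₂] [InnerProductSpace ℂ H₂]
  [NormedAddCommGroup K] [InnerProductSpace ℂ K] {J : WithLp 2 (H₁ × H₂) →ₗᵢ[ℂ] K} {h₁ : H₁}

theorem norm_inlᵢ (J : WithLp 2 (H₁ × H₂) →ₗᵢ[ℂ] K) (hh₁ : ‖h₁‖ = 1) : ‖inlᵢ J h₁‖ = 1 :=
  ((inlᵢ J).norm_map h₁).trans hh₁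

variable [CompleteSpace K] {θ : EZeroSemigroup K}

theorem toHom_rankOne_mem (hh₁ : ‖h₁‖ = 1) (t : ℝ≥0) (k x : K) :
    θ.toHom t (rankOne ℂ (inlᵢ J h₁) k) x ∈ θ.fiber (inlᵢ J h₁) t := by
  rw [mem_fiber, ← toHom_mul_apply, rankOne_mul_rankOne, inner_self_eq_norm_sq_to_K,
    norm_inlᵢ J hh₁]
  simp

/-- θ_t(|h₁⟩⟨k|) changes the reference vector from k to h₁ without changing the associated operator,
since |y⟩⟨h₁| |h₁⟩⟨k| = |y⟩⟨k|. -/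
theorem act_toHom_rankOne (hh₁ : ‖h₁‖ = 1) (t : ℝ≥0) (k x y : K) :
    θ.act (inlᵢ J h₁) t (θ.toHom t (rankOne ℂ (inlᵢ J h₁) k) x) y = θ.act k t x y := by
  rw [act_apply, ← toHom_mul_apply, rankOne_mul_rankOne, inner_self_eq_norm_sq_to_K,
    norm_inlᵢ J hh₁, act_apply]
  simp

end

variable {H₁ : Type u} {H₂ : Type v} {K : Type w}
  [NormedAddCommGroup H₁] [InnerProductSpace ℂ H₁] [CompleteSpace H₁]
  [NormedAddCommGroup H₂] [InnerProductSpace ℂ H₂] [CompleteSpace H₂]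
  [NormedAddCommGroup K] [InnerProductSpace ℂ K] [CompleteSpace K]
  {ϑ₁ : EZeroSemigroup H₁} {ϑ₂ : EZeroSemigroup H₂} {U₁ : IntertwiningSemigroup ϑ₁}
  {U₂ : IntertwiningSemigroup ϑ₂} {θ : EZeroSemigroup K} {J : WithLp 2 (H₁ × H₂) →ₗᵢ[ℂ] K}
  (hd : IsMinimalDilation (powersSum ϑ₁ ϑ₂ U₁ U₂) θ J)
  {h₁ : H₁} (hh₁ : ‖h₁‖ = 1) {h₂ : H₂} (hh₂ : ‖h₂‖ = 1)

theorem inl_mem (hd : IsMinimalDilation (powersSum ϑ₁ ϑ₂ U₁ U₂) θ J) {t : ℝ≥0} {x : H₁}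
    (hx : x ∈ ϑ₁.fiber h₁ t) : inlᵢ J x ∈ θ.fiber (inlᵢ J h₁) t := by
  rw [mem_fiber, hd.toHom_inl, ϑ₁.mem_fiber.1 hx]

theorem act_inl (hd : IsMinimalDilation (powersSum ϑ₁ ϑ₂ U₁ U₂) θ J) (t : ℝ≥0) (x y : H₁) :
    θ.act (inlᵢ J h₁) t (inlᵢ J x) (inlᵢ J y) = inlᵢ J (ϑ₁.act h₁ t x y) :=
  hd.toHom_inl y h₁ x

theorem act_inr (hd : IsMinimalDilation (powersSum ϑ₁ ϑ₂ U₁ U₂) θ J) (t : ℝ≥0) (x y : H₂) :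
    θ.act (inrᵢ J h₂) t (inrᵢ J x) (inrᵢ J y) = inrᵢ J (ϑ₂.act h₂ t x y) :=
  hd.toHom_inr y h₂ x

variable [TopologicalSpace.SeparableSpace H₁] [TopologicalSpace.SeparableSpace H₂]
  [TopologicalSpace.SeparableSpace K]

/-- The embeddings of the Arveson systems of the summands into the one of the dilation. -/
noncomputable def embedding :
    SpatialEmbedding (U₁.unit hh₁) (U₂.unit hh₂) (θ.arveson (norm_inlᵢ J hh₁)) where
  left t := ((inlᵢ J).toContinuousLinearMap.comp (ϑ₁.val hh₁ t)).codRestrict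
    (θ.fiber (inlᵢ J h₁) t) fun x => hd.inl_mem (ϑ₁.val_mem hh₁ x)
  -- The system of ϑ² naturally lives over the reference vector h₂; θ_t(|h₁⟩⟨h₂|) moves it to the
  -- fibre over h₁.
  right t := ((θ.toHom t (rankOne ℂ (inlᵢ J h₁) (inrᵢ J h₂))).comp
    ((inrᵢ J).toContinuousLinearMap.comp (ϑ₂.val hh₂ t))).codRestrict
    (θ.fiber (inlᵢ J h₁) t) fun x => toHom_rankOne_mem hh₁ t _ _
  mul_left {s t r} hr x y := θ.val_injective (norm_inlᵢ J hh₁) r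
    (hd.act_inl s (ϑ₁.val hh₁ s x) (ϑ₁.val hh₁ t y))
  mul_right {s t r} hr x y := by
    subst hr
    refine θ.val_injective (norm_inlᵢ J hh₁) _ ?_
    change θ.act (inlᵢ J h₁) s (θ.toHom s (rankOne ℂ (inlᵢ J h₁) (inrᵢ J h₂))
      (inrᵢ J (ϑ₂.val hh₂ s x))) (θ.toHom t (rankOne ℂ (inlᵢ J h₁) (inrᵢ J h₂))
      (inrᵢ J (ϑ₂.val hh₂ t y))) = θ.toHom (s + t) (rankOne ℂ (inlᵢ J h₁) (inrᵢ J h₂))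
      (inrᵢ J (ϑ₂.act h₂ s (ϑ₂.val hh₂ s x) (ϑ₂.val hh₂ t y)))
    rw [act_toHom_rankOne hh₁, θ.add, ← hd.act_inr, toHom_act]
  inner_left_left t x y := (inlᵢ J).inner_map_map _ _
  inner_right_right t x y := by
    change inner ℂ (θ.toHom t (rankOne ℂ (inlᵢ J h₁) (inrᵢ J h₂)) (inrᵢ J (ϑ₂.val hh₂ t x)))
      (θ.toHom t (rankOne ℂ (inlᵢ J h₁) (inrᵢ J h₂)) (inrᵢ J (ϑ₂.val hh₂ t y))) = _
    rw [inner_toHom_left, ← toHom_mul_apply, star_rankOne, rankOne_mul_rankOne,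
      inner_self_eq_norm_sq_to_K, norm_inlᵢ J hh₁, RCLike.ofReal_one, one_pow, one_smul,
      hd.toHom_inr, ϑ₂.mem_fiber.1 (ϑ₂.val_mem hh₂ y), (inrᵢ J).inner_map_map]
    rfl
  inner_left_right t x y := hd.inner_inl_toHom_inr (ϑ₁.val hh₁ t x) h₁ h₂ (ϑ₂.val hh₂ t y)

/-- The closed subspace that is reached from the initial space by words of length `r`. -/
noncomputable def reach (r : ℝ≥0) : Submodule ℂ K :=
  (Submodule.span ℂ {z | ∃ p, IsWord (hd.embedding hh₁ hh₂).gen r p ∧ ∃ x,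
    θ.act (inlᵢ J h₁) r (θ.val (norm_inlᵢ J hh₁) r p.1) (J x) = z}).topologicalClosure

theorem isClosed_reach (r : ℝ≥0) : IsClosed (hd.reach hh₁ hh₂ r : Set K) :=
  Submodule.isClosed_topologicalClosure _

theorem act_mem_reach {r : ℝ≥0} {p : (θ.arveson (norm_inlᵢ J hh₁)).space r ×
    ((ϑ₁.arveson hh₁).tensor (ϑ₂.arveson hh₂)).space r}
    (hp : IsWord (hd.embedding hh₁ hh₂).gen r p) (x : WithLp 2 (H₁ × H₂)) :
    θ.act (inlᵢ J h₁) r (θ.val (norm_inlᵢ J hh₁) r p.1) (J x) ∈ hd.reach hh₁ hh₂ r :=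
  Submodule.le_topologicalClosure _ (Submodule.subset_span ⟨p, hp, x, rfl⟩)

/-- Each H_i is itself fibre ⊗ H_i for ϑ^i, so its vectors are limits of combinations of one-letter
words of length s applied to H_i. -/
theorem apply_mem_reach (s : ℝ≥0) (x : WithLp 2 (H₁ × H₂)) : J x ∈ hd.reach hh₁ hh₂ s := by
  rw [apply_eq_add]
  refine Submodule.add_mem _ ?_ ?_
  · have : (⊤ : Submodule ℂ H₁) ≤ (hd.reach hh₁ hh₂ s).comap (inlᵢ J).toLinearMap := by
      rw [← ϑ₁.total_act_val hh₁ s]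
      refine Submodule.topologicalClosure_minimal _ ?_
        ((hd.isClosed_reach hh₁ hh₂ s).preimage (inlᵢ J).continuous)
      rw [Submodule.span_le]
      rintro _ ⟨x, k, rfl⟩
      change inlᵢ J _ ∈ hd.reach hh₁ hh₂ s
      rw [← hd.act_inl, inlᵢ_apply J k]
      exact hd.act_mem_reach hh₁ hh₂ (.of ((hd.embedding hh₁ hh₂).left_mem_gen x)) _
    exact this Submodule.mem_top
  · have : (⊤ : Submodule ℂ H₂) ≤ (hd.reach hh₁ hh₂ s).comap (inrᵢ J).toLinearMap := by
      rw [← ϑ₂.total_act_val hh₂ s]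
      refine Submodule.topologicalClosure_minimal _ ?_
        ((hd.isClosed_reach hh₁ hh₂ s).preimage (inrᵢ J).continuous)
      rw [Submodule.span_le]
      rintro _ ⟨x, k, rfl⟩
      change inrᵢ J _ ∈ hd.reach hh₁ hh₂ s
      rw [← hd.act_inr, ← act_toHom_rankOne (J := J) (θ := θ) hh₁,
        inrᵢ_apply J k]
      exact hd.act_mem_reach hh₁ hh₂ (.of ((hd.embedding hh₁ hh₂).right_mem_gen x)) _
    exact this Submodule.mem_top

/-- The initial vector behind a word of length r is itself reached by words of length r' - r;
concatenation gives length r'. -/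
theorem reach_mono {r r' : ℝ≥0} (hr : r ≤ r') : hd.reach hh₁ hh₂ r ≤ hd.reach hh₁ hh₂ r' := by
  refine Submodule.topologicalClosure_minimal _ ?_ (hd.isClosed_reach hh₁ hh₂ r')
  rw [Submodule.span_le]
  rintro _ ⟨p, hp, x, rfl⟩
  have e : r + (r' - r) = r' := add_tsub_cancel_of_le hr
  set L := θ.actL (inlᵢ J h₁) r (θ.val (norm_inlᵢ J hh₁) r p.1)
  have : hd.reach hh₁ hh₂ (r' - r) ≤ (hd.reach hh₁ hh₂ r').comap L.toLinearMap := by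
    refine Submodule.topologicalClosure_minimal _ ?_
      ((hd.isClosed_reach hh₁ hh₂ r').preimage L.continuous)
    rw [Submodule.span_le]
    rintro _ ⟨q, hq, y, rfl⟩
    have h1 := hd.act_mem_reach hh₁ hh₂ (hp.mul e hq) y
    rw [mulPair, val_mul] at h1
    have h2 := θ.act_act (h := inlᵢ J h₁) r (r' - r) (θ.val (norm_inlᵢ J hh₁) r p.1)
      (θ.val (norm_inlᵢ J hh₁) (r' - r) q.1) (J y)
    rw [e] at h2
    rwa [h2] at h1
  exact this (hd.apply_mem_reach hh₁ hh₂ (r' - r) x)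

/-- θ_r(a) passes through a word of length r and acts on the initial vector only. -/
theorem toHom_mem_reach {r : ℝ≥0} (a : WithLp 2 (H₁ × H₂) →L[ℂ] WithLp 2 (H₁ × H₂)) {x : K}
    (hx : x ∈ hd.reach hh₁ hh₂ r) : θ.toHom r (ampliate J a) x ∈ hd.reach hh₁ hh₂ r := by
  have : hd.reach hh₁ hh₂ r ≤
      (hd.reach hh₁ hh₂ r).comap (θ.toHom r (ampliate J a)).toLinearMap := by
    refine Submodule.topologicalClosure_minimal _ ?_
      ((hd.isClosed_reach hh₁ hh₂ r).preimage (ContinuousLinearMap.continuous _))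
    rw [Submodule.span_le]
    rintro _ ⟨p, hp, y, rfl⟩
    change θ.toHom r (ampliate J a) _ ∈ hd.reach hh₁ hh₂ r
    rw [toHom_act, ampliate_apply]
    exact hd.act_mem_reach hh₁ hh₂ hp _
  exact this hx

/-- The times decrease inwards, so when θ_{t_i} is applied the vector is already reached by words of
length t_i, and `toHom_mem_reach` applies. -/
theorem foldr_mem_reach (l : List (ℝ≥0 × (WithLp 2 (H₁ × H₂) →L[ℂ] WithLp 2 (H₁ × H₂))))
    (hl : l.Pairwise fun p q => q.1 ≤ p.1) (x : WithLp 2 (H₁ × H₂)) :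
    ∀ r, (∀ p ∈ l, p.1 ≤ r) →
    l.foldr (fun p y => θ.toHom p.1 (ampliate J p.2) y) (J x) ∈ hd.reach hh₁ hh₂ r := by
  induction l with
  | nil => exact fun r _ => hd.apply_mem_reach hh₁ hh₂ r x
  | cons p l ih =>
    intro r hr
    rw [List.pairwise_cons] at hl
    refine hd.reach_mono hh₁ hh₂ (hr p (by simp)) ?_
    exact hd.toHom_mem_reach hh₁ hh₂ _ (ih hl.2 p.1 hl.1)

/-- Project the total vectors supplied by minimality onto the fibre at t. A word of length r ≥ t
splits into words p and q of lengths t and r - t; the projection keeps p and turns q and the initial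
vector into a scalar. -/
theorem total_words (t : ℝ≥0) :
    (Submodule.span ℂ {x | ∃ p, IsWord (hd.embedding hh₁ hh₂).gen t p ∧
      p.1 = x}).topologicalClosure = ⊤ := by
  set M := (Submodule.span ℂ {x | ∃ p, IsWord (hd.embedding hh₁ hh₂).gen t p ∧
      p.1 = x}).topologicalClosure with hM
  have hMc : IsClosed (M : Set ((θ.arveson (norm_inlᵢ J hh₁)).space t)) :=
    Submodule.isClosed_topologicalClosure _
  let Q : K →L[ℂ] (θ.arveson (norm_inlᵢ J hh₁)).space t := θ.fiberProj (norm_inlᵢ J hh₁) t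
  have hQ : ∀ x, θ.val (norm_inlᵢ J hh₁) t (Q x) =
      θ.toHom t (rankOne ℂ (inlᵢ J h₁) (inlᵢ J h₁)) x := fun x => rfl
  have hreach : ∀ r, t ≤ r → hd.reach hh₁ hh₂ r ≤ M.comap Q.toLinearMap := by
    intro r hr
    refine Submodule.topologicalClosure_minimal _ ?_ (hMc.preimage Q.continuous)
    rw [Submodule.span_le]
    rintro _ ⟨p, hp, x, rfl⟩
    have e : t + (r - t) = r := add_tsub_cancel_of_le hr
    let V : K →L[ℂ] K := θ.toHom r (rankOne ℂ (J x) (inlᵢ J h₁))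
    let L := (Q.comp (V.comp (θ.val (norm_inlᵢ J hh₁) r))).comp (ContinuousLinearMap.fst ℂ _
      (((ϑ₁.arveson hh₁).tensor (ϑ₂.arveson hh₂)).space r))
    have : (Submodule.span ℂ {k | ∃ p, IsWord (hd.embedding hh₁ hh₂).gen t p ∧
        ∃ q, IsWord (hd.embedding hh₁ hh₂).gen (r - t) q ∧ mulPair e p q = k}).topologicalClosure ≤
        M.comap L.toLinearMap := by
      refine Submodule.topologicalClosure_minimal _ ?_ (hMc.preimage L.continuous)
      rw [Submodule.span_le]
      rintro _ ⟨p, hp, q, hq, rfl⟩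
      change Q (θ.act (inlᵢ J h₁) r (θ.val (norm_inlᵢ J hh₁) r
        ((θ.arveson (norm_inlᵢ J hh₁)).mul e p.1 q.1)) (J x)) ∈ M
      have h2 := θ.act_act (h := inlᵢ J h₁) t (r - t) (θ.val (norm_inlᵢ J hh₁) t p.1)
        (θ.val (norm_inlᵢ J hh₁) (r - t) q.1) (J x)
      rw [e] at h2
      rw [val_mul, h2]
      set z := θ.act (inlᵢ J h₁) (r - t) (θ.val (norm_inlᵢ J hh₁) (r - t) q.1) (J x)
      -- Q acts as |h₁⟩⟨h₁| on the second tensor factor of p ⊗ z, and p ⊗ h₁ is p as a vector of the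
      -- fibre.
      have h3 : Q (θ.act (inlᵢ J h₁) t (θ.val (norm_inlᵢ J hh₁) t p.1) z) =
          (inner ℂ (inlᵢ J h₁) z : ℂ) • p.1 := by
        refine θ.val_injective (norm_inlᵢ J hh₁) t ?_
        rw [hQ, toHom_act, InnerProductSpace.rankOne_apply, map_smul, map_smul,
          act_eq_self _ (θ.val_mem _ _)]
      rw [h3]
      exact M.smul_mem _ (Submodule.le_topologicalClosure _ (Submodule.subset_span ⟨p, hp, rfl⟩))
    exact this (hp.split (hd.embedding hh₁ hh₂).isSplit e)
  have htop : (⊤ : Submodule ℂ K) ≤ M.comap Q.toLinearMap := by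
    rw [← hd.minimal]
    refine Submodule.topologicalClosure_minimal _ ?_ (hMc.preimage Q.continuous)
    rw [Submodule.span_le]
    rintro _ ⟨l, x, hl, rfl⟩
    obtain ⟨r, hr⟩ : ∃ r, ∀ p ∈ l, p.1 ≤ r := by
      obtain ⟨r, hr⟩ := (l.map Prod.fst).toFinset.bddAbove
      exact ⟨r, fun p hp => hr (by simpa using ⟨p.2, hp⟩)⟩
    exact hreach _ (le_max_right r t) (hd.foldr_mem_reach hh₁ hh₂ l hl x _
      fun p hp => (hr p hp).trans (le_max_left r t))
  rw [eq_top_iff]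
  rintro x -
  have e : Q (θ.val (norm_inlᵢ J hh₁) t x) = x := θ.fiberProj_coe (norm_inlᵢ J hh₁) t x
  rw [← e]
  exact htop Submodule.mem_top

end IsMinimalDilation

end

/-! ### From isomorphic Arveson systems to cocycle conjugacy. -/

namespace EZeroSemigroup

open Filter Topology

section Continuity

variable {K : Type u} [NormedAddCommGroup K] [InnerProductSpace ℂ K] [CompleteSpace K]
  (θ : EZeroSemigroup K) {h : K}

theorem tendsto_act_zero (hh : ‖h‖ = 1) {x : ℝ≥0 → K} (hx : Tendsto x (𝓝 0) (𝓝 h)) (k : K) :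
    Tendsto (fun t => θ.act h t (x t) k) (𝓝 0) (𝓝 k) := by
  have h1 : Tendsto (fun t : ℝ≥0 => (t, x t, k)) (𝓝 0) (𝓝 (0, h, k)) :=
    tendsto_id.prodMk_nhds (hx.prodMk_nhds tendsto_const_nhds)
  have h2 := ((θ.continuous_act (h := h)).tendsto (0, h, k)).comp h1
  have e : θ.act h 0 h k = k := by
    rw [act_apply, θ.zero, InnerProductSpace.rankOne_apply, inner_self_eq_norm_sq_to_K, hh]
    simp
  rwa [e] at h2

/-- `E₀`-semigroups preserve the strong convergence of contractions to the identity. -/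
theorem tendsto_toHom_apply (hh : ‖h‖ = 1) {D : ℝ≥0 → K →L[ℂ] K} (hD : ∀ t, ‖D t‖ ≤ 1)
    (hD0 : ∀ k, Tendsto (fun t => D t k) (𝓝 0) (𝓝 k)) (s : ℝ≥0) (k : K) :
    Tendsto (fun t => θ.toHom s (D t) k) (𝓝 0) (𝓝 k) := by
  have hle : ∀ t k, ‖θ.toHom s (D t) k‖ ≤ ‖k‖ := fun t k =>
    (θ.norm_toHom_apply_le s _ k).trans (mul_le_of_le_one_left (norm_nonneg _) (hD t))
  -- Contractivity makes the vectors of convergence a closed subspace. It contains the total vectors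
  -- θ_s(|k⟩⟨h|) x, where `D t` acts on k alone.
  let M : Submodule ℂ K :=
    { carrier := {k | Tendsto (fun t => θ.toHom s (D t) k) (𝓝 0) (𝓝 k)}
      zero_mem' := by simp
      add_mem' := fun ha hb => by
        simp only [Set.mem_ofPred_eq, map_add] at *
        exact ha.add hb
      smul_mem' := fun c k hk => by
        simp only [Set.mem_ofPred_eq, map_smul] at *
        exact hk.const_smul c }
  have hM : IsClosed (M : Set K) := by
    refine isClosed_of_closure_subset fun k hk => ?_
    change Tendsto _ _ _
    rw [Metric.tendsto_nhds]
    intro ε hε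
    obtain ⟨k', hk', hd⟩ := Metric.mem_closure_iff.1 hk (ε / 3) (by positivity)
    filter_upwards [Metric.tendsto_nhds.1 (show Tendsto _ _ _ from hk') (ε / 3) (by positivity)]
      with t ht
    have h1 : dist (θ.toHom s (D t) k) (θ.toHom s (D t) k') < ε / 3 := by
      rw [dist_eq_norm, ← map_sub]
      exact (hle t _).trans_lt (by rwa [← dist_eq_norm])
    rw [dist_comm] at hd
    linarith [dist_triangle4 (θ.toHom s (D t) k) (θ.toHom s (D t) k') k' k]
  have htop : (⊤ : Submodule ℂ K) ≤ M := by
    rw [← θ.total_act hh s]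
    refine Submodule.topologicalClosure_minimal _ ?_ hM
    rw [Submodule.span_le]
    rintro _ ⟨x, k, rfl⟩
    change Tendsto _ _ _
    simp only [toHom_act]
    exact ((θ.actL h s x).continuous.tendsto k).comp (hD0 k)
  exact htop Submodule.mem_top

/-- A unitary cocycle that is strongly continuous at `0` is strongly continuous, if there are
intertwining isometries that converge to the identity at `0`. -/
theorem continuous_cocycle (hh : ‖h‖ = 1) {D : ℝ≥0 → K ≃ₗᵢ[ℂ] K}
    (hmul : ∀ s t k, D (s + t) k =
      D s (θ.toHom s ((D t : K ≃L[ℂ] K) : K →L[ℂ] K) k))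
    (hD0 : ∀ k, Tendsto (fun t => D t k) (𝓝 0) (𝓝 k)) {V : ℝ≥0 → K →L[ℂ] K}
    (hV : ∀ t k, ‖V t k‖ = ‖k‖) (hVa : ∀ t a k, θ.toHom t a (V t k) = V t (a k))
    (hV0 : ∀ k, Tendsto (fun t => V t k) (𝓝 0) (𝓝 k)) (k : K) :
    Continuous fun t => D t k := by
  have hD1 : ∀ t, ‖((D t : K ≃L[ℂ] K) : K →L[ℂ] K)‖ ≤ 1 := fun t =>
    ContinuousLinearMap.opNorm_le_bound _ zero_le_one fun k => by
      rw [one_mul]; exact ((D t).norm_map k).le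
  -- The cocycle identity and unitarity of D a reduce this to the distance of θ_a(C) k from k.
  -- Applying V (N - a) replaces θ_a(C) by θ_N(C), at a time independent of a, and costs at most
  -- twice the displacement of k by V (N - a).
  have hdist : ∀ a b N : ℝ≥0, a ≤ b → a ≤ N → dist (D a k) (D b k) ≤
      dist (θ.toHom N ((D (b - a) : K ≃L[ℂ] K) : K →L[ℂ] K) k) k +
      2 * dist (V (N - a) k) k := by
    intro a b N hab haN
    set C := ((D (b - a) : K ≃L[ℂ] K) : K →L[ℂ] K) with hC
    have h1 : D b k = D a (θ.toHom a C k) := by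
      rw [hC, ← hmul, add_tsub_cancel_of_le hab]
    have h2 : V (N - a) (θ.toHom a C k) = θ.toHom N C (V (N - a) k) := by
      rw [← hVa, ← θ.add, tsub_add_cancel_of_le haN]
    have hle : ‖θ.toHom N C (V (N - a) k - k)‖ ≤ ‖V (N - a) k - k‖ :=
      (θ.norm_toHom_apply_le N _ _).trans (mul_le_of_le_one_left (norm_nonneg _) (hD1 _))
    have e : θ.toHom N C (V (N - a) k) - V (N - a) k =
        θ.toHom N C (V (N - a) k - k) + (θ.toHom N C k - k) - (V (N - a) k - k) := by
      rw [map_sub]; abel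
    rw [h1, (D a).dist_map, dist_comm, dist_eq_norm, ← hV (N - a), map_sub, h2, e,
      dist_eq_norm, dist_eq_norm]
    refine (norm_sub_le _ _).trans ?_
    linarith [norm_add_le (θ.toHom N C (V (N - a) k - k)) (θ.toHom N C k - k)]
  rw [continuous_iff_continuousAt]
  intro N
  -- Taking a = min s N and b = max s N treats both sides of N at once.
  have hr : Tendsto (fun s => max s N - min s N) (𝓝 N) (𝓝 0) := by
    have : Continuous fun s : ℝ≥0 => max s N - min s N := by fun_prop
    simpa using this.tendsto N
  have ha : Tendsto (fun s => N - min s N) (𝓝 N) (𝓝 0) := by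
    have : Continuous fun s : ℝ≥0 => N - min s N := by fun_prop
    simpa using this.tendsto N
  have h1 := tendsto_iff_dist_tendsto_zero.1
    ((θ.tendsto_toHom_apply hh hD1 hD0 N k).comp hr)
  have h2 := tendsto_iff_dist_tendsto_zero.1 ((hV0 k).comp ha)
  have h3 := h1.add (h2.const_mul 2)
  rw [mul_zero, add_zero] at h3
  refine tendsto_iff_dist_tendsto_zero.2 (squeeze_zero (fun _ => dist_nonneg) (fun s => ?_) h3)
  have := hdist (min s N) (max s N) N min_le_max (min_le_right s N)
  rcases le_total s N with hs | hs
  · rw [min_eq_left hs, max_eq_right hs] at this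
    simpa [hs] using this
  · rw [min_eq_right hs, max_eq_left hs, dist_comm] at this
    simpa [hs] using this

theorem ext_act [TopologicalSpace.SeparableSpace K] {Y : Type*} [NormedAddCommGroup Y]
    [NormedSpace ℂ Y] (hh : ‖h‖ = 1) (t : ℝ≥0) {A B : K →L[ℂ] Y}
    (hAB : ∀ x k, A (θ.act h t (θ.val hh t x) k) = B (θ.act h t (θ.val hh t x) k)) : A = B := by
  refine ContinuousLinearMap.ext_on
    (Submodule.dense_iff_topologicalClosure_eq_top.2 (θ.total_act_val hh t)) ?_
  rintro _ ⟨x, k, rfl⟩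
  exact hAB x k

end Continuity

variable {K : Type u} {K' : Type v} [NormedAddCommGroup K] [InnerProductSpace ℂ K]
  [CompleteSpace K] [TopologicalSpace.SeparableSpace K] [NormedAddCommGroup K']
  [InnerProductSpace ℂ K'] [CompleteSpace K'] [TopologicalSpace.SeparableSpace K']
  {θ : EZeroSemigroup K} {θ' : EZeroSemigroup K'} {h : K} {h' : K'} (hh : ‖h‖ = 1)
  (hh' : ‖h'‖ = 1)

/-- The unitary that implements a unitary of the fibres of the Arveson systems. -/
theorem exists_equiv_act (W : K ≃ₗᵢ[ℂ] K') {t : ℝ≥0} (Φ : (θ.arveson hh).space t ≃ₗᵢ[ℂ] (θ'.arveson hh').space t) :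
    ∃ D : K' ≃ₗᵢ[ℂ] K', ∀ x k, D (θ'.act h' t (θ'.val hh' t (Φ x)) k) =
      W (θ.act h t (θ.val hh t x) (W.symm k)) := by
  suffices h : ∃ D : K' ≃ₗᵢ[ℂ] K', ∀ p : (θ.arveson hh).space t × K',
      D (θ'.act h' t (θ'.val hh' t (Φ p.1)) p.2) = W (θ.act h t (θ.val hh t p.1) (W.symm p.2)) by
    obtain ⟨D, hD⟩ := h
    exact ⟨D, fun x k => hD (x, k)⟩
  -- Both families realise the elementary tensors of fibre ⊗ K', with Gram matrix ⟨x, x'⟩⟨k, k'⟩.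
  refine exists_linearIsometryEquiv_of_gram _ _ ?_ ?_ ?_
  · intro p q
    rw [W.inner_map_map, inner_act_of_mem _ _ _ _ (θ'.val_mem hh' _),
      inner_act_of_mem _ _ _ _ (θ.val_mem hh _), inner_val, inner_val, Φ.inner_map_map,
      W.symm.inner_map_map]
  · rw [← θ'.total_act_val hh' t]
    congr 2
    ext z
    constructor
    · rintro ⟨p, rfl⟩
      exact ⟨_, _, rfl⟩
    · rintro ⟨x, k, rfl⟩
      exact ⟨(Φ.symm x, k), by simp⟩
  · rw [← Submodule.dense_iff_topologicalClosure_eq_top]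
    have h1 := Submodule.dense_iff_topologicalClosure_eq_top.2 (θ.total_act_val hh t)
    have h2 := W.surjective.denseRange.dense_image W.continuous h1
    refine h2.mono ?_
    rintro _ ⟨z, hz, rfl⟩
    have : (Submodule.span ℂ {z | ∃ (x : (θ.arveson hh).space t) (k : K),
        θ.act h t (θ.val hh t x) k = z}) ≤ (Submodule.span ℂ (Set.range
        fun p : (θ.arveson hh).space t × K' =>
          W (θ.act h t (θ.val hh t p.1) (W.symm p.2)))).comap W.toLinearEquiv.toLinearMap := by
      rw [Submodule.span_le]
      rintro _ ⟨x, k, rfl⟩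
      exact Submodule.subset_span ⟨(x, W k), by simp⟩
    exact this hz

/-- `E₀`-semigroups with isomorphic Arveson systems are cocycle conjugate. -/
theorem cocycleConjugate_of_equiv (W : K ≃ₗᵢ[ℂ] K')
    (Φ : ∀ t, (θ.arveson hh).space t ≃ₗᵢ[ℂ] (θ'.arveson hh').space t)
    (hΦ : ∀ {s t r : ℝ≥0} (hr : s + t = r) (x : (θ.arveson hh).space s)
      (y : (θ.arveson hh).space t), Φ r ((θ.arveson hh).mul hr x y) =
        (θ'.arveson hh').mul hr (Φ s x) (Φ t y))
    {x : ∀ t, (θ.arveson hh).space t} (hx1 : ∀ t, ‖x t‖ = 1)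
    (hx : Tendsto (fun t => θ.val hh t (x t)) (𝓝 0) (𝓝 h))
    (hx' : Tendsto (fun t => θ'.val hh' t (Φ t (x t))) (𝓝 0) (𝓝 h')) :
    CocycleConjugate θ θ' := by
  choose D hD using fun t => exists_equiv_act hh hh' W (Φ t)
  have hext : ∀ (t : ℝ≥0) {A B : K' →L[ℂ] K'},
      (∀ x k, A (θ'.act h' t (θ'.val hh' t (Φ t x)) k) =
        B (θ'.act h' t (θ'.val hh' t (Φ t x)) k)) → A = B := fun t A B hAB =>
    θ'.ext_act hh' t fun y k => by simpa using hAB ((Φ t).symm y) k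
  -- Tested on the total vectors Φ x ⊗ k, and then with k itself of the form Φ y ⊗ k'.
  -- Multiplicativity of Φ makes both sides the image under W of x ⊗ y ⊗ W⁻¹ k'.
  have hmul : ∀ s t, ((D (s + t) : K' ≃L[ℂ] K') : K' →L[ℂ] K') =
      ((D s : K' ≃L[ℂ] K') : K' →L[ℂ] K') *
        θ'.toHom s ((D t : K' ≃L[ℂ] K') : K' →L[ℂ] K') := by
    intro s t
    refine hext s fun x k => ?_
    change D (s + t) _ = D s (θ'.toHom s ((D t : K' ≃L[ℂ] K') : K' →L[ℂ] K') _)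
    rw [toHom_act]
    change _ = D s (θ'.act h' s _ (D t k))
    rw [hD]
    have := hext t (A := ((D (s + t) : K' ≃L[ℂ] K') : K' →L[ℂ] K').comp
        (θ'.actL h' s (θ'.val hh' s (Φ s x))))
      (B := ((W : K ≃L[ℂ] K') : K →L[ℂ] K').comp ((θ.actL h s (θ.val hh s x)).comp
        (((W.symm : K' ≃L[ℂ] K) : K' →L[ℂ] K).comp ((D t : K' ≃L[ℂ] K') : K' →L[ℂ] K'))))
      fun y k => ?_
    · exact DFunLike.congr_fun this k
    · change D (s + t) (θ'.act h' s _ (θ'.act h' t _ k)) =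
        W (θ.act h s _ (W.symm (D t (θ'.act h' t _ k))))
      rw [hD, W.symm_apply_apply, ← act_act, ← act_act, ← val_mul θ' hh' rfl, ← hΦ, hD, val_mul]
  -- For small t, k is close to Φ(x_t) ⊗ k, which D t sends to the image under W of x_t ⊗ W⁻¹ k,
  -- again close to k.
  have hD0 : ∀ k, Tendsto (fun t => D t k) (𝓝 0) (𝓝 k) := by
    intro k
    have h1 := tendsto_iff_dist_tendsto_zero.1 (θ'.tendsto_act_zero hh' hx' k)
    have h2 := tendsto_iff_dist_tendsto_zero.1
      ((W.continuous.tendsto _).comp (θ.tendsto_act_zero hh hx (W.symm k)))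
    have h3 := h1.add h2
    rw [add_zero] at h3
    refine tendsto_iff_dist_tendsto_zero.2 (squeeze_zero (fun _ => dist_nonneg) (fun t => ?_) h3)
    refine (dist_triangle _ (D t (θ'.act h' t (θ'.val hh' t (Φ t (x t))) k)) _).trans ?_
    rw [(D t).dist_map, dist_comm k, hD]
    simp
  have hcont := θ'.continuous_cocycle hh' (fun s t k => DFunLike.congr_fun (hmul s t) k) hD0
    (V := fun t => θ'.actL h' t (θ'.val hh' t (Φ t (x t))))
    (fun t k => by
      have h1 := θ'.inner_act_of_mem (θ'.val hh' t (Φ t (x t))) k k (θ'.val_mem hh' (Φ t (x t)))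
      rw [inner_self_eq_norm_sq_to_K, inner_self_eq_norm_sq_to_K, inner_self_eq_norm_sq_to_K,
        norm_val, (Φ t).norm_map, hx1, RCLike.ofReal_one, one_pow, one_mul] at h1
      exact (pow_left_inj₀ (norm_nonneg _) (norm_nonneg _) two_ne_zero).1 (by exact_mod_cast h1))
    (fun t a k => θ'.toHom_act t a _ k) (θ'.tendsto_act_zero hh' hx')
  refine ⟨W, fun t => Unitary.linearIsometryEquiv.symm (D t), hmul, hcont, fun t a => ?_⟩
  set C := Unitary.linearIsometryEquiv.symm (D t)
  -- Both semigroups act on the second tensor factor only, which D t transports by W.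
  have key : ampliate W.toLinearIsometry (θ.toHom t a) * (C : K' →L[ℂ] K') =
      C * θ'.toHom t (ampliate W.toLinearIsometry a) := by
    refine hext t fun x k => ?_
    obtain ⟨k, rfl⟩ := W.surjective k
    have e : ∀ b, ampliate W.toLinearIsometry b (W k) = W (b k) := fun b =>
      ampliate_apply W.toLinearIsometry b k
    change ampliate W.toLinearIsometry (θ.toHom t a) (D t _) = D t (θ'.toHom t _ _)
    rw [toHom_act, e, hD, hD, W.symm_apply_apply, W.symm_apply_apply, ← toHom_act]
    exact ampliate_apply W.toLinearIsometry _ _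
  rw [← key, mul_assoc, ← Unitary.coe_star, ← Submonoid.coe_mul, Unitary.mul_star_self]
  simp

end EZeroSemigroup

/-! ### Identifying the Hilbert spaces, and the conclusion. -/

section

open ContinuousLinearMap (adjoint)
open Filter Topology

section Separable

/-- Orthonormal vectors are at least 1 apart, so balls of radius 1/2 around them are disjoint; a
separable space has room for only countably many. -/
theorem Orthonormal.countable {𝕜 E ι : Type*} [RCLike 𝕜] [NormedAddCommGroup E]
    [InnerProductSpace 𝕜 E] [TopologicalSpace.SeparableSpace E] {e : ι → E}
    (he : Orthonormal 𝕜 e) : Countable ι := by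
  have hd : ∀ i j, i ≠ j → 1 ≤ dist (e i) (e j) := by
    intro i j hij
    have h1 := norm_sub_sq (𝕜 := 𝕜) (e i) (e j)
    rw [he.2 hij, he.1, he.1, map_zero] at h1
    rw [dist_eq_norm]
    nlinarith [norm_nonneg (e i - e j)]
  have h : (Set.univ : Set ι).PairwiseDisjoint fun i => Metric.ball (e i) (1 / 2) :=
    fun i _ j _ hij => Metric.ball_disjoint_ball (by norm_num; exact hd i j hij)
  exact Set.countable_univ_iff.1 (h.countable_of_isOpen (fun _ _ => Metric.isOpen_ball)
    fun i _ => ⟨e i, Metric.mem_ball_self (by norm_num)⟩)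

/-- An infinite dimensional separable Hilbert space has an orthonormal basis indexed by `ℕ`. -/
theorem exists_orthonormal_nat (𝕜 K : Type*) [RCLike 𝕜] [NormedAddCommGroup K]
    [InnerProductSpace 𝕜 K] [CompleteSpace K] [TopologicalSpace.SeparableSpace K]
    (hK : ¬ FiniteDimensional 𝕜 K) : ∃ e : ℕ → K, Orthonormal 𝕜 e ∧
      (Submodule.span 𝕜 (Set.range e)).topologicalClosure = ⊤ := by
  obtain ⟨w, b, -⟩ := exists_hilbertBasis 𝕜 K
  have := b.orthonormal.countable
  have : Infinite w := by
    by_contra h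
    rw [not_infinite_iff_finite] at h
    have := Fintype.ofFinite w
    exact hK b.toOrthonormalBasis.toBasis.finiteDimensional_of_finite
  obtain ⟨σ⟩ := nonempty_equiv_of_countable (α := ℕ) (β := w)
  refine ⟨b ∘ σ, b.orthonormal.comp σ σ.injective, ?_⟩
  rw [σ.surjective.range_comp]
  exact b.dense_span

theorem nonempty_linearIsometryEquiv_of_infinite {K : Type u} {K' : Type v}
    [NormedAddCommGroup K] [InnerProductSpace ℂ K] [CompleteSpace K]
    [TopologicalSpace.SeparableSpace K] [NormedAddCommGroup K'] [InnerProductSpace ℂ K']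
    [CompleteSpace K'] [TopologicalSpace.SeparableSpace K'] (hK : ¬ FiniteDimensional ℂ K)
    (hK' : ¬ FiniteDimensional ℂ K') : Nonempty (K ≃ₗᵢ[ℂ] K') := by
  obtain ⟨e, he, hd⟩ := exists_orthonormal_nat ℂ K hK
  obtain ⟨e', he', hd'⟩ := exists_orthonormal_nat ℂ K' hK'
  obtain ⟨W, -⟩ := exists_linearIsometryEquiv_of_gram e e' (fun i j => by
    rw [orthonormal_iff_ite.1 he, orthonormal_iff_ite.1 he']) hd hd'
  exact ⟨W⟩

end Separable

theorem IntertwiningSemigroup.adjoint_op_apply {H : Type u} [NormedAddCommGroup H]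
    [InnerProductSpace ℂ H] [CompleteSpace H] {ϑ : EZeroSemigroup H}
    (U : IntertwiningSemigroup ϑ) (t : ℝ≥0) (y : H) : adjoint (U.op t) (U.op t y) = y :=
  DFunLike.congr_fun ((ContinuousLinearMap.norm_map_iff_adjoint_comp_self _).1 (U.isometry t)) y

theorem IntertwiningSemigroup.tendsto_op {H : Type u} [NormedAddCommGroup H]
    [InnerProductSpace ℂ H] [CompleteSpace H] {ϑ : EZeroSemigroup H}
    (U : IntertwiningSemigroup ϑ) (y : H) : Tendsto (fun t => U.op t y) (𝓝 0) (𝓝 y) := by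
  simpa [U.zero] using (U.continuous y).tendsto 0

theorem ArvesonSystem.dist_tmul {E : ArvesonSystem.{u}} {F : ArvesonSystem.{v}} {t : ℝ≥0}
    (x : E.space t) (y y' : F.space t) :
    dist (tmul E F x y) (tmul E F x y') = ‖x‖ * dist y y' := by
  rw [dist_eq_norm, dist_eq_norm, ← (tensorEmbedding E F).norm_map, map_sub]
  rfl

namespace IsMinimalDilation

section

variable {H₁ : Type u} {H₂ : Type v} {K : Type w}
  [NormedAddCommGroup H₁] [InnerProductSpace ℂ H₁] [CompleteSpace H₁]
  [NormedAddCommGroup H₂] [InnerProductSpace ℂ H₂] [CompleteSpace H₂]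
  [NormedAddCommGroup K] [InnerProductSpace ℂ K] [CompleteSpace K]
  {ϑ₁ : EZeroSemigroup H₁} {ϑ₂ : EZeroSemigroup H₂} (U₁ : IntertwiningSemigroup ϑ₁)
  (U₂ : IntertwiningSemigroup ϑ₂) {θ : EZeroSemigroup K} {J : WithLp 2 (H₁ × H₂) →ₗᵢ[ℂ] K}

/-- The direct sum of two intertwining semigroups. -/
noncomputable def directSum (t : ℝ≥0) : WithLp 2 (H₁ × H₂) →ₗᵢ[ℂ] WithLp 2 (H₁ × H₂) where
  toLinearMap := (blockOperator (U₁.op t) 0 0 (U₂.op t)).toLinearMap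
  norm_map' x := by
    have e : blockOperator (U₁.op t) 0 0 (U₂.op t) x =
        WithLp.toLp 2 (U₁.op t x.fst, U₂.op t x.snd) := by
      simp [blockOperator]
    change ‖blockOperator (U₁.op t) 0 0 (U₂.op t) x‖ = ‖x‖
    rw [e, WithLp.prod_norm_eq_of_L2, WithLp.prod_norm_eq_of_L2]
    simp [U₁.isometry, U₂.isometry]

theorem directSum_apply (t : ℝ≥0) (x : WithLp 2 (H₁ × H₂)) :
    directSum U₁ U₂ t x = WithLp.toLp 2 (U₁.op t x.fst, U₂.op t x.snd) := by
  change blockOperator (U₁.op t) 0 0 (U₂.op t) x = _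
  simp [blockOperator]

/-- On the diagonal this is the intertwining relation, off the diagonal U*U = 1. -/
theorem powersSum_directSum (t : ℝ≥0) (a : WithLp 2 (H₁ × H₂) →L[ℂ] WithLp 2 (H₁ × H₂))
    (x : WithLp 2 (H₁ × H₂)) : powersSum ϑ₁ ϑ₂ U₁ U₂ t a (directSum U₁ U₂ t x) =
      directSum U₁ U₂ t (a x) := by
  have hx : a x = a (inlL H₁ H₂ x.fst) + a (inrL H₁ H₂ x.snd) := by
    rw [← map_add, inlL_apply, inrL_apply, ← WithLp.toLp_add]
    simp
    rfl
  rw [directSum_apply, directSum_apply, hx]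
  simp [powersSum, blockOperator, IntertwiningSemigroup.toHom_op,
    IntertwiningSemigroup.adjoint_op_apply, adjoint_inlL_apply,
    adjoint_inrL_apply]

variable {U₁ U₂}

/-- In finite dimension the isometry U₁ ⊕ U₂ is surjective and intertwines the Powers sum, so the
norm condition of `toHom_ampliate_apply` holds at every vector. The dilation then never leaves the
initial space, and minimality makes that space everything. -/
theorem surjective_of_finiteDimensional [FiniteDimensional ℂ (WithLp 2 (H₁ × H₂))]
    (hd : IsMinimalDilation (powersSum ϑ₁ ϑ₂ U₁ U₂) θ J) : Function.Surjective J := by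
  have hT : ∀ t a x, θ.toHom t (ampliate J a) (J x) = J (powersSum ϑ₁ ϑ₂ U₁ U₂ t a x) := by
    intro t a x
    refine toHom_ampliate_apply (hd.dilation t) a x ?_
    obtain ⟨y, rfl⟩ := LinearMap.injective_iff_surjective.1 (directSum U₁ U₂ t).injective x
    change inner ℂ (directSum U₁ U₂ t y) (powersSum ϑ₁ ϑ₂ U₁ U₂ t _ (directSum U₁ U₂ t y)) =
      inner ℂ (powersSum ϑ₁ ϑ₂ U₁ U₂ t _ (directSum U₁ U₂ t y)) _
    change _ = inner ℂ _ (powersSum ϑ₁ ϑ₂ U₁ U₂ t _ (directSum U₁ U₂ t y))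
    rw [powersSum_directSum, powersSum_directSum, LinearIsometry.inner_map_map,
      LinearIsometry.inner_map_map, mul_apply_eq_comp,
      ContinuousLinearMap.star_eq_adjoint, ContinuousLinearMap.adjoint_inner_right]
  have htop : (⊤ : Submodule ℂ K) ≤ J.toLinearMap.range := by
    rw [← hd.minimal]
    refine Submodule.topologicalClosure_minimal _ ?_ (Submodule.closed_of_finiteDimensional _)
    rw [Submodule.span_le]
    rintro _ ⟨l, x, -, rfl⟩
    induction l with
    | nil => exact ⟨x, rfl⟩
    | cons p l ih =>
      obtain ⟨y, hy⟩ := ih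
      exact ⟨_, by
        rw [List.foldr_cons, ← hy]
        exact (hT p.1 p.2 y).symm⟩
  exact fun x => htop (Submodule.mem_top (x := x))

end

/-- The Hilbert spaces of minimal dilations of Powers sums of the same `E₀`-semigroups are
isometric. -/
theorem nonempty_linearIsometryEquiv {H₁ : Type u} {H₂ : Type v} {K : Type w} {K' : Type w'}
    [NormedAddCommGroup H₁] [InnerProductSpace ℂ H₁] [CompleteSpace H₁]
    [NormedAddCommGroup H₂] [InnerProductSpace ℂ H₂] [CompleteSpace H₂]
    [NormedAddCommGroup K] [InnerProductSpace ℂ K] [CompleteSpace K]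
    [TopologicalSpace.SeparableSpace K]
    [NormedAddCommGroup K'] [InnerProductSpace ℂ K'] [CompleteSpace K']
    [TopologicalSpace.SeparableSpace K']
    {ϑ₁ : EZeroSemigroup H₁} {ϑ₂ : EZeroSemigroup H₂} {U₁ U₁' : IntertwiningSemigroup ϑ₁}
    {U₂ U₂' : IntertwiningSemigroup ϑ₂} {θ : EZeroSemigroup K} {θ' : EZeroSemigroup K'}
    {J : WithLp 2 (H₁ × H₂) →ₗᵢ[ℂ] K} {J' : WithLp 2 (H₁ × H₂) →ₗᵢ[ℂ] K'}
    (hd : IsMinimalDilation (powersSum ϑ₁ ϑ₂ U₁ U₂) θ J)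
    (hd' : IsMinimalDilation (powersSum ϑ₁ ϑ₂ U₁' U₂') θ' J') : Nonempty (K ≃ₗᵢ[ℂ] K') := by
  by_cases hH : FiniteDimensional ℂ (WithLp 2 (H₁ × H₂))
  · exact ⟨(LinearIsometryEquiv.ofSurjective J hd.surjective_of_finiteDimensional).symm.trans
      (LinearIsometryEquiv.ofSurjective J' hd'.surjective_of_finiteDimensional)⟩
  · exact nonempty_linearIsometryEquiv_of_infinite
      (fun _ => hH (FiniteDimensional.of_injective J.toLinearMap J.injective))
      (fun _ => hH (FiniteDimensional.of_injective J'.toLinearMap J'.injective))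

/-- Minimal dilations of Powers sums of the same `E₀`-semigroups are cocycle conjugate. -/
theorem cocycleConjugate {H₁ : Type u} {H₂ : Type v} {K : Type w} {K' : Type w'}
    [NormedAddCommGroup H₁] [InnerProductSpace ℂ H₁] [CompleteSpace H₁]
    [TopologicalSpace.SeparableSpace H₁] [Nontrivial H₁]
    [NormedAddCommGroup H₂] [InnerProductSpace ℂ H₂] [CompleteSpace H₂]
    [TopologicalSpace.SeparableSpace H₂] [Nontrivial H₂]
    [NormedAddCommGroup K] [InnerProductSpace ℂ K] [CompleteSpace K]
    [TopologicalSpace.SeparableSpace K]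
    [NormedAddCommGroup K'] [InnerProductSpace ℂ K'] [CompleteSpace K']
    [TopologicalSpace.SeparableSpace K']
    {ϑ₁ : EZeroSemigroup H₁} {ϑ₂ : EZeroSemigroup H₂} {U₁ U₁' : IntertwiningSemigroup ϑ₁}
    {U₂ U₂' : IntertwiningSemigroup ϑ₂} {θ : EZeroSemigroup K} {θ' : EZeroSemigroup K'}
    {J : WithLp 2 (H₁ × H₂) →ₗᵢ[ℂ] K} {J' : WithLp 2 (H₁ × H₂) →ₗᵢ[ℂ] K'}
    (hd : IsMinimalDilation (powersSum ϑ₁ ϑ₂ U₁ U₂) θ J)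
    (hd' : IsMinimalDilation (powersSum ϑ₁ ϑ₂ U₁' U₂') θ' J') : CocycleConjugate θ θ' := by
  obtain ⟨W⟩ := hd.nonempty_linearIsometryEquiv hd'
  obtain ⟨h₁, hh₁⟩ := exists_norm_eq H₁ zero_le_one
  obtain ⟨h₂, hh₂⟩ := exists_norm_eq H₂ zero_le_one
  obtain ⟨Ψ, hΨ, hΨm⟩ := (hd.embedding hh₁ hh₂).exists_equiv (hd.total_words hh₁ hh₂)
  have hex := (hd'.embedding hh₁ hh₂).exists_equiv (hd'.total_words hh₁ hh₂)
  -- Here part (1) enters: both dilations are compared with one and the same subsystem.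
  rw [ArvesonSystem.spatialProduct_eq (U₁'.unit hh₁) (U₁.unit hh₁) (U₂'.unit hh₂)
    (U₂.unit hh₂)] at hex
  obtain ⟨Ψ', hΨ', hΨm'⟩ := hex
  refine EZeroSemigroup.cocycleConjugate_of_equiv (norm_inlᵢ J hh₁) (norm_inlᵢ J' hh₁) W
    (fun t => (Ψ t).trans (Ψ' t).symm) (fun {s t r} hr x y => ?_)
    (x := fun t => (hd.embedding hh₁ hh₂).left t ((U₁.unit hh₁).sec t)) (fun t => ?_) ?_ ?_
  · refine (Ψ' r).injective (Subtype.ext ?_)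
    rw [hΨm']
    simp [hΨm]
  · change ‖inlᵢ J (U₁.op t h₁)‖ = 1
    rw [LinearIsometry.norm_map, U₁.isometry, hh₁]
  · exact ((inlᵢ J).continuous.tendsto _).comp (U₁.tendsto_op h₁)
  -- The isomorphism need not match the two left embeddings: in the spatial product the images of
  -- the unit are U₁h₁ ⊗ U₂h₂ and U₁h₁ ⊗ U₂'h₂. Their distance is that of U₂h₂ and U₂'h₂, which
  -- vanishes as t → 0.
  · have hy : Tendsto (fun t => θ'.val (norm_inlᵢ J' hh₁) t
        ((hd'.embedding hh₁ hh₂).left t ((U₁.unit hh₁).sec t))) (𝓝 0) (𝓝 (inlᵢ J' h₁)) :=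
      ((inlᵢ J').continuous.tendsto _).comp (U₁.tendsto_op h₁)
    refine hy.congr_dist ?_
    have h2 : Tendsto (fun t => dist (U₂'.op t h₂) (U₂.op t h₂)) (𝓝 0) (𝓝 0) := by
      simpa using (U₂'.tendsto_op h₂).dist (U₂.tendsto_op h₂)
    refine h2.congr fun t => ?_
    set y := (hd'.embedding hh₁ hh₂).left t ((U₁.unit hh₁).sec t) with hy
    set z := (hd.embedding hh₁ hh₂).left t ((U₁.unit hh₁).sec t) with hz
    change _ = dist y ((Ψ' t).symm (Ψ t z))
    rw [← (Ψ' t).dist_map, (Ψ' t).apply_symm_apply, Subtype.dist_eq, hΨ, hΨ',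
      ArvesonSystem.dist_tmul, (U₁.unit hh₁).norm_sec, one_mul]
    rfl

end IsMinimalDilation

end

theorem theorem1 :
    (∀ (E : ArvesonSystem.{u}) (F : ArvesonSystem.{v}) (u u' : E.UnitalUnit) (v v' : F.UnitalUnit),
      ArvesonSystem.spatialProduct u v = ArvesonSystem.spatialProduct u' v' ∧
      Nonempty ((ArvesonSystem.spatialProduct u v).toArvesonSystem.Iso
        (ArvesonSystem.spatialProduct u' v').toArvesonSystem)) ∧
    (∀ (H₁ : Type u) (H₂ : Type v)
      [NormedAddCommGroup H₁] [InnerProductSpace ℂ H₁] [CompleteSpace H₁]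
      [TopologicalSpace.SeparableSpace H₁] [Nontrivial H₁]
      [NormedAddCommGroup H₂] [InnerProductSpace ℂ H₂] [CompleteSpace H₂]
      [TopologicalSpace.SeparableSpace H₂] [Nontrivial H₂]
      (ϑ₁ : EZeroSemigroup H₁) (ϑ₂ : EZeroSemigroup H₂)
      (U₁ U₁' : IntertwiningSemigroup ϑ₁) (U₂ U₂' : IntertwiningSemigroup ϑ₂)
      (K : Type w) (K' : Type w')
      [NormedAddCommGroup K] [InnerProductSpace ℂ K] [CompleteSpace K]
      [TopologicalSpace.SeparableSpace K]
      [NormedAddCommGroup K'] [InnerProductSpace ℂ K'] [CompleteSpace K']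
      [TopologicalSpace.SeparableSpace K']
      (θ : EZeroSemigroup K) (θ' : EZeroSemigroup K')
      (J : WithLp 2 (H₁ × H₂) →ₗᵢ[ℂ] K) (J' : WithLp 2 (H₁ × H₂) →ₗᵢ[ℂ] K'),
      IsMinimalDilation (powersSum ϑ₁ ϑ₂ U₁ U₂) θ J →
      IsMinimalDilation (powersSum ϑ₁ ϑ₂ U₁' U₂') θ' J' →
      CocycleConjugate θ θ') :=
  ⟨fun _ _ _ _ _ _ =>
    ⟨ArvesonSystem.spatialProduct_eq _ _ _ _,
      ArvesonSystem.nonempty_iso_of_eq (ArvesonSystem.spatialProduct_eq _ _ _ _)⟩,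
    fun _ _ _ _ _ _ _ _ _ _ _ _ _ _ _ _ _ _ _ _ _ _ _ _ _ _ _ _ _ _ _ _ hd hd' =>
      hd.cocycleConjugate hd'⟩
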